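/- **Networks.** A deterministic multiclass queueing network has finitely many single-server nodes and finitely many classes. Each class $c$ belongs to one server and has a buffer of finite or infinite capacity $B_c$ (the number of waiting jobs it can store, not counting the job in service), a rational service time $m_c\ge 0$, at most one next class (jobs completing class $c$ go there at once, or leave the network if there is none), and possibly external arrivals, exactly at the times $b_c+na_c$, $n=0,1,2,\dots$ ($a_c>0$, $b_c\ge 0$ rational). The zero-one routing matrix $R$ has spectral radius $<1$. With $\lambda_c=1/a_c$ ($0$ without external arrivals) and $\bar\lambda=(I-R^T)^{-1}\lambda$, the load factor of a server $S$ is $\rho_S=\sum_{c\in S}\bar\lambda_c m_c$. A static non-preemptive buffer priority policy $\theta$ is a strict priority order of the classes of each server; a free server starts the waiting job of the highest priority and never interrupts or idles while a job waits. Simultaneous events at a time $t$ are treated as follows: (1) external arrivals at $t$ join their buffers; (2) every free server whose top-priority waiting job has service time $0$ serves it at once and the job is routed, and this is repeated until no such server is left; (3) jobs whose service ends at $t$ are routed; (4) step (2) is repeated; (5) every free server starts its top-priority waiting job; (6) waiting jobs in excess of a buffer's capacity are dropped (so a job is accepted in a buffer of capacity $0$ if and only if it can be served at once). Given initial queue lengths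 $Q(0)$ this determines the queue lengths $Q_c(t)$ (waiting jobs plus the job in service). The triplet (network, $\theta$, $Q(0)$) is *stable* if $\sup_{t\ge0}\sum_c Q_c(t)<\infty$. **Simplified counter machines (SCM).** An SCM has states $\{1,\dots,m\}$ and maps $\alpha:\{1,\dots,m\}\times\{0,1\}^2\to\{1,\dots,m\}$, $\beta:\{1,\dots,m\}\to\{(-1,0),(0,-1),(0,0),(1,0),(0,1)\}$; a configuration $(s,z_1,z_2)$ becomes $(r,(z_1,z_2)+\beta(r))$ with $r=\alpha(s,1\{z_1>0\},1\{z_2>0\})$. It never decrements a zero counter: $\beta(\alpha(s,0,b))\ne(-1,0)$ and $\beta(\alpha(s,b,0))\ne(0,-1)$ for all $s,b$. For a start state $s^*$ it runs from $(s^*,0,0)$; it is *stable* if both counters stay bounded. **The modified network of an SCM.** We list "class: next class; service time; external arrival times; capacity; priority level", writing "–" for no next class (exit) or no external arrivals. Level 1 is the highest, and ties between classes of the same level at a server may be broken arbitrarily; $n=0,1,2,\dots$. For each counter $i=1,2$, the subnetwork $SN_i$: * Server $S_{i1}$: $i11$: $i21$; 0; –; $\infty$; 2. $i12$: –; 0.5;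 –; $\infty$; 1. $i13$: $i31$; 0; $3n+1.6$; 0; 3. $i14$: $i31$; 0; $3n+2.6$; 0; 4. * Server $S_{i2}$: $i21$: –; 0.5; –; $\infty$; 1. $i22$: $i12$; 0; $n$; $\infty$; 2. $i23$: $i31$; 0; $3n+2.1$; 0; 3. * Server $S_{i3}$: $i31$: –; 0.04; –; $\infty$; 2. $i32$: –; 1.1; $3n+1.5$; $\infty$; 1. $i33$: $01i$; 0; $3n+2.7$; 0; 3. * Server $S_{i4}$ (rescaled and shifted times): $i41$: –; $0.2/m$; –; $\infty$; 1. $i42$: $i11$; 0.02; $n$; 0; 2. * Server $S_{i5}$: $i51$: $i11$; 0.02; –; $\infty$; 1 (no longer fed). * Extra blocking server: classes $b^i_{1j}$ ($1\le j\le m$): –; $0.005/m$; –; 0; 1. $b^i_2$: –; 0.03; $3n$; 0; 2. $b^i_3$: $i11$; 0.01; $3n+0.01$; 0; 3. The main network $MN$: * Server $S_{01}$: $011$: –; 0.09; –; $\infty$; 1. $012$: –; 0.18; –; $\infty$; 2. $03j$ ($1\le j\le m$): first stage of $3j1$; 0; –; $\infty$; 3. * Split servers $S_{02j}$ ($1\le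 j\le m$), each serving only the class $02j$: $03j$; 2.71; –; $\infty$; 1. * Split servers $S_{3js}$ ($1\le j\le m$, $1\le s\le 4m$). For each state $k$ put $r_1=\alpha(k,1,1)$, $r_2=\alpha(k,0,1)$, $r_3=\alpha(k,1,0)$, $r_4=\alpha(k,0,0)$. The class $3kl$ ($l=1,\dots,4$) consists of $4m$ stages, stage $s$ being at $S_{3r_ls}$, with service time $0.09/(4m)$, no external arrivals, capacity $\infty$, level 1; each stage leads to the following stage, the last stage of $3kl$ to the first stage of $3k(l+1)$, and the last stage of $3k4$ to the exit. The class $3j5$ consists of $4m$ stages, stage $s$ being at $S_{3js}$, with service time 0, capacity 0, level 2; external arrivals in its first stage at $3n+2.99$; the last stage leads to $4j1$. * Servers $S_{4j}$ ($1\le j\le m$): $4j1$: –; 0.02; –; $\infty$; 1. $4j2$: $02j$; 0; $3n+3$; 0; 2. $4j3$: $141$, $b^1_{1j}$, $241$, $b^2_{1j}$, exit according as $\beta(j)=(-1,0),(1,0),(0,-1),(0,1),(0,0)$; 0; $3n+3$; 0; 3. Initially there is one job in class $02s^*$ and no other job. **Theorem.** (a) For every SCM, every start state $s^*$ and every buffer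 priority policy $\theta$ that respects the levels above, the modified network is a network in the above sense and satisfies: 1. $\rho_S<1$ for every server $S$. 2. It emulates the SCM: if $(s_q,z_1,z_2)$ is the configuration after $t$ steps ($t\ge0$), then at time $3t+1$ the server $S_{02q}$ is serving a job of class $02q$ whose service started at time $3t$, and there is no other job in $MN$. Moreover, for $i=1,2$: $Q_{i12}(3t+1)\,Q_{i21}(3t+1)=0$; immediately before time $3t+1$ no job of $SN_i$ (its blocking server included) is outside the classes $i11,i12,i21,i22$; and $2W_i((3t+1)^-)=z_i$, where $W_i$ is the total remaining service time of the jobs in $i12$ and $i21$ plus $0.5(Q_{i11}+Q_{i22})$. 3. The triplet (modified network, $\theta$, initial state) is stable if and only if the SCM started in $(s^*,0,0)$ is stable. (b) Consequently stability is undecidable even for networks with $\rho_S<1$ for all servers: there is no algorithm (computable function on finite descriptions of triplets) that, for every network, buffer priority policy $\theta$ and vector $Q(0)$ of initial queue lengths such that $\rho_S<1$ for every server $S$, decides correctly whether the triplet is stable (its answers on other inputs being arbitrary). -/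

import Mathlib

namespace MQN

/-! ### Deterministic multiclass queueing networks -/

/-- A deterministic multiclass queueing network with set of servers `S` and set of classes `C`.
Every class `c` belongs to the server `server c`. External jobs arrive in class `c` at the times
`delay c + n * a`, `n = 0, 1, 2, …`, where `interarrival c = some a`; there are none if
`interarrival c = none`. `capacity c` bounds the number of jobs of class `c` that wait (the job in
service is not counted), `none` meaning an infinite buffer. A job that completes service in class
`c` goes to the class `next c`, or leaves the network if `next c = none`. -/
structure Network (S C : Type) where
  server : C → S
  interarrival : C → Option ℚ
  delay : C → ℚ
  service : C → ℚ
  capacity : C → Option ℕ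
  next : C → Option C

/-- Between two events the state is constant: the number of waiting jobs of every class, and for
every server the class of the job in service (if any) with the time at which its service began. -/
structure State (S C : Type) where
  waiting : C → ℕ
  serving : S → Option (C × ℚ)

namespace Network

variable {S C : Type}

/-- The zero-one routing matrix. -/
def routing [DecidableEq C] (N : Network S C) (K : Type) [Zero K] [One K] : Matrix C C K :=
  fun c d => if N.next c = some d then 1 else 0

/-- The standing assumptions on the data of a network. -/
def Valid [Fintype C] [DecidableEq C] (N : Network S C) : Prop :=
  (∀ c, ∀ a ∈ N.interarrival c, 0 < a) ∧ (∀ c, 0 ≤ N.delay c) ∧ (∀ c, 0 ≤ N.service c) ∧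
    spectralRadius ℂ (N.routing ℂ) < 1

/-- A static buffer priority policy: the classes of every server are linearly ordered; a smaller
value of `θ` is a higher priority. -/
def IsPolicy (N : Network S C) (θ : C → ℕ) : Prop :=
  ∀ c d, N.server c = N.server d → θ c = θ d → c = d

/-- The external arrival rates. -/
def externalRate (N : Network S C) (c : C) : ℚ :=
  match N.interarrival c with
  | some a => 1 / a
  | none => 0

/-- The total arrival rates: the solution of the traffic equation. -/
noncomputable def totalRate [Fintype C] [DecidableEq C] (N : Network S C) : C → ℚ :=
  (1 - (N.routing ℚ).transpose)⁻¹.mulVec N.externalRate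

/-- The load factor of a server. -/
noncomputable def load [Fintype C] [DecidableEq C] [DecidableEq S] (N : Network S C) (s : S) : ℚ :=
  ∑ c with N.server c = s, N.totalRate c * N.service c

/-! ### Dynamics under the policy `θ` -/

/-- Class `c` has the highest priority among the classes with waiting jobs at its server. -/
def IsTop (N : Network S C) (θ : C → ℕ) (w : C → ℕ) (c : C) : Prop :=
  0 < w c ∧ ∀ d, N.server d = N.server c → 0 < w d → θ c ≤ θ d

open Classical in
/-- The number of external arrivals in class `c` at time `t`. -/
noncomputable def arrivals (N : Network S C) (t : ℚ) (c : C) : ℕ :=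
  if ∃ a ∈ N.interarrival c, ∃ n : ℕ, t = N.delay c + n * a then 1 else 0

/-- If `y d` jobs leave each class `d`, then `routed y c` of them come to class `c`. -/
def routed [Fintype C] [DecidableEq C] (N : Network S C) (y : C → ℕ) (c : C) : ℕ :=
  ∑ d, if N.next d = some c then y d else 0

/-- External arrivals at time `t` join their buffers. -/
noncomputable def arrive (N : Network S C) (t : ℚ) (x : State S C) : State S C where
  waiting c := x.waiting c + N.arrivals t c
  serving := x.serving

open Classical in
/-- The jobs whose service ends at time `t`. -/
noncomputable def finishing (N : Network S C) (t : ℚ) (x : State S C) (c : C) : ℕ :=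
  if ∃ u, x.serving (N.server c) = some (c, u) ∧ u + N.service c = t then 1 else 0

/-- Jobs whose service ends at time `t` leave their server and are routed. -/
noncomputable def complete [Fintype C] [DecidableEq C] (N : Network S C) (t : ℚ) (x : State S C) :
    State S C where
  waiting c := x.waiting c + N.routed (N.finishing t x) c
  serving s := (x.serving s).filter fun p => decide (p.2 + N.service p.1 ≠ t)

open Classical in
/-- The jobs which can be served at once: the server is free, and the waiting job of highest
priority has service time zero. -/
noncomputable def immediate (N : Network S C) (θ : C → ℕ) (x : State S C) (c : C) : ℕ :=
  if x.serving (N.server c) = none ∧ N.IsTop θ x.waiting c ∧ N.service c = 0 then 1 else 0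

/-- Every free server whose waiting job of highest priority has service time zero serves that
job, and the job is routed. -/
noncomputable def flushStep [Fintype C] [DecidableEq C] (N : Network S C) (θ : C → ℕ)
    (x : State S C) : State S C where
  waiting c := x.waiting c - N.immediate θ x c + N.routed (N.immediate θ x) c
  serving := x.serving

/-- All instantaneous services are carried out. Since the routes of a valid network are acyclic, a
job makes at most as many of them as there are classes, and so the number of iterations below
suffices to reach a fixed point of `flushStep`. -/
noncomputable def flush [Fintype C] [DecidableEq C] (N : Network S C) (θ : C → ℕ)
    (x : State S C) : State S C :=
  (N.flushStep θ)^[(∑ c, x.waiting c) * Fintype.card C] x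

/-- The part of `n` waiting jobs which a buffer can store. -/
def stored : Option ℕ → ℕ → ℕ
  | none, n => n
  | some B, n => min B n

open Classical in
/-- Every free server starts to serve its waiting job of highest priority at time `t`; then jobs in
excess of the capacity of their buffer are dropped. -/
noncomputable def start (N : Network S C) (θ : C → ℕ) (t : ℚ) (x : State S C) : State S C where
  waiting c := stored (N.capacity c)
    (x.waiting c - if x.serving (N.server c) = none ∧ N.IsTop θ x.waiting c then 1 else 0)
  serving s :=
    if x.serving s = none then
      if h : ∃ c, N.server c = s ∧ N.IsTop θ x.waiting c then some (h.choose, t) else none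
    else x.serving s

/-- All that happens at the time `t`. -/
noncomputable def instant [Fintype C] [DecidableEq C] (N : Network S C) (θ : C → ℕ) (t : ℚ)
    (x : State S C) : State S C :=
  N.start θ t (N.flush θ (N.complete t (N.flush θ (N.arrive t x))))

/-- The first external arrival in class `c` after time `t`. -/
def nextArrival (N : Network S C) (t : ℚ) (c : C) : Option ℚ :=
  (N.interarrival c).map fun a =>
    if t < N.delay c then N.delay c else N.delay c + (⌊(t - N.delay c) / a⌋ + 1) * a

/-- The time of the next event after time `t`. For convenience an empty event is inserted when
nothing happens for one unit of time. -/
def nextTime [Fintype S] [Fintype C] (N : Network S C) (t : ℚ) (x : State S C) : ℚ :=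
  (insert (t + 1)
    ((Finset.univ.biUnion fun c => (N.nextArrival t c).toFinset) ∪
      Finset.univ.biUnion fun s =>
        ((x.serving s).map fun p => p.2 + N.service p.1).toFinset)).min'
    (Finset.insert_nonempty _ _)

/-- The sequence of event times and of the states right after the events, for the initial queue
lengths `q`. -/
noncomputable def run [Fintype S] [Fintype C] [DecidableEq C] (N : Network S C) (θ : C → ℕ)
    (q : C → ℕ) : ℕ → ℚ × State S C
  | 0 => (0, N.instant θ 0 ⟨q, fun _ => none⟩)
  | n + 1 =>
    let p := run N θ q n
    (N.nextTime p.1 p.2, N.instant θ (N.nextTime p.1 p.2) p.2)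

/-- The state at time `t ≥ 0` (after the event at time `t`, if there is one). -/
noncomputable def stateAt [Fintype S] [Fintype C] [DecidableEq C] (N : Network S C) (θ : C → ℕ)
    (q : C → ℕ) (t : ℝ) : State S C :=
  (N.run θ q (sSup {n | ((N.run θ q n).1 : ℝ) ≤ t})).2

/-- The state immediately before time `t > 0`. -/
noncomputable def stateBefore [Fintype S] [Fintype C] [DecidableEq C] (N : Network S C) (θ : C → ℕ)
    (q : C → ℕ) (t : ℝ) : State S C :=
  (N.run θ q (sSup {n | ((N.run θ q n).1 : ℝ) < t})).2

open Classical in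
/-- The queue length of class `c`, including the job in service. -/
noncomputable def queueLength (N : Network S C) (x : State S C) (c : C) : ℕ :=
  x.waiting c + if ∃ u, x.serving (N.server c) = some (c, u) then 1 else 0

/-- The time needed at time `t` to serve the jobs which are then in class `c`. -/
def work [DecidableEq C] (N : Network S C) (x : State S C) (t : ℚ) (c : C) : ℚ :=
  N.service c * x.waiting c +
    match x.serving (N.server c) with
    | some (d, u) => if d = c then u + N.service c - t else 0
    | none => 0

/-- Stability of the triplet of a network, a policy and a vector of initial queue lengths. -/
def Stable [Fintype S] [Fintype C] [DecidableEq C] (N : Network S C) (θ : C → ℕ)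
    (q : C → ℕ) : Prop :=
  BddAbove {k : ℕ | ∃ t : ℝ, 0 ≤ t ∧ k = ∑ c, N.queueLength (N.stateAt θ q t) c}

end Network

/-! ### Simplified counter machines -/

/-- A simplified counter machine with `m` states: from state `s`, with `b₁`, `b₂` telling which of
the counters are positive, it goes to the state `r = α s b₁ b₂`, and `β r` is added to the pair of
counters. A counter equal to zero is never decremented. -/
structure SCM (m : ℕ) where
  α : Fin m → Bool → Bool → Fin m
  β : Fin m → ℤ × ℤ
  β_mem : ∀ s, β s = (-1, 0) ∨ β s = (0, -1) ∨ β s = (0, 0) ∨ β s = (1, 0) ∨ β s = (0, 1)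
  consistent₁ : ∀ s b₁ b₂, β (α s b₁ b₂) = (-1, 0) → b₁ = true
  consistent₂ : ∀ s b₁ b₂, β (α s b₁ b₂) = (0, -1) → b₂ = true

namespace SCM

variable {m : ℕ}

/-- The update of a configuration (the truncation `toNat` never takes effect). -/
def step (M : SCM m) (p : Fin m × ℕ × ℕ) : Fin m × ℕ × ℕ :=
  let r := M.α p.1 (decide (0 < p.2.1)) (decide (0 < p.2.2))
  (r, ((p.2.1 : ℤ) + (M.β r).1).toNat, ((p.2.2 : ℤ) + (M.β r).2).toNat)

/-- The configuration after `t` steps from the state `s₀` with both counters zero. -/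
def config (M : SCM m) (s₀ : Fin m) (t : ℕ) : Fin m × ℕ × ℕ :=
  M.step^[t] (s₀, 0, 0)

/-- Both counters stay bounded. -/
def Stable (M : SCM m) (s₀ : Fin m) : Prop :=
  BddAbove (Set.range fun t => (M.config s₀ t).2.1) ∧
    BddAbove (Set.range fun t => (M.config s₀ t).2.2)

end SCM

/-! ### The modified network of a simplified counter machine -/

/-- The servers. `s1 i, …, s5 i` are the five servers of the subnetwork of counter `i`, and
`blk i` is its extra blocking server. The others form the main network; the server of the classes
`02j` is split into the servers `m02 j`, and the server `3j` into the `4m` servers `m3 j s`. -/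
inductive Srv (m : ℕ) : Type
  | s1 (i : Fin 2) | s2 (i : Fin 2) | s3 (i : Fin 2) | s4 (i : Fin 2) | s5 (i : Fin 2)
  | blk (i : Fin 2)
  | m01 | m02 (j : Fin m) | m3 (j : Fin m) (s : Fin (4 * m)) | m4 (j : Fin m)
  deriving DecidableEq, Fintype

/-- The classes. `cjk i` is the class `ijk` of the subnetwork of counter `i`, and `b1 i j`, `b2 i`,
`b3 i` are the classes of its blocking server, `b1 i j` receiving the jobs which the main network
sends to this server from the class `4j3`. `m01 i`, `m02 j`, `m03 j`, `m41 j`, `m42 j`, `m43 j` are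
the classes `01i`, `02j`, `03j`, `4j1`, `4j2`, `4j3` of the main network; `m3 k l s` is the stage
`s` of class `3k(l+1)`, and `m35 j s` the stage `s` of class `3j5`. -/
inductive Cls (m : ℕ) : Type
  | c11 (i : Fin 2) | c12 (i : Fin 2) | c13 (i : Fin 2) | c14 (i : Fin 2)
  | c21 (i : Fin 2) | c22 (i : Fin 2) | c23 (i : Fin 2)
  | c31 (i : Fin 2) | c32 (i : Fin 2) | c33 (i : Fin 2)
  | c41 (i : Fin 2) | c42 (i : Fin 2) | c51 (i : Fin 2)
  | b1 (i : Fin 2) (j : Fin m) | b2 (i : Fin 2) | b3 (i : Fin 2)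
  | m01 (i : Fin 2) | m02 (j : Fin m) | m03 (j : Fin m)
  | m3 (k : Fin m) (l : Fin 4) (s : Fin (4 * m)) | m35 (j : Fin m) (s : Fin (4 * m))
  | m41 (j : Fin m) | m42 (j : Fin m) | m43 (j : Fin m)
  deriving DecidableEq, Fintype

namespace SCM

variable {m : ℕ}

/-- The four possible successors of state `k`, in the order in which they are visited. -/
def successor (M : SCM m) (k : Fin m) (l : Fin 4) : Fin m :=
  ![M.α k true true, M.α k false true, M.α k true false, M.α k false false] l

def serverOf (M : SCM m) : Cls m → Srv m
  | .c11 i | .c12 i | .c13 i | .c14 i => .s1 i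
  | .c21 i | .c22 i | .c23 i => .s2 i
  | .c31 i | .c32 i | .c33 i => .s3 i
  | .c41 i | .c42 i => .s4 i
  | .c51 i => .s5 i
  | .b1 i _ | .b2 i | .b3 i => .blk i
  | .m01 _ | .m03 _ => .m01
  | .m02 j => .m02 j
  | .m3 k l s => .m3 (M.successor k l) s
  | .m35 j s => .m3 j s
  | .m41 j | .m42 j | .m43 j => .m4 j

/-- The pairs (interarrival time, delay) of the classes with external arrivals. -/
def arrivalData : Cls m → Option (ℚ × ℚ)
  | .c13 _ => some (3, 1.6)
  | .c14 _ => some (3, 2.6)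
  | .c22 _ => some (1, 0)
  | .c23 _ => some (3, 2.1)
  | .c32 _ => some (3, 1.5)
  | .c33 _ => some (3, 2.7)
  | .c42 _ => some (1, 0)
  | .b2 _ => some (3, 0)
  | .b3 _ => some (3, 0.01)
  | .m35 _ s => if (s : ℕ) = 0 then some (3, 2.99) else none
  | .m42 _ => some (3, 3)
  | .m43 _ => some (3, 3)
  | _ => none

def serviceTime : Cls m → ℚ
  | .c12 _ => 0.5
  | .c21 _ => 0.5
  | .c31 _ => 0.04
  | .c32 _ => 1.1
  | .c41 _ => 0.2 / m
  | .c42 _ => 0.02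
  | .c51 _ => 0.02
  | .b1 _ _ => 0.005 / m
  | .b2 _ => 0.03
  | .b3 _ => 0.01
  | .m01 i => if i = 0 then 0.09 else 0.18
  | .m02 _ => 2.71
  | .m3 _ _ _ => 0.09 / (4 * m)
  | .m41 _ => 0.02
  | _ => 0

/-- The buffers are infinite, apart from those of capacity zero listed here. -/
def bufferSize : Cls m → Option ℕ
  | .c13 _ | .c14 _ | .c23 _ | .c33 _ | .c42 _ => some 0
  | .b1 _ _ | .b2 _ | .b3 _ => some 0
  | .m35 _ _ | .m42 _ | .m43 _ => some 0
  | _ => none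

/-- The class to which jobs leaving the class `4j3` are sent. -/
def command (M : SCM m) (j : Fin m) : Option (Cls m) :=
  if M.β j = (-1, 0) then some (.c41 0)
  else if M.β j = (1, 0) then some (.b1 0 j)
  else if M.β j = (0, -1) then some (.c41 1)
  else if M.β j = (0, 1) then some (.b1 1 j)
  else none

def nextClass (M : SCM m) : Cls m → Option (Cls m)
  | .c11 i => some (.c21 i)
  | .c13 i | .c14 i | .c23 i => some (.c31 i)
  | .c22 i => some (.c12 i)
  | .c33 i => some (.m01 i)
  | .c42 i | .c51 i | .b3 i => some (.c11 i)
  | .m02 j => some (.m03 j)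
  | .m03 j => some (.m3 j 0 ⟨0, Nat.mul_pos (by norm_num) j.pos⟩)
  | .m3 k l s =>
    if h : (s : ℕ) + 1 < 4 * m then some (.m3 k l ⟨s + 1, h⟩)
    else if h' : (l : ℕ) + 1 < 4 then some (.m3 k ⟨l + 1, h'⟩ ⟨0, s.pos⟩)
    else none
  | .m35 j s => if h : (s : ℕ) + 1 < 4 * m then some (.m35 j ⟨s + 1, h⟩) else some (.m41 j)
  | .m42 j => some (.m02 j)
  | .m43 j => M.command j
  | _ => none

/-- The modified network. -/
def network (M : SCM m) : Network (Srv m) (Cls m) where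
  server := M.serverOf
  interarrival c := (arrivalData c).map Prod.fst
  delay c := ((arrivalData c).map Prod.snd).getD 0
  service := serviceTime
  capacity := bufferSize
  next := M.nextClass

/-- The priority levels within the servers; level `1` is the highest. -/
def level : Cls m → ℕ
  | .c12 _ | .c21 _ | .c32 _ | .c41 _ | .c51 _ | .b1 _ _ => 1
  | .c11 _ | .c22 _ | .c31 _ | .c42 _ | .b2 _ => 2
  | .c13 _ | .c23 _ | .c33 _ | .b3 _ => 3
  | .c14 _ => 4
  | .m01 i => if i = 0 then 1 else 2
  | .m03 _ => 3
  | .m02 _ | .m3 _ _ _ | .m41 _ => 1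
  | .m35 _ _ | .m42 _ => 2
  | .m43 _ => 3

/-- The policy `θ` respects the levels; ties within a level are broken arbitrarily. -/
def RespectsLevels (M : SCM m) (θ : Cls m → ℕ) : Prop :=
  ∀ c d, M.serverOf c = M.serverOf d → level c < level d → θ c < θ d

/-- At time zero there is one job in class `02j`, where `j` is the initial state of the machine,
and there are no other jobs. -/
def initialQueue (s₀ : Fin m) (c : Cls m) : ℕ := if c = .m02 s₀ then 1 else 0

/-- The subnetwork to which a class belongs; `none` is the main network. -/
def subnetwork : Cls m → Option (Fin 2)
  | .c11 i | .c12 i | .c13 i | .c14 i | .c21 i | .c22 i | .c23 i | .c31 i | .c32 i | .c33 i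
  | .c41 i | .c42 i | .c51 i | .b1 i _ | .b2 i | .b3 i => some i
  | _ => none

/-- At time `t + 1` the main network holds exactly one job, which is of class `02k` and is in
service since time `t`. -/
def MainStatus (M : SCM m) (θ : Cls m → ℕ) (s₀ : Fin m) (t : ℕ) (k : Fin m) : Prop :=
  let x := M.network.stateAt θ (initialQueue s₀) (t + 1)
  x.serving (.m02 k) = some (.m02 k, (t : ℚ)) ∧
    ∀ c, subnetwork c = none → M.network.queueLength x c = if c = .m02 k then 1 else 0

/-- The workload of the servers `i1` and `i2` immediately before time `t`. -/
noncomputable def workloadBefore (M : SCM m) (θ : Cls m → ℕ) (s₀ : Fin m) (i : Fin 2)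
    (t : ℕ) : ℚ :=
  let x := M.network.stateBefore θ (initialQueue s₀) t
  M.network.work x t (.c12 i) + M.network.work x t (.c21 i) +
    0.5 * M.network.queueLength x (.c22 i) + 0.5 * M.network.queueLength x (.c11 i)

/-- The subnetwork `i` displays the counter value `z` at time `t`: not both of the classes `i12`,
`i21` hold jobs at time `t`, immediately before time `t` no jobs of the subnetwork are outside the
classes `i11`, `i12`, `i21`, `i22`, and twice the workload of the servers `i1`, `i2` immediately
before time `t` is `z`. -/
def CounterStatus (M : SCM m) (θ : Cls m → ℕ) (s₀ : Fin m) (i : Fin 2) (t z : ℕ) : Prop :=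
  M.network.queueLength (M.network.stateAt θ (initialQueue s₀) t) (.c12 i) *
      M.network.queueLength (M.network.stateAt θ (initialQueue s₀) t) (.c21 i) = 0 ∧
    (∀ c, subnetwork c = some i → c ≠ .c11 i → c ≠ .c12 i → c ≠ .c21 i → c ≠ .c22 i →
      M.network.queueLength (M.network.stateBefore θ (initialQueue s₀) t) c = 0) ∧
    2 * M.workloadBefore θ s₀ i t = z

end SCM

/-! ### Networks as inputs of algorithms -/

/-- The description of one class: the number of its server, the pair of its interarrival time and
delay (if it has external arrivals), its service time, its capacity (`none` is infinite), the number
of its next class, its priority and its initial queue length. The pair `(p, q)` of natural numbers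
stands for the rational number `p / (q + 1)`. -/
structure ClassSpec where
  server : ℕ
  arrival : Option ((ℕ × ℕ) × (ℕ × ℕ))
  service : ℕ × ℕ
  capacity : Option ℕ
  next : Option ℕ
  priority : ℕ
  initial : ℕ

/-- The finite description of a triplet of a network, a policy and initial queue lengths. -/
structure NetworkInput where
  numServers : ℕ
  classes : List ClassSpec

def ClassSpec.equivTuple : ClassSpec ≃
    ℕ × Option ((ℕ × ℕ) × (ℕ × ℕ)) × (ℕ × ℕ) × Option ℕ × Option ℕ × ℕ × ℕ where
  toFun c := (c.server, c.arrival, c.service, c.capacity, c.next, c.priority, c.initial)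
  invFun p := ⟨p.1, p.2.1, p.2.2.1, p.2.2.2.1, p.2.2.2.2.1, p.2.2.2.2.2.1, p.2.2.2.2.2.2⟩
  left_inv _ := rfl
  right_inv _ := rfl

instance : Primcodable ClassSpec := Primcodable.ofEquiv _ ClassSpec.equivTuple

def NetworkInput.equivTuple : NetworkInput ≃ ℕ × List ClassSpec where
  toFun I := (I.numServers, I.classes)
  invFun p := ⟨p.1, p.2⟩
  left_inv _ := rfl
  right_inv _ := rfl

instance : Primcodable NetworkInput := Primcodable.ofEquiv _ NetworkInput.equivTuple

def ratOf (p : ℕ × ℕ) : ℚ := p.1 / (p.2 + 1)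

namespace NetworkInput

/-- The numbers of servers and classes which occur in the description are meaningful. -/
def InRange (I : NetworkInput) : Prop :=
  ∀ c : Fin I.classes.length, (I.classes.get c).server < I.numServers ∧
    ∀ d ∈ (I.classes.get c).next, d < I.classes.length

def network (I : NetworkInput) (h : I.InRange) :
    Network (Fin I.numServers) (Fin I.classes.length) where
  server c := ⟨(I.classes.get c).server, (h c).1⟩
  interarrival c := (I.classes.get c).arrival.map fun p => ratOf p.1
  delay c := ((I.classes.get c).arrival.map fun p => ratOf p.2).getD 0
  service c := ratOf (I.classes.get c).service
  capacity c := (I.classes.get c).capacity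
  next c := (I.classes.get c).next.pmap Fin.mk (h c).2

def policy (I : NetworkInput) (c : Fin I.classes.length) : ℕ := (I.classes.get c).priority

def initialQueue (I : NetworkInput) (c : Fin I.classes.length) : ℕ := (I.classes.get c).initial

end NetworkInput

end MQN

/-!
Emulation. All data of the modified network are multiples of `1 / (400 * m)`, so nothing happens
outside this grid, and the dynamics reduce to a recursion over its ticks (`Network.gridState`,
`Network.run_eq_gridState`). One step of the machine takes a cycle of three units of time, that is
`1200 * m` ticks.

In a subnetwork, the counter is the workload of the servers `i1` and `i2`: their jobs alternate
between the class `i12`, fed through `i22`, and the class `i21`, fed through `i11`, and never are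
both in service, as the higher priority of the class in service keeps the other route closed
(`Core`). Every unit of time drains the same amount of work that the regular arrivals bring in,
unless a job sent by the main network changes the balance: one in class `i41` blocks a job of class
`i42`, which lowers the workload, and one in a class `b1` ends early enough for a job of class `b3`
to pass, which raises it. The jobs of the classes `i13`, `i14`, `i23` pass only if they find their
server idle; all three do so if and only if the new counter is zero, and then they occupy the
server `i3` so long that the job of class `i33` is lost, which otherwise reaches the main network
(`SubStart.cycle`).

In the main network, the jobs so received keep the server `01` busy for `0`, `0.09`, `0.18` or
`0.27` units of time, and only then the job of class `03k` enters the chain of stages. At the time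
`3t + 2.99` it is therefore in the stages located at the servers `3r`, where `r` is the successor
of `k` for the current signs of the counters. The job of class `3r5` finds one of these servers
busy and is lost; for the other states `j` the job of class `3j5` passes and occupies the server
`4j`. Hence at time `3t + 3` just the server `4r` is free, starts the job of class `02r`, and sends
the command `β r` to the subnetworks (`MainStart.cycle`). Both parts combine to `CycleStart.cycle`,
and by induction to `emulates`.

Stability. At the tick considered in `emulates` every queue length is bounded in terms of the
counters, and conversely; during one cycle the queues grow by a bounded amount
(`Setting.stable_iff`). Routes are acyclic, so the routing matrix is nilpotent, and the load
factors come from an explicit solution of the traffic equation (`Setting.load_lt_one`).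

Undecidability. The halting problem asks for a zero of a primitive recursive function `g (n, ·)`.
Primitive recursive functions are computed by programs for registers (`Program.exists_implements`),
and so there is a program which searches for a zero. Let the exponents of the primes in the number
`N` be the contents of the registers. Then each step of the program is affine in `N` on the residue
classes of a modulus, and can be made by a machine with two counters (`Program.moves_exec`). The
search with input `n` starts with the counters `2 ^ n` and `0`; it stays bounded if it ends, and
otherwise tests arbitrarily large numbers (`Program.exists_scm`). The network of this machine is
fixed, and the initial counter `2 ^ n` is a number of jobs in class `112`. So the description of
the triplet is computable in `n`, and a decision procedure for its stability would solve the
halting problem (`not_decidable_stable`).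
-/

namespace MQN

namespace Network

variable {S C : Type}

/-! ### Instantaneous services -/

/-- Routes are acyclic: some rank decreases along every route. -/
def Acyclic (N : Network S C) : Prop := ∃ r : C → ℕ, ∀ c d, N.next c = some d → r d < r c

theorem immediate_le (N : Network S C) (θ : C → ℕ) (x : State S C) (c : C) :
    N.immediate θ x c ≤ x.waiting c := by
  unfold immediate
  split_ifs with h
  · exact h.2.1.1
  · exact Nat.zero_le _

theorem immediate_of_service_ne (N : Network S C) (θ : C → ℕ) (x : State S C) {c : C}
    (hc : N.service c ≠ 0) : N.immediate θ x c = 0 := by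
  unfold immediate
  rw [if_neg fun h => hc h.2.2]

/-- At the time `t` the server `s` is free, or its service ends. -/
def FreeAt (N : Network S C) (t : ℚ) (x : State S C) (s : S) : Prop :=
  ∀ p, x.serving s = some p → p.2 + N.service p.1 = t

theorem exists_isTop (N : Network S C) (θ : C → ℕ) (w : C → ℕ) {c : C} (hc : 0 < w c) :
    ∃ e, N.server e = N.server c ∧ N.IsTop θ w e := by
  obtain ⟨e, he, hmin⟩ :=
    WellFounded.has_min (measure θ).wf {e | N.server e = N.server c ∧ 0 < w e} ⟨c, rfl, hc⟩
  refine ⟨e, he.1, he.2, fun d hd hw => ?_⟩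
  by_contra hlt
  exact hmin d ⟨hd.trans he.1, hw⟩ (not_le.1 hlt)

theorem finishing_congr (N : Network S C) (t : ℚ) {x y : State S C} (h : x.serving = y.serving) :
    N.finishing t x = N.finishing t y := by
  funext c
  unfold finishing
  rw [h]

theorem finishing_of_serving (N : Network S C) {t : ℚ} {x : State S C} {c d : C} {u : ℚ}
    (h : x.serving (N.server d) = some (c, u)) (hne : c ≠ d ∨ u + N.service c ≠ t) :
    N.finishing t x d = 0 := by
  unfold finishing
  rw [if_neg]
  rintro ⟨v, hv, hv'⟩
  rw [h] at hv
  simp only [Option.some.injEq, Prod.mk.injEq] at hv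
  obtain ⟨rfl, rfl⟩ := hv
  rcases hne with h | h <;> exact h (by first | rfl | exact hv')

theorem finishing_of_none (N : Network S C) {t : ℚ} {x : State S C} {d : C}
    (h : x.serving (N.server d) = none) : N.finishing t x d = 0 := by
  unfold finishing
  rw [if_neg]
  rintro ⟨v, hv, -⟩
  rw [h] at hv
  exact absurd hv (by simp)

theorem finishing_of_end (N : Network S C) {t : ℚ} {x : State S C} {d : C} {u : ℚ}
    (h : x.serving (N.server d) = some (d, u)) (ht : u + N.service d = t) :
    N.finishing t x d = 1 := by
  unfold finishing
  rw [if_pos ⟨u, h, ht⟩]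

/-- The service in progress at a server, if any, is of a class with a positive service time. -/
def State.Positive (N : Network S C) (x : State S C) : Prop :=
  ∀ c u, x.serving (N.server c) = some (c, u) → N.service c ≠ 0

theorem finishing_of_service_eq (N : Network S C) {t : ℚ} {x : State S C}
    (hx : State.Positive N x) {c : C} (hc : N.service c = 0) : N.finishing t x c = 0 := by
  unfold finishing
  rw [if_neg]
  rintro ⟨u, hu, -⟩
  exact hx c u hu hc

theorem stored_zero (o : Option ℕ) : stored o 0 = 0 := by
  cases o <;> simp [stored]

theorem stored_le (o : Option ℕ) (n : ℕ) : stored o n ≤ n := by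
  cases o <;> simp [stored]

variable [Fintype C] [DecidableEq C]

theorem routed_add (N : Network S C) (y z : C → ℕ) (c : C) :
    N.routed (fun d => y d + z d) c = N.routed y c + N.routed z c := by
  unfold routed
  rw [← Finset.sum_add_distrib]
  exact Finset.sum_congr rfl fun d _ => by split_ifs <;> simp

/-- The total number of jobs routed does not exceed the number of jobs which leave their classes,
since a job has at most one next class. -/
theorem sum_routed_le (N : Network S C) (y : C → ℕ) : ∑ c, N.routed y c ≤ ∑ d, y d := by
  have h1 : ∑ c, N.routed y c = ∑ d, ∑ c, if N.next d = some c then y d else 0 :=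
    Finset.sum_comm
  rw [h1]
  refine Finset.sum_le_sum fun d _ => ?_
  cases h : N.next d <;> simp

/-- The number of instantaneous services of jobs of class `c` in the first `n` rounds. -/
noncomputable def flushedIn (N : Network S C) (θ : C → ℕ) (x : State S C) (n : ℕ) (c : C) : ℕ :=
  (Finset.range n).sum fun k => N.immediate θ ((N.flushStep θ)^[k] x) c

/-- The number of instantaneous services of jobs of class `c`. -/
noncomputable def flushed (N : Network S C) (θ : C → ℕ) (x : State S C) (c : C) : ℕ :=
  N.flushedIn θ x ((∑ c, x.waiting c) * Fintype.card C) c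

theorem serving_iterate (N : Network S C) (θ : C → ℕ) (x : State S C) (n : ℕ) :
    ((N.flushStep θ)^[n] x).serving = x.serving := by
  induction n with
  | zero => rfl
  | succ n ih => rw [Function.iterate_succ_apply']; exact ih

theorem waiting_iterate (N : Network S C) (θ : C → ℕ) (x : State S C) (n : ℕ) (c : C) :
    ((N.flushStep θ)^[n] x).waiting c + N.flushedIn θ x n c =
      x.waiting c + N.routed (N.flushedIn θ x n) c := by
  induction n with
  | zero => simp [flushedIn, routed]
  | succ n ih =>
    have h1 : N.flushedIn θ x (n + 1) =
        fun d => N.flushedIn θ x n d + N.immediate θ ((N.flushStep θ)^[n] x) d := by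
      funext d
      exact Finset.sum_range_succ _ _
    have h2 := N.immediate_le θ ((N.flushStep θ)^[n] x) c
    rw [h1, routed_add, Function.iterate_succ_apply']
    change (_ - _ + _) + _ = _
    simp only
    omega

theorem flushedIn_of_service_ne (N : Network S C) (θ : C → ℕ) (x : State S C) (n : ℕ) {c : C}
    (hc : N.service c ≠ 0) : N.flushedIn θ x n c = 0 :=
  Finset.sum_eq_zero fun _ _ => N.immediate_of_service_ne θ _ hc

theorem flush_serving (N : Network S C) (θ : C → ℕ) (x : State S C) :
    (N.flush θ x).serving = x.serving := N.serving_iterate θ x _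

theorem flush_waiting (N : Network S C) (θ : C → ℕ) (x : State S C) (c : C) :
    (N.flush θ x).waiting c + N.flushed θ x c = x.waiting c + N.routed (N.flushed θ x) c :=
  N.waiting_iterate θ x _ c

theorem flushed_of_service_ne (N : Network S C) (θ : C → ℕ) (x : State S C) {c : C}
    (hc : N.service c ≠ 0) : N.flushed θ x c = 0 := N.flushedIn_of_service_ne θ x _ hc

theorem flushed_of_serving (N : Network S C) (θ : C → ℕ) (x : State S C) {c : C}
    (hc : x.serving (N.server c) ≠ none) : N.flushed θ x c = 0 := by
  unfold flushed flushedIn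
  refine Finset.sum_eq_zero fun k _ => ?_
  unfold immediate
  rw [if_neg]
  rw [serving_iterate]
  exact fun h => hc h.1

theorem flushed_le (N : Network S C) (θ : C → ℕ) (x : State S C) (c : C) :
    N.flushed θ x c ≤ x.waiting c + N.routed (N.flushed θ x) c := by
  have := N.flush_waiting θ x c
  omega

/-- A waiting job that needs a positive service time keeps the jobs of lower priority at its server
from instantaneous service. -/
theorem flushed_of_blocked (N : Network S C) (θ : C → ℕ) (x : State S C) {c d : C}
    (hs : N.server d = N.server c) (hd : N.service d ≠ 0) (hw : 0 < x.waiting d)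
    (hp : θ d < θ c) : N.flushed θ x c = 0 := by
  unfold flushed flushedIn
  refine Finset.sum_eq_zero fun k _ => ?_
  unfold immediate
  rw [if_neg]
  rintro ⟨-, h, -⟩
  have h1 := N.waiting_iterate θ x k d
  rw [N.flushedIn_of_service_ne θ x k hd] at h1
  have h2 := h.2 d hs (by omega)
  omega

/-- Every round of instantaneous services lowers the weighted number of waiting jobs, if the weights
decrease along the routes. -/
theorem potential_flushStep (N : Network S C) (θ : C → ℕ) (x : State S C) {h : C → ℕ}
    (hpos : ∀ c, 0 < h c) (hh : ∀ c d, N.next c = some d → h d < h c) :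
    ∑ c, h c * (N.flushStep θ x).waiting c + ∑ c, N.immediate θ x c ≤ ∑ c, h c * x.waiting c := by
  have e1 : ∑ c, h c * N.routed (N.immediate θ x) c + ∑ c, N.immediate θ x c
      ≤ ∑ c, h c * N.immediate θ x c := by
    unfold routed
    simp_rw [Finset.mul_sum]
    rw [Finset.sum_comm, ← Finset.sum_add_distrib]
    refine Finset.sum_le_sum fun d _ => ?_
    cases hd : N.next d with
    | none =>
      have := Nat.mul_le_mul_right (N.immediate θ x d) (Nat.succ_le_of_lt (hpos d))
      simpa using this
    | some e =>
      have := Nat.mul_le_mul_right (N.immediate θ x d) (Nat.succ_le_of_lt (hh d e hd))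
      simp only [Option.some.injEq, mul_ite, mul_zero, Finset.sum_ite_eq, Finset.mem_univ, if_true]
      linarith
  have e2 : ∑ c, h c * (N.flushStep θ x).waiting c + ∑ c, h c * N.immediate θ x c
      = ∑ c, h c * x.waiting c + ∑ c, h c * N.routed (N.immediate θ x) c := by
    rw [← Finset.sum_add_distrib, ← Finset.sum_add_distrib]
    refine Finset.sum_congr rfl fun c _ => ?_
    have := N.immediate_le θ x c
    rw [← mul_add, ← mul_add]
    congr 1
    change (_ - _ + _) + _ = _
    omega
  omega

theorem flushStep_eq_self (N : Network S C) (θ : C → ℕ) (x : State S C)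
    (h : ∀ c, N.immediate θ x c = 0) : N.flushStep θ x = x := by
  have : N.immediate θ x = fun _ => 0 := funext h
  unfold flushStep
  simp [this, routed]

/-- In an acyclic network the instantaneous services come to an end. -/
theorem immediate_flush (N : Network S C) (hN : N.Acyclic) (θ : C → ℕ) (x : State S C) (c : C) :
    N.immediate θ (N.flush θ x) c = 0 := by
  obtain ⟨r, hr⟩ := hN
  -- the weight of a class is the number of classes whose rank is not larger
  set h : C → ℕ := fun c => (Finset.univ.filter fun d => r d ≤ r c).card with hdef
  have hpos : ∀ c, 0 < h c := fun c => Finset.card_pos.2 ⟨c, by simp⟩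
  have hh : ∀ c d, N.next c = some d → h d < h c := by
    intro c d hcd
    have := hr c d hcd
    refine Finset.card_lt_card ⟨fun e => ?_, fun hsub => ?_⟩
    · simp only [Finset.mem_filter, Finset.mem_univ, true_and]; omega
    · have h1 : c ∈ Finset.univ.filter fun e => r e ≤ r d := hsub (by simp)
      rw [Finset.mem_filter] at h1
      omega
  set n := (∑ c, x.waiting c) * Fintype.card C with hn
  by_cases hex : ∃ k ≤ n, ∀ c, N.immediate θ ((N.flushStep θ)^[k] x) c = 0
  · obtain ⟨k, hk, hk0⟩ := hex
    have hst : ∀ j, (N.flushStep θ)^[k + j] x = (N.flushStep θ)^[k] x := by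
      intro j
      induction j with
      | zero => rfl
      | succ j ih =>
        rw [← add_assoc, Function.iterate_succ_apply', ih, N.flushStep_eq_self θ _ hk0]
    unfold flush
    rw [← hn, ← Nat.add_sub_cancel' hk, hst]
    exact hk0 c
  · push Not at hex
    have hb : ∀ k ≤ n, ∑ c, h c * ((N.flushStep θ)^[k] x).waiting c + k ≤ n := by
      intro k hk
      induction k with
      | zero =>
        simp only [Function.iterate_zero, id, add_zero]
        rw [hn, Finset.sum_mul]
        refine Finset.sum_le_sum fun c _ => ?_
        rw [mul_comm]
        exact Nat.mul_le_mul_left _ (Finset.card_le_univ _)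
      | succ k ih =>
        have h1 := ih (by omega)
        obtain ⟨c, hc⟩ := hex k (by omega)
        have h2 := N.potential_flushStep θ ((N.flushStep θ)^[k] x) hpos hh
        have h3 : N.immediate θ ((N.flushStep θ)^[k] x) c ≤
            ∑ c, N.immediate θ ((N.flushStep θ)^[k] x) c :=
          Finset.single_le_sum (f := fun c => N.immediate θ ((N.flushStep θ)^[k] x) c)
            (fun _ _ => Nat.zero_le _) (Finset.mem_univ c)
        rw [Function.iterate_succ_apply']
        omega
    have h0 := hb n le_rfl
    have h1 : h c * (N.flush θ x).waiting c ≤ ∑ c, h c * ((N.flushStep θ)^[n] x).waiting c :=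
      Finset.single_le_sum (f := fun c => h c * ((N.flushStep θ)^[n] x).waiting c)
        (fun _ _ => Nat.zero_le _) (Finset.mem_univ c)
    have h2 : h c * (N.flush θ x).waiting c = 0 := by omega
    have h3 := N.immediate_le θ (N.flush θ x) c
    rcases Nat.mul_eq_zero.1 h2 with h4 | h4
    · exact absurd h4 (hpos c).ne'
    · omega

/-- After the instantaneous services, the waiting job of highest priority at a free server needs a
positive service time. -/
theorem service_ne_of_isTop_flush (N : Network S C) (hN : N.Acyclic) (θ : C → ℕ) (x : State S C)
    {c : C} (hs : x.serving (N.server c) = none) (hc : N.IsTop θ (N.flush θ x).waiting c) :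
    N.service c ≠ 0 := by
  intro h0
  have := N.immediate_flush hN θ x c
  unfold immediate at this
  rw [if_pos ⟨by rw [flush_serving]; exact hs, hc, h0⟩] at this
  exact one_ne_zero this

/-! ### One instant -/

/-- The state right before step (5) of the instant `t`. -/
noncomputable def beforeStart (N : Network S C) (θ : C → ℕ) (t : ℚ) (x : State S C) : State S C :=
  N.flush θ (N.complete t (N.flush θ (N.arrive t x)))

/-- The number of jobs that leave class `c` at time `t`. -/
noncomputable def outflow (N : Network S C) (θ : C → ℕ) (t : ℚ) (x : State S C) (c : C) : ℕ :=
  N.flushed θ (N.arrive t x) c + N.finishing t x c +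
    N.flushed θ (N.complete t (N.flush θ (N.arrive t x))) c

/-- The number of jobs that join class `c` at time `t`. -/
noncomputable def inflow (N : Network S C) (θ : C → ℕ) (t : ℚ) (x : State S C) (c : C) : ℕ :=
  N.arrivals t c + N.routed (N.outflow θ t x) c

theorem flush_arrive_serving (N : Network S C) (θ : C → ℕ) (t : ℚ) (x : State S C) :
    (N.flush θ (N.arrive t x)).serving = x.serving := by
  rw [flush_serving]; rfl

theorem complete_waiting (N : Network S C) (θ : C → ℕ) (t : ℚ) (x : State S C) (c : C) :
    (N.complete t (N.flush θ (N.arrive t x))).waiting c + N.flushed θ (N.arrive t x) c =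
      x.waiting c + N.arrivals t c + N.routed (N.flushed θ (N.arrive t x)) c +
        N.routed (N.finishing t x) c := by
  have h1 := N.flush_waiting θ (N.arrive t x) c
  have h2 : (N.arrive t x).waiting c = x.waiting c + N.arrivals t c := rfl
  have h3 : (N.complete t (N.flush θ (N.arrive t x))).waiting c =
      (N.flush θ (N.arrive t x)).waiting c + N.routed (N.finishing t x) c := by
    rw [← N.finishing_congr t (N.flush_arrive_serving θ t x)]; rfl
  omega

theorem complete_serving (N : Network S C) (θ : C → ℕ) (t : ℚ) (x : State S C) (s : S) :
    (N.complete t (N.flush θ (N.arrive t x))).serving s =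
      (x.serving s).filter fun p => decide (p.2 + N.service p.1 ≠ t) := by
  rw [← N.flush_arrive_serving θ t x]; rfl

theorem beforeStart_serving (N : Network S C) (θ : C → ℕ) (t : ℚ) (x : State S C) (s : S) :
    (N.beforeStart θ t x).serving s =
      (x.serving s).filter fun p => decide (p.2 + N.service p.1 ≠ t) := by
  unfold beforeStart
  rw [flush_serving, complete_serving]

theorem FreeAt.complete_serving {N : Network S C} {t : ℚ} {x : State S C} {s : S}
    (h : N.FreeAt t x s) (θ : C → ℕ) :
    (N.complete t (N.flush θ (N.arrive t x))).serving s = none := by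
  rw [Network.complete_serving]
  cases hx : x.serving s with
  | none => rfl
  | some p => simp [h p hx]

theorem FreeAt.beforeStart_serving {N : Network S C} {t : ℚ} {x : State S C} {s : S}
    (h : N.FreeAt t x s) (θ : C → ℕ) : (N.beforeStart θ t x).serving s = none := by
  unfold beforeStart
  rw [flush_serving, h.complete_serving]

theorem routed_outflow (N : Network S C) (θ : C → ℕ) (t : ℚ) (x : State S C) (c : C) :
    N.routed (N.outflow θ t x) c = N.routed (N.flushed θ (N.arrive t x)) c +
      N.routed (N.finishing t x) c +
        N.routed (N.flushed θ (N.complete t (N.flush θ (N.arrive t x)))) c := by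
  unfold outflow
  rw [routed_add, routed_add]

/-- Conservation of jobs. -/
theorem beforeStart_waiting (N : Network S C) (θ : C → ℕ) (t : ℚ) (x : State S C) (c : C) :
    (N.beforeStart θ t x).waiting c + N.outflow θ t x c =
      x.waiting c + N.inflow θ t x c + N.finishing t x c := by
  have h1 := N.complete_waiting θ t x c
  have h2 := N.flush_waiting θ (N.complete t (N.flush θ (N.arrive t x))) c
  have h3 : (N.beforeStart θ t x).waiting c =
    (N.flush θ (N.complete t (N.flush θ (N.arrive t x)))).waiting c := rfl
  unfold inflow
  rw [routed_outflow]
  unfold outflow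
  omega

theorem outflow_of_service_ne (N : Network S C) (θ : C → ℕ) (t : ℚ) (x : State S C) {c : C}
    (hc : N.service c ≠ 0) : N.outflow θ t x c = N.finishing t x c := by
  unfold outflow
  rw [flushed_of_service_ne _ _ _ hc, flushed_of_service_ne _ _ _ hc]
  omega

theorem beforeStart_waiting_of_service_ne (N : Network S C) (θ : C → ℕ) (t : ℚ) (x : State S C)
    {c : C} (hc : N.service c ≠ 0) :
    (N.beforeStart θ t x).waiting c = x.waiting c + N.inflow θ t x c := by
  have h1 := N.beforeStart_waiting θ t x c
  have h2 := N.outflow_of_service_ne θ t x hc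
  omega

theorem outflow_le (N : Network S C) (θ : C → ℕ) (t : ℚ) {x : State S C}
    (hx : State.Positive N x) {c : C} (hc : N.service c = 0) :
    N.outflow θ t x c ≤ x.waiting c + N.inflow θ t x c := by
  have h1 := N.beforeStart_waiting θ t x c
  have h2 := N.finishing_of_service_eq (t := t) hx hc
  omega

theorem instant_serving (N : Network S C) (θ : C → ℕ) (t : ℚ) (x : State S C) (s : S) :
    (N.instant θ t x).serving s = (N.start θ t (N.beforeStart θ t x)).serving s := rfl

/-- A server whose service does not end goes on with it, and no job leaves a class of it. -/
theorem instant_serving_of_busy (N : Network S C) (θ : C → ℕ) {t : ℚ} {x : State S C} {s : S}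
    {c : C} {u : ℚ} (h : x.serving s = some (c, u)) (ht : u + N.service c ≠ t) :
    (N.instant θ t x).serving s = some (c, u) := by
  have : (N.beforeStart θ t x).serving s = some (c, u) := by
    rw [beforeStart_serving, h]; simp [ht]
  rw [instant_serving]
  unfold start
  simp [this]

theorem outflow_of_busy (N : Network S C) (θ : C → ℕ) {t : ℚ} {x : State S C} {d : C}
    {c : C} {u : ℚ} (h : x.serving (N.server d) = some (c, u)) (ht : u + N.service c ≠ t) :
    N.outflow θ t x d = 0 := by
  unfold outflow
  rw [N.finishing_of_serving h (Or.inr ht), flushed_of_serving, flushed_of_serving]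
  · rw [complete_serving, h]; simp [ht]
  · change x.serving (N.server d) ≠ none; simp [h]

theorem instant_waiting_of_busy (N : Network S C) (θ : C → ℕ) {t : ℚ} {x : State S C} {d : C}
    {c : C} {u : ℚ} (h : x.serving (N.server d) = some (c, u)) (ht : u + N.service c ≠ t) :
    (N.instant θ t x).waiting d = stored (N.capacity d) (x.waiting d + N.inflow θ t x d) := by
  have h1 : (N.beforeStart θ t x).serving (N.server d) = some (c, u) := by
    rw [beforeStart_serving, h]; simp [ht]
  have h2 := N.beforeStart_waiting θ t x d
  rw [N.outflow_of_busy θ h ht, N.finishing_of_serving h (Or.inr ht)] at h2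
  change (N.start θ t (N.beforeStart θ t x)).waiting d = _
  unfold start
  simp only [add_zero] at h2
  simp only [h1, reduceCtorEq, false_and, if_false, h2, Nat.sub_zero]

theorem beforeStart_waiting_eq_zero (N : Network S C) (hN : N.Acyclic) (θ : C → ℕ) {t : ℚ}
    {x : State S C} {s : S} (hf : N.FreeAt t x s)
    (h : ∀ d, N.server d = s → N.service d ≠ 0 → x.waiting d + N.inflow θ t x d = 0) {d : C}
    (hd : N.server d = s) : (N.beforeStart θ t x).waiting d = 0 := by
  by_contra hne
  obtain ⟨e, he, htop⟩ := N.exists_isTop θ _ (Nat.pos_of_ne_zero hne)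
  have hfree := hf.complete_serving θ
  rw [← hd, ← he] at hfree
  have h1 := N.service_ne_of_isTop_flush hN θ _ hfree htop
  have h2 := N.beforeStart_waiting_of_service_ne θ t x h1
  have h3 := h e (he.trans hd) h1
  have h4 : 0 < (N.beforeStart θ t x).waiting e := htop.1
  omega

/-- A free server gets idle if no jobs with a positive service time are present. -/
theorem instant_serving_of_idle (N : Network S C) (hN : N.Acyclic) (θ : C → ℕ) {t : ℚ}
    {x : State S C} {s : S} (hf : N.FreeAt t x s)
    (h : ∀ d, N.server d = s → N.service d ≠ 0 → x.waiting d + N.inflow θ t x d = 0) :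
    (N.instant θ t x).serving s = none := by
  rw [instant_serving]
  unfold start
  simp only [hf.beforeStart_serving θ, if_true]
  rw [dif_neg]
  rintro ⟨c, hc, htop⟩
  have := N.beforeStart_waiting_eq_zero hN θ hf h hc
  have := htop.1
  omega

theorem outflow_of_idle (N : Network S C) (hN : N.Acyclic) (θ : C → ℕ) {t : ℚ}
    {x : State S C} {s : S} (hx : State.Positive N x) (hf : N.FreeAt t x s)
    (h : ∀ d, N.server d = s → N.service d ≠ 0 → x.waiting d + N.inflow θ t x d = 0) {d : C}
    (hd : N.server d = s) (h0 : N.service d = 0) :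
    N.outflow θ t x d = x.waiting d + N.inflow θ t x d := by
  have h1 := N.beforeStart_waiting_eq_zero hN θ hf h hd
  have h2 := N.beforeStart_waiting θ t x d
  have h3 := N.finishing_of_service_eq (t := t) hx h0
  omega

/-- A free server starts to serve a job of the class `c`, if this class has the highest priority
among the classes with positive service time of which jobs are present. -/
theorem isTop_beforeStart (N : Network S C) (hN : N.Acyclic) {θ : C → ℕ} {t : ℚ}
    {x : State S C} {c : C} (hf : N.FreeAt t x (N.server c)) (hc : N.service c ≠ 0)
    (hw : 0 < x.waiting c + N.inflow θ t x c)
    (h : ∀ d, N.server d = N.server c → N.service d ≠ 0 → 0 < x.waiting d + N.inflow θ t x d →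
      θ c ≤ θ d) : N.IsTop θ (N.beforeStart θ t x).waiting c := by
  have hw' := N.beforeStart_waiting_of_service_ne θ t x hc
  refine ⟨by omega, fun d hd hdw => ?_⟩
  obtain ⟨e, he, htop⟩ := N.exists_isTop θ _ hdw
  have hfree := hf.complete_serving θ
  rw [← hd, ← he] at hfree
  have h1 := N.service_ne_of_isTop_flush hN θ _ hfree htop
  have h2 := N.beforeStart_waiting_of_service_ne θ t x h1
  have h4 : 0 < (N.beforeStart θ t x).waiting e := htop.1
  exact (h e (he.trans hd) h1 (by omega)).trans (htop.2 d he.symm hdw)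

theorem instant_serving_of_start (N : Network S C) (hN : N.Acyclic) {θ : C → ℕ}
    (hθ : N.IsPolicy θ) {t : ℚ}
    {x : State S C} {c : C} (hf : N.FreeAt t x (N.server c)) (hc : N.service c ≠ 0)
    (hw : 0 < x.waiting c + N.inflow θ t x c)
    (h : ∀ d, N.server d = N.server c → N.service d ≠ 0 → 0 < x.waiting d + N.inflow θ t x d →
      θ c ≤ θ d) : (N.instant θ t x).serving (N.server c) = some (c, t) := by
  have htop := N.isTop_beforeStart hN hf hc hw h
  rw [instant_serving]
  unfold start
  have hex : ∃ e, N.server e = N.server c ∧ N.IsTop θ (N.beforeStart θ t x).waiting e :=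
    ⟨c, rfl, htop⟩
  simp only [hf.beforeStart_serving θ, if_true, dif_pos hex]
  have h1 := hex.choose_spec
  have h2 : hex.choose = c := hθ _ _ h1.1
    (le_antisymm (h1.2.2 c h1.1.symm htop.1) (htop.2 _ h1.1 h1.2.1))
  rw [h2]

theorem instant_waiting_of_start (N : Network S C) (hN : N.Acyclic) {θ : C → ℕ}
    (hθ : N.IsPolicy θ) {t : ℚ}
    {x : State S C} {c : C} (hf : N.FreeAt t x (N.server c)) (hc : N.service c ≠ 0)
    (hw : 0 < x.waiting c + N.inflow θ t x c)
    (h : ∀ d, N.server d = N.server c → N.service d ≠ 0 → 0 < x.waiting d + N.inflow θ t x d →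
      θ c ≤ θ d) {d : C} (hd : N.server d = N.server c) :
    (N.instant θ t x).waiting d =
      stored (N.capacity d) ((N.beforeStart θ t x).waiting d - if d = c then 1 else 0) := by
  have htop := N.isTop_beforeStart hN hf hc hw h
  change (N.start θ t (N.beforeStart θ t x)).waiting d = _
  unfold start
  have hfree : (N.beforeStart θ t x).serving (N.server d) = none := by
    rw [hd, hf.beforeStart_serving θ]
  by_cases hdc : d = c
  · subst hdc
    simp only [hfree, htop, and_self, if_true]
  · rw [if_neg hdc]
    simp only
    rw [if_neg]
    rintro ⟨-, h1⟩
    exact hdc (hθ _ _ hd (le_antisymm (h1.2 c hd.symm htop.1) (htop.2 _ hd h1.1)))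

/-- A job with a positive service time keeps the jobs of lower priority at its server from
instantaneous service, if it waits at the latest after step (3). -/
theorem outflow_of_blocked (N : Network S C) (θ : C → ℕ) {t : ℚ}
    {x : State S C} (hx : State.Positive N x) {c d : C}
    (hs : N.server d = N.server c) (hd : N.service d ≠ 0) (hc : N.service c = 0) (hp : θ d < θ c)
    (h1 : N.flushed θ (N.arrive t x) c = 0)
    (hw : 0 < x.waiting d + N.arrivals t d + N.routed (N.flushed θ (N.arrive t x)) d +
      N.routed (N.finishing t x) d) :
    N.outflow θ t x c = 0 := by
  unfold outflow
  rw [h1, N.finishing_of_service_eq hx hc, N.flushed_of_blocked θ _ hs hd _ hp]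
  have h2 := N.complete_waiting θ t x d
  have h3 := N.flushed_of_service_ne θ (N.arrive t x) hd
  omega

/-- At a free server, jobs that need no service pass in the first flush, unless a job with higher
priority and a positive service time is present. -/
theorem flushed_arrive_of_free (N : Network S C) (hN : N.Acyclic) (θ : C → ℕ) {t : ℚ}
    {x : State S C} {c : C} (hf : x.serving (N.server c) = none)
    (h : ∀ d, N.server d = N.server c → N.service d ≠ 0 →
      x.waiting d + N.arrivals t d + N.routed (N.flushed θ (N.arrive t x)) d = 0) :
    N.flushed θ (N.arrive t x) c =
      x.waiting c + N.arrivals t c + N.routed (N.flushed θ (N.arrive t x)) c := by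
  have h1 := N.flush_waiting θ (N.arrive t x) c
  have h2 : (N.arrive t x).waiting c = x.waiting c + N.arrivals t c := rfl
  rcases Nat.eq_zero_or_pos ((N.flush θ (N.arrive t x)).waiting c) with h3 | h3
  · omega
  · exfalso
    obtain ⟨e, he, htop⟩ := N.exists_isTop θ _ h3
    have h4 := N.service_ne_of_isTop_flush hN θ (N.arrive t x) (c := e)
      (by rw [he]; exact hf) htop
    have h5 := N.flush_waiting θ (N.arrive t x) e
    have h6 : (N.arrive t x).waiting e = x.waiting e + N.arrivals t e := rfl
    have h7 := h e he h4
    have h8 := htop.1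
    omega

theorem positive_instant (N : Network S C) (hN : N.Acyclic) (θ : C → ℕ) {t : ℚ}
    {x : State S C} (hx : State.Positive N x) : State.Positive N (N.instant θ t x) := by
  intro c u h
  rw [instant_serving] at h
  unfold start at h
  simp only at h
  split_ifs at h with h1 h2
  · simp only [Option.some.injEq, Prod.mk.injEq] at h
    obtain ⟨h3, -⟩ := h
    have h4 := h2.choose_spec
    rw [h3] at h4
    refine N.service_ne_of_isTop_flush hN θ _ ?_ h4.2
    unfold beforeStart at h1
    rw [flush_serving] at h1
    exact h1
  · refine hx c u ?_
    rw [beforeStart_serving] at h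
    exact (Option.filter_eq_some_iff.1 h).1

theorem waiting_instant_le_capacity (N : Network S C) (θ : C → ℕ) (t : ℚ) (x : State S C) (c : C) :
    stored (N.capacity c) ((N.instant θ t x).waiting c) = (N.instant θ t x).waiting c := by
  change stored _ ((N.start θ t (N.beforeStart θ t x)).waiting c) =
    (N.start θ t (N.beforeStart θ t x)).waiting c
  unfold start
  simp only
  cases N.capacity c <;> simp [stored]

theorem waiting_instant_of_serving_none (N : Network S C) (θ : C → ℕ) (t : ℚ) (x : State S C)
    {c : C} (h : (N.instant θ t x).serving (N.server c) = none) :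
    (N.instant θ t x).waiting c = 0 := by
  rw [instant_serving] at h
  change (N.start θ t (N.beforeStart θ t x)).waiting c = 0
  unfold start at h ⊢
  simp only at h
  split_ifs at h with h1 h2
  have h3 : (N.beforeStart θ t x).waiting c = 0 := by
    by_contra hne
    obtain ⟨e, he, htop⟩ := N.exists_isTop θ _ (Nat.pos_of_ne_zero hne)
    exact h2 ⟨e, he, htop⟩
  · simp only [h3, Nat.zero_sub, stored_zero]
  · exact absurd h h1

end Network

namespace Network

/-! ### Networks whose data lie on a grid -/

section Grid

variable {S C : Type}

/-- All data of the network are multiples of `1 / D`. -/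
structure OnGrid (N : Network S C) (D : ℕ) : Prop where
  pos : 0 < D
  interarrival_pos : ∀ c, ∀ a ∈ N.interarrival c, 0 < a
  interarrival : ∀ c, ∀ a ∈ N.interarrival c, ∃ k : ℕ, a = k / D
  delay : ∀ c, ∃ k : ℕ, N.delay c = k / D
  service : ∀ c, ∃ k : ℕ, N.service c = k / D

/-- The property of the state right before the tick `k` of the grid that every service in progress
began earlier, at a tick, has positive length, and does not end before the tick `k`. -/
def Regular (N : Network S C) (D k : ℕ) (x : State S C) : Prop :=
  ∀ s c u, x.serving s = some (c, u) → N.server c = s ∧ N.service c ≠ 0 ∧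
    (∃ j : ℕ, u = j / D ∧ j < k) ∧ (k : ℚ) / D ≤ u + N.service c

theorem Regular.positive {N : Network S C} {D k : ℕ} {x : State S C} (h : N.Regular D k x) :
    State.Positive N x := fun c u hcu => (h _ c u hcu).2.1

variable [Fintype C] [DecidableEq C]

/-- The state right before the tick `k` of the grid. -/
noncomputable def gridState (N : Network S C) (θ : C → ℕ) (q : C → ℕ) (D : ℕ) : ℕ → State S C
  | 0 => ⟨q, fun _ => none⟩
  | k + 1 => N.instant θ (k / D) (gridState N θ q D k)

/-- Regularity is preserved: services begin and end at ticks, so none ends strictly between two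
ticks. -/
theorem Regular.instant {N : Network S C} {D k : ℕ} {x : State S C} (hG : N.OnGrid D)
    (hN : N.Acyclic) (θ : C → ℕ) (h : N.Regular D k x) :
    N.Regular D (k + 1) (N.instant θ (k / D) x) := by
  intro s c u hs
  have hD : (0 : ℚ) < D := by exact_mod_cast hG.pos
  have hpos := N.positive_instant hN θ (t := k / D) h.positive
  have key : N.server c = s ∧ ((u = k / D) ∨ ((∃ j : ℕ, u = j / D ∧ j < k) ∧
      (k : ℚ) / D ≤ u + N.service c ∧ u + N.service c ≠ k / D)) := by
    rw [instant_serving] at hs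
    unfold start at hs
    simp only at hs
    split_ifs at hs with h1 h2
    · simp only [Option.some.injEq, Prod.mk.injEq] at hs
      have h4 := h2.choose_spec
      rw [hs.1] at h4
      exact ⟨h4.1, Or.inl hs.2.symm⟩
    · rw [beforeStart_serving] at hs
      obtain ⟨h3, h4⟩ := Option.filter_eq_some_iff.1 hs
      obtain ⟨h5, -, h6, h7⟩ := h s c u h3
      exact ⟨h5, Or.inr ⟨h6, h7, by simpa using h4⟩⟩
  obtain ⟨hc, hu⟩ := key
  subst hc
  have hne := hpos c u hs
  obtain ⟨l, hl⟩ := hG.service c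
  have hl0 : 0 < l := by
    rcases Nat.eq_zero_or_pos l with rfl | h0
    · simp at hl; exact absurd hl hne
    · exact h0
  refine ⟨rfl, hne, ?_, ?_⟩
  · rcases hu with hu | ⟨⟨j, hj, hjk⟩, -⟩
    · exact ⟨k, hu, by omega⟩
    · exact ⟨j, hj, by omega⟩
  · rcases hu with hu | ⟨⟨j, hj, hjk⟩, h1, h2⟩
    · rw [hu, hl, ← add_div, div_le_div_iff_of_pos_right hD]
      exact_mod_cast (by omega : k + 1 ≤ k + l)
    · rw [hj, hl, ← add_div] at h1 h2 ⊢
      rw [div_le_div_iff_of_pos_right hD] at h1 ⊢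
      have h3 : k ≤ j + l := by exact_mod_cast h1
      have h4 : j + l ≠ k := by
        intro h5
        exact h2 (by rw [← h5]; push_cast; rfl)
      exact_mod_cast (by omega : k + 1 ≤ j + l)

theorem regular_gridState (N : Network S C) {D : ℕ} (hG : N.OnGrid D) (hN : N.Acyclic)
    (θ : C → ℕ) (q : C → ℕ) (k : ℕ) : N.Regular D k (N.gridState θ q D k) := by
  induction k with
  | zero => intro s c u h; exact absurd h (by simp [gridState])
  | succ k ih => exact ih.instant hG hN θ

/-- Nothing happens at an instant without arrivals and completions. -/
theorem instant_quiet (N : Network S C) (θ : C → ℕ) {t : ℚ} {x : State S C}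
    (hfree : ∀ c, x.serving (N.server c) = none → x.waiting c = 0)
    (hcap : ∀ c, stored (N.capacity c) (x.waiting c) = x.waiting c)
    (harr : ∀ c, N.arrivals t c = 0)
    (hfin : ∀ s p, x.serving s = some p → p.2 + N.service p.1 ≠ t) : N.instant θ t x = x := by
  have h1 : N.arrive t x = x := by unfold arrive; simp [harr]
  have h2 : N.flushStep θ x = x := by
    refine N.flushStep_eq_self θ x fun c => ?_
    unfold immediate
    rw [if_neg]
    rintro ⟨h, h', -⟩
    have := hfree c h
    have := h'.1
    omega
  have h3 : N.flush θ x = x := by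
    unfold flush
    generalize (∑ c, x.waiting c) * Fintype.card C = n
    induction n with
    | zero => rfl
    | succ n ih => rw [Function.iterate_succ_apply, h2, ih]
  have h4 : N.complete t x = x := by
    have h5 : N.finishing t x = fun _ => 0 := by
      funext c
      unfold finishing
      rw [if_neg]
      rintro ⟨u, h, h'⟩
      exact hfin _ _ h h'
    have h6 : ∀ s, (x.serving s).filter (fun p => decide (p.2 + N.service p.1 ≠ t)) =
        x.serving s := by
      intro s
      cases hs : x.serving s with
      | none => rfl
      | some p => simp [hfin s p hs]
    unfold complete
    simp only [h5, h6]
    simp [routed]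
  unfold instant
  rw [h1, h3, h4, h3]
  unfold start
  have h7 : ∀ c, ¬ (x.serving (N.server c) = none ∧ N.IsTop θ x.waiting c) := by
    rintro c ⟨h, h'⟩
    have := hfree c h
    have := h'.1
    omega
  have h8 : ∀ s, x.serving s = none → ¬ ∃ c, N.server c = s ∧ N.IsTop θ x.waiting c := by
    rintro s hs ⟨c, rfl, hc⟩
    exact h7 c ⟨hs, hc⟩
  cases x with
  | mk w v =>
    simp only [State.mk.injEq]
    refine ⟨?_, ?_⟩
    · funext c
      rw [if_neg (h7 c)]
      exact hcap c
    · funext s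
      split_ifs with h9 h10
      · exact absurd h10 (h8 s h9)
      · exact h9.symm
      · rfl

variable [Fintype S]

omit [DecidableEq C] in
theorem nextTime_le_end (N : Network S C) (t : ℚ) (x : State S C) {s : S} {p : C × ℚ}
    (h : x.serving s = some p) : N.nextTime t x ≤ p.2 + N.service p.1 := by
  refine Finset.min'_le _ _ (Finset.mem_insert_of_mem (Finset.mem_union_right _ ?_))
  refine Finset.mem_biUnion.2 ⟨s, Finset.mem_univ _, ?_⟩
  simp [h]

omit [DecidableEq C] in
/-- No external arrival is skipped. -/
theorem nextTime_le_arrival (N : Network S C) {D : ℕ} (hG : N.OnGrid D) {t t' : ℚ}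
    (x : State S C) {c : C} (h : N.arrivals t' c ≠ 0) (ht : t < t') : N.nextTime t x ≤ t' := by
  unfold arrivals at h
  split_ifs at h with hex
  · obtain ⟨a, ha, n, hn⟩ := hex
    have ha0 := hG.interarrival_pos c a ha
    have h1 : ∃ b ∈ N.nextArrival t c, b ≤ t' := by
      unfold nextArrival
      rw [Option.mem_def] at ha
      rw [ha]
      refine ⟨_, rfl, ?_⟩
      split_ifs with hd
      · rw [hn]
        have : (0 : ℚ) ≤ n * a := by positivity
        linarith
      · rw [hn]
        have h2 : ⌊(t - N.delay c) / a⌋ < (n : ℤ) := by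
          rw [Int.floor_lt, div_lt_iff₀ ha0]
          push_cast
          linarith
        have h3 : ((⌊(t - N.delay c) / a⌋ : ℚ) + 1) ≤ n := by
          exact_mod_cast Int.add_one_le_of_lt h2
        have h4 := mul_le_mul_of_nonneg_right h3 ha0.le
        linarith
    obtain ⟨b, hb, hbt⟩ := h1
    refine (Finset.min'_le _ _ (Finset.mem_insert_of_mem (Finset.mem_union_left _ ?_))).trans hbt
    refine Finset.mem_biUnion.2 ⟨c, Finset.mem_univ _, ?_⟩
    rw [Option.mem_def] at hb
    simp [hb]
  · exact absurd rfl h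

omit [DecidableEq C] in
theorem nextTime_cases (N : Network S C) (t : ℚ) (x : State S C) :
    N.nextTime t x = t + 1 ∨ (∃ c, N.nextArrival t c = some (N.nextTime t x)) ∨
      ∃ s p, x.serving s = some p ∧ N.nextTime t x = p.2 + N.service p.1 := by
  have h := Finset.min'_mem (insert (t + 1)
    ((Finset.univ.biUnion fun c => (N.nextArrival t c).toFinset) ∪
      Finset.univ.biUnion fun s =>
        ((x.serving s).map fun p => p.2 + N.service p.1).toFinset)) (Finset.insert_nonempty _ _)
  rw [Finset.mem_insert, Finset.mem_union, Finset.mem_biUnion, Finset.mem_biUnion] at h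
  rcases h with h | ⟨c, -, h⟩ | ⟨s, -, h⟩
  · exact Or.inl h
  · exact Or.inr (Or.inl ⟨c, Option.mem_toFinset.1 h⟩)
  · rw [Option.mem_toFinset, Option.mem_def, Option.map_eq_some_iff] at h
    obtain ⟨p, hp, h⟩ := h
    exact Or.inr (Or.inr ⟨s, p, hp, h.symm⟩)

omit [DecidableEq C] in
/-- The next event after a tick of the grid is at a later tick. -/
theorem exists_nextTime_eq (N : Network S C) {D : ℕ} (hG : N.OnGrid D) {k : ℕ} {x : State S C}
    (hx : N.Regular D (k + 1) x) : ∃ l : ℕ, k < l ∧ N.nextTime (k / D) x = l / D := by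
  have hD : (0 : ℚ) < D := by exact_mod_cast hG.pos
  rcases N.nextTime_cases (k / D) x with h | ⟨c, h⟩ | ⟨s, p, hp, h⟩
  · refine ⟨k + D, by have := hG.pos; omega, ?_⟩
    rw [h]; push_cast; field_simp
  · obtain ⟨a, ha, hb⟩ := Option.map_eq_some_iff.1 h
    obtain ⟨i, hi⟩ := hG.interarrival c a ha
    have ha0 := hG.interarrival_pos c a ha
    obtain ⟨j, hj⟩ := hG.delay c
    split_ifs at hb with h1
    · refine ⟨j, ?_, by rw [← hb, hj]⟩
      rw [hj, div_lt_div_iff_of_pos_right hD] at h1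
      exact_mod_cast h1
    · have h2 : (0 : ℤ) ≤ ⌊((k : ℚ) / D - N.delay c) / a⌋ :=
        Int.floor_nonneg.2 (div_nonneg (by linarith) ha0.le)
      obtain ⟨n, hn⟩ := Int.eq_ofNat_of_zero_le h2
      refine ⟨j + (n + 1) * i, ?_, ?_⟩
      · have h3 := Int.lt_floor_add_one (((k : ℚ) / D - N.delay c) / a)
        rw [hn, div_lt_iff₀ ha0, hi, hj] at h3
        rw [← sub_div, ← mul_div_assoc, div_lt_div_iff_of_pos_right hD] at h3
        have h4 : (k : ℚ) < j + (n + 1) * i := by push_cast at h3; linarith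
        exact_mod_cast h4
      · rw [← hb, hn, hi, hj]; push_cast; ring
  · obtain ⟨-, -, ⟨j, hj, -⟩, h1⟩ := hx s p.1 p.2 hp
    obtain ⟨l, hl⟩ := hG.service p.1
    refine ⟨j + l, ?_, by rw [h, hj, hl]; push_cast; ring⟩
    rw [hj, hl, ← add_div, div_le_div_iff_of_pos_right hD] at h1
    have h2 : k + 1 ≤ j + l := by exact_mod_cast h1
    omega

/-- The event times are ticks of the grid, and the state does not change at the other ticks. -/
theorem run_eq_gridState (N : Network S C) {D : ℕ} (hG : N.OnGrid D) (hN : N.Acyclic)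
    (θ : C → ℕ) (q : C → ℕ) : ∃ j : ℕ → ℕ, StrictMono j ∧ j 0 = 0 ∧
      (∀ n, (N.run θ q n).1 = j n / D) ∧
      ∀ n k, j n ≤ k → k < j (n + 1) → N.gridState θ q D (k + 1) = (N.run θ q n).2 := by
  have hD : (0 : ℚ) < D := by exact_mod_cast hG.pos
  have h0 : ∀ n, ∃ j : ℕ, (N.run θ q n).1 = j / D ∧
      (N.run θ q n).2 = N.gridState θ q D (j + 1) ∧ (n = 0 → j = 0) ∧
      ∃ l, j < l ∧ (N.run θ q (n + 1)).1 = l / D ∧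
      ∀ k, j ≤ k → k < l → N.gridState θ q D (k + 1) = (N.run θ q n).2 := by
    have step : ∀ n (j : ℕ), (N.run θ q n).1 = j / D →
        (N.run θ q n).2 = N.gridState θ q D (j + 1) →
        ∃ l, j < l ∧ (N.run θ q (n + 1)).1 = l / D ∧
        (∀ k, j ≤ k → k < l → N.gridState θ q D (k + 1) = (N.run θ q n).2) := by
      intro n j h1 h2
      have hreg := N.regular_gridState hG hN θ q (j + 1)
      rw [← h2] at hreg
      obtain ⟨l, hjl, hl⟩ := N.exists_nextTime_eq hG hreg
      refine ⟨l, hjl, ?_, fun k hk => ?_⟩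
      · change N.nextTime (N.run θ q n).1 (N.run θ q n).2 = _
        rw [h1, hl]
      · induction k, hk using Nat.le_induction with
        | base => intro _; exact h2.symm
        | succ k hk ih =>
          intro hkl
          have ih := ih (by omega)
          change N.instant θ _ (N.gridState θ q D (k + 1)) = _
          have hlt : ((k + 1 : ℕ) : ℚ) / D < N.nextTime (j / D) (N.run θ q n).2 := by
            rw [hl, div_lt_div_iff_of_pos_right hD]
            exact_mod_cast hkl
          rw [ih]
          refine N.instant_quiet θ ?_ ?_ ?_ ?_
          · intro c
            rw [h2]
            exact N.waiting_instant_of_serving_none θ _ _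
          · intro c
            rw [h2]
            exact N.waiting_instant_le_capacity θ _ _ c
          · intro c
            by_contra hc
            have h3 : (j : ℚ) / D < ((k + 1 : ℕ) : ℚ) / D := by
              rw [div_lt_div_iff_of_pos_right hD]
              exact_mod_cast Nat.lt_succ_of_le hk
            exact absurd (N.nextTime_le_arrival hG (N.run θ q n).2 hc h3) (not_le.2 hlt)
          · intro s p hp hpt
            have := N.nextTime_le_end (j / D) _ hp
            rw [hpt] at this
            exact absurd this (not_le.2 hlt)
    intro n
    have h1 : ∃ j : ℕ, (N.run θ q n).1 = j / D ∧
        (N.run θ q n).2 = N.gridState θ q D (j + 1) ∧ (n = 0 → j = 0) := by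
      induction n with
      | zero =>
        refine ⟨0, by simp [run], ?_, fun _ => rfl⟩
        change N.instant θ 0 _ = N.instant θ _ _
        simp [gridState]
      | succ n ih =>
        obtain ⟨j, h1, h2, -⟩ := ih
        obtain ⟨l, h3, h4, h5⟩ := step n j h1 h2
        refine ⟨l, h4, ?_, fun h => absurd h (Nat.succ_ne_zero n)⟩
        have h6 : (N.run θ q (n + 1)).2 =
          N.instant θ (N.run θ q (n + 1)).1 (N.run θ q n).2 := rfl
        rw [h6, h4]
        have h7 := h5 (l - 1) (by omega) (by omega)
        rw [Nat.sub_add_cancel (by omega)] at h7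
        rw [← h7]
        rfl
    obtain ⟨j, h2, h3, h4⟩ := h1
    exact ⟨j, h2, h3, h4, step n j h2 h3⟩
  choose j hj1 _ hj0 l hjl hl hk using h0
  have hlj : ∀ n, l n = j (n + 1) := by
    intro n
    have := (hl n).symm.trans (hj1 (n + 1))
    rw [div_left_inj' hD.ne'] at this
    exact_mod_cast this
  refine ⟨j, strictMono_nat_of_lt_succ fun n => hlj n ▸ hjl n, hj0 0 rfl, hj1, fun n k h1 h2 => ?_⟩
  exact hk n k h1 (hlj n ▸ h2)

theorem run_sSup_eq_gridState (N : Network S C) {D : ℕ} (hG : N.OnGrid D) (hN : N.Acyclic)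
    (θ : C → ℕ) (q : C → ℕ) (K : ℕ) {P : ℚ → Prop} (hP : ∀ k : ℕ, P (k / D) ↔ k ≤ K) :
    (N.run θ q (sSup {n | P (N.run θ q n).1})).2 = N.gridState θ q D (K + 1) := by
  obtain ⟨j, hmono, hj0, hj, hk⟩ := N.run_eq_gridState hG hN θ q
  have hset : {n | P (N.run θ q n).1} = {n | j n ≤ K} := by
    ext n; simp only [Set.mem_ofPred_eq, hj, hP]
  rw [hset]
  have hne : {n | j n ≤ K}.Nonempty := ⟨0, by simp [hj0]⟩
  have hbdd : BddAbove {n | j n ≤ K} := ⟨K, fun n hn => (hmono.le_apply).trans hn⟩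
  have h1 := Nat.sSup_mem hne hbdd
  refine (hk _ K h1 ?_).symm
  by_contra h2
  have := le_csSup hbdd (not_lt.1 h2)
  omega

theorem stateAt_eq_gridState (N : Network S C) {D : ℕ} (hG : N.OnGrid D) (hN : N.Acyclic)
    (θ : C → ℕ) (q : C → ℕ) {t : ℝ} (ht : 0 ≤ t) :
    N.stateAt θ q t = N.gridState θ q D (⌊t * D⌋₊ + 1) := by
  have hD : (0 : ℝ) < D := by exact_mod_cast hG.pos
  refine N.run_sSup_eq_gridState hG hN θ q ⌊t * D⌋₊ (P := fun r => (r : ℝ) ≤ t) fun k => ?_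
  push_cast
  rw [div_le_iff₀ hD, Nat.le_floor_iff (by positivity)]

theorem stateAt_natCast (N : Network S C) {D : ℕ} (hG : N.OnGrid D) (hN : N.Acyclic)
    (θ : C → ℕ) (q : C → ℕ) (n : ℕ) :
    N.stateAt θ q n = N.gridState θ q D (n * D + 1) := by
  rw [N.stateAt_eq_gridState hG hN θ q (Nat.cast_nonneg n)]
  congr 2
  exact_mod_cast Nat.floor_natCast (n * D)

theorem stateBefore_natCast (N : Network S C) {D : ℕ} (hG : N.OnGrid D) (hN : N.Acyclic)
    (θ : C → ℕ) (q : C → ℕ) {n : ℕ} (hn : 0 < n) :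
    N.stateBefore θ q n = N.gridState θ q D (n * D) := by
  have hD : (0 : ℝ) < D := by exact_mod_cast hG.pos
  have hnD : 0 < n * D := Nat.mul_pos hn hG.pos
  have h := N.run_sSup_eq_gridState hG hN θ q (n * D - 1) (P := fun r => (r : ℝ) < (n : ℝ))
    fun k => by
      push_cast
      rw [div_lt_iff₀ hD]
      constructor
      · intro h
        have : k < n * D := by exact_mod_cast h
        omega
      · intro h
        exact_mod_cast (by omega : k < n * D)
  rw [Nat.sub_add_cancel hnD] at h
  exact h

/-- Stability in terms of the states at the ticks of the grid. -/
theorem stable_iff_gridState (N : Network S C) {D : ℕ} (hG : N.OnGrid D) (hN : N.Acyclic)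
    (θ : C → ℕ) (q : C → ℕ) : N.Stable θ q ↔
      ∃ B, ∀ k, ∑ c, N.queueLength (N.gridState θ q D (k + 1)) c ≤ B := by
  have hD : (0 : ℝ) < D := by exact_mod_cast hG.pos
  constructor
  · rintro ⟨B, hB⟩
    refine ⟨B, fun k => hB ⟨(k : ℝ) / D, by positivity, ?_⟩⟩
    rw [N.stateAt_eq_gridState hG hN θ q (by positivity), div_mul_cancel₀ _ hD.ne',
      Nat.floor_natCast]
  · rintro ⟨B, hB⟩
    refine ⟨B, ?_⟩
    rintro _ ⟨t, ht, rfl⟩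
    rw [N.stateAt_eq_gridState hG hN θ q ht]
    exact hB _

end Grid

section Growth

variable {S C : Type} [Fintype C] [DecidableEq C]

open Classical in
/-- The queue length grows at most by the balance of inflow and outflow; it may be less because of
lost jobs. -/
theorem queueLength_instant_le (N : Network S C) (θ : C → ℕ) (t : ℚ) (x : State S C) (c : C) :
    N.queueLength (N.instant θ t x) c + N.finishing t x c + N.outflow θ t x c ≤
      N.queueLength x c + N.inflow θ t x c + N.finishing t x c := by
  have hbal := N.beforeStart_waiting θ t x c
  have hsv := N.beforeStart_serving θ t x (N.server c)
  have hle : N.queueLength (N.instant θ t x) c + N.finishing t x c ≤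
      (N.beforeStart θ t x).waiting c + if ∃ u, x.serving (N.server c) = some (c, u) then 1 else 0 := by
    unfold queueLength
    change (N.start θ t (N.beforeStart θ t x)).waiting c +
      (if ∃ u, (N.start θ t (N.beforeStart θ t x)).serving (N.server c) = some (c, u) then 1 else 0)
      + _ ≤ _
    generalize N.beforeStart θ t x = y at hsv ⊢
    unfold start
    simp only
    rcases Option.eq_none_or_eq_some (y.serving (N.server c)) with hy | ⟨p, hy⟩
    rotate_left
    · rw [hy] at hsv
      obtain ⟨h1, h2⟩ := Option.filter_eq_some_iff.1 hsv.symm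
      rw [N.finishing_of_serving (c := p.1) (u := p.2) (t := t) h1 (Or.inr (by simpa using h2)), h1]
      simp only [hy, reduceCtorEq, false_and, if_false, Nat.sub_zero, add_zero]
      exact Nat.add_le_add_right (stored_le _ _) _
    · have hfin : N.finishing t x c ≤
          if ∃ u, x.serving (N.server c) = some (c, u) then 1 else 0 := by
        unfold finishing
        split_ifs with h1 h2
        · exact le_rfl
        · obtain ⟨u, hu, -⟩ := h1
          exact absurd ⟨u, hu⟩ h2
        · exact Nat.zero_le _
        · exact le_rfl
      have hst := stored_le (N.capacity c) (y.waiting c - if True ∧ N.IsTop θ y.waiting c then 1 else 0)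
      simp only [hy, if_true]
      by_cases htop : N.IsTop θ y.waiting c
      · have h3 := htop.1
        simp only [htop, and_self, if_true] at hst ⊢
        split_ifs at hfin ⊢ <;> omega
      · simp only [htop, and_false, if_false, Nat.sub_zero] at hst ⊢
        rw [if_neg]
        · omega
        · rintro ⟨u, hu⟩
          split_ifs at hu with h1
          simp only [Option.some.injEq, Prod.mk.injEq] at hu
          have h2 := h1.choose_spec
          rw [hu.1] at h2
          exact htop h2.2
  have h1 : N.queueLength x c =
    x.waiting c + if ∃ u, x.serving (N.server c) = some (c, u) then 1 else 0 := rfl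
  omega

/-- At any instant, the number of jobs in the network grows at most by the number of external
arrivals. -/
theorem sum_queueLength_instant_le (N : Network S C) (θ : C → ℕ) (t : ℚ) (x : State S C) :
    ∑ c, N.queueLength (N.instant θ t x) c ≤ ∑ c, N.queueLength x c + Fintype.card C := by
  have h1 := Finset.sum_le_sum fun c (_ : c ∈ Finset.univ) => N.queueLength_instant_le θ t x c
  have h2 := N.sum_routed_le (N.outflow θ t x)
  have h3 : ∑ c, N.arrivals t c ≤ Fintype.card C := by
    have h4 : ∑ c, N.arrivals t c ≤ ∑ _c : C, 1 := by
      refine Finset.sum_le_sum fun c _ => ?_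
      unfold arrivals
      split_ifs <;> simp
    simpa using h4
  have h4 : ∑ c, N.inflow θ t x c = ∑ c, N.arrivals t c + ∑ c, N.routed (N.outflow θ t x) c := by
    rw [← Finset.sum_add_distrib]; rfl
  simp only [Finset.sum_add_distrib] at h1
  omega

end Growth

end Network

/-! ### The modified network on the grid of ticks -/

namespace SCM

variable {m : ℕ}

/-- The service time of a class, counted in ticks of length `1 / (400 m)`. -/
def ticks : Cls m → ℕ
  | .c12 _ => 200 * m
  | .c21 _ => 200 * m
  | .c31 _ => 16 * m
  | .c32 _ => 440 * m
  | .c41 _ => 80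
  | .c42 _ => 8 * m
  | .c51 _ => 8 * m
  | .b1 _ _ => 2
  | .b2 _ => 12 * m
  | .b3 _ => 4 * m
  | .m01 i => if i = 0 then 36 * m else 72 * m
  | .m02 _ => 1084 * m
  | .m3 _ _ _ => 9
  | .m41 _ => 8 * m
  | _ => 0

/-- The period and the delay of the external arrivals of a class, counted in ticks. -/
def arrivalTicks : Cls m → Option (ℕ × ℕ)
  | .c13 _ => some (1200 * m, 640 * m)
  | .c14 _ => some (1200 * m, 1040 * m)
  | .c22 _ => some (400 * m, 0)
  | .c23 _ => some (1200 * m, 840 * m)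
  | .c32 _ => some (1200 * m, 600 * m)
  | .c33 _ => some (1200 * m, 1080 * m)
  | .c42 _ => some (400 * m, 0)
  | .b2 _ => some (1200 * m, 0)
  | .b3 _ => some (1200 * m, 4 * m)
  | .m35 _ s => if (s : ℕ) = 0 then some (1200 * m, 1196 * m) else none
  | .m42 _ => some (1200 * m, 1200 * m)
  | .m43 _ => some (1200 * m, 1200 * m)
  | _ => none

theorem serviceTime_eq (hm : 0 < m) (c : Cls m) :
    serviceTime c = (ticks c : ℚ) / (400 * m : ℕ) := by
  have : (m : ℚ) ≠ 0 := by exact_mod_cast hm.ne'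
  cases c <;> simp only [serviceTime, ticks] <;> try split_ifs
  all_goals push_cast; field_simp; try norm_num

theorem arrivalData_eq (hm : 0 < m) (c : Cls m) :
    arrivalData c = (arrivalTicks c).map fun p =>
      ((p.1 : ℚ) / (400 * m : ℕ), (p.2 : ℚ) / (400 * m : ℕ)) := by
  have : (m : ℚ) ≠ 0 := by exact_mod_cast hm.ne'
  cases c <;> simp only [arrivalData, arrivalTicks] <;> try split_ifs
  all_goals simp only [Option.map_some, Option.map_none]
  all_goals simp only [Option.some.injEq, Prod.mk.injEq]
  all_goals constructor <;> (push_cast; field_simp; try norm_num)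

theorem arrivalTicks_pos (hm : 0 < m) {c : Cls m} {p : ℕ × ℕ} (h : arrivalTicks c = some p) :
    0 < p.1 := by
  cases c <;> simp only [arrivalTicks] at h <;> (try split_ifs at h) <;>
    simp only [Option.some.injEq, reduceCtorEq] at h <;> subst h <;> simp only <;> omega

theorem onGrid (M : SCM m) (hm : 0 < m) : M.network.OnGrid (400 * m) := by
  have hD : (0 : ℚ) < (400 * m : ℕ) := by exact_mod_cast (by omega : 0 < 400 * m)
  have key : ∀ c, ∀ a ∈ M.network.interarrival c, ∃ k : ℕ, 0 < k ∧ a = k / (400 * m : ℕ) := by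
    intro c a ha
    change a ∈ (arrivalData c).map Prod.fst at ha
    rw [arrivalData_eq hm, Option.map_map, Option.mem_def, Option.map_eq_some_iff] at ha
    obtain ⟨p, hp, rfl⟩ := ha
    exact ⟨p.1, arrivalTicks_pos hm hp, rfl⟩
  refine ⟨by omega, ?_, ?_, ?_, fun c => ⟨ticks c, serviceTime_eq hm c⟩⟩
  · intro c a ha
    obtain ⟨k, hk, rfl⟩ := key c a ha
    exact div_pos (by exact_mod_cast hk) hD
  · intro c a ha
    obtain ⟨k, -, hk⟩ := key c a ha
    exact ⟨k, hk⟩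
  · intro c
    change ∃ k : ℕ, ((arrivalData c).map Prod.snd).getD 0 = _
    rw [arrivalData_eq hm]
    cases arrivalTicks c with
    | none => exact ⟨0, by simp⟩
    | some p => exact ⟨p.2, rfl⟩

/-- The external arrivals in terms of ticks. -/
theorem arrivals_eq (M : SCM m) (hm : 0 < m) (k : ℕ) (c : Cls m) :
    M.network.arrivals (k / (400 * m : ℕ)) c =
      ((arrivalTicks c).map fun p => if p.2 ≤ k ∧ (k - p.2) % p.1 = 0 then 1 else 0).getD 0 := by
  have hD : ((400 * m : ℕ) : ℚ) ≠ 0 := by exact_mod_cast (by omega : 400 * m ≠ 0)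
  unfold Network.arrivals
  have h1 : M.network.interarrival c = (arrivalData c).map Prod.fst := rfl
  have h2 : M.network.delay c = ((arrivalData c).map Prod.snd).getD 0 := rfl
  rw [h1, h2, arrivalData_eq hm]
  cases arrivalTicks c with
  | none => simp
  | some p =>
    simp only [Option.map_some, Option.getD_some]
    have hiff : (∃ a ∈ some ((p.1 : ℚ) / (400 * m : ℕ)), ∃ n : ℕ,
        (k : ℚ) / (400 * m : ℕ) = (p.2 : ℚ) / (400 * m : ℕ) + n * a) ↔ p.2 ≤ k ∧ (k - p.2) % p.1 = 0 := by
      constructor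
      · rintro ⟨a, ha, n, hn⟩
        rw [Option.mem_def, Option.some.injEq] at ha
        subst ha
        rw [← mul_div_assoc, ← add_div, div_left_inj' hD] at hn
        have hn : k = p.2 + n * p.1 := by exact_mod_cast hn
        refine ⟨by omega, ?_⟩
        rw [hn, Nat.add_sub_cancel_left, Nat.mul_mod_left]
      · rintro ⟨h1, h2⟩
        refine ⟨_, rfl, (k - p.2) / p.1, ?_⟩
        rw [← mul_div_assoc, ← add_div, div_left_inj' hD]
        have := Nat.div_mul_cancel (Nat.dvd_of_mod_eq_zero h2)
        exact_mod_cast (by omega : k = p.2 + (k - p.2) / p.1 * p.1)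
    by_cases h : p.2 ≤ k ∧ (k - p.2) % p.1 = 0
    · rw [if_pos h, if_pos (hiff.2 h)]
    · rw [if_neg h, if_neg fun h' => h (hiff.1 h')]

/-- A rank of the classes which decreases along the routes. -/
def rank : Cls m → ℕ
  | .c11 _ | .c13 _ | .c14 _ | .c23 _ | .c22 _ | .c33 _ | .m43 _ => 1
  | .c42 _ | .c51 _ | .b3 _ => 2
  | .m3 _ l s => 16 * m - (4 * m * l + s)
  | .m03 _ => 16 * m + 1
  | .m02 _ => 16 * m + 2
  | .m42 _ => 16 * m + 3
  | .m35 _ s => 4 * m - s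
  | _ => 0

theorem command_eq_some (M : SCM m) {j : Fin m} {d : Cls m} (h : M.command j = some d) :
    (∃ i, d = .c41 i) ∨ ∃ i, d = .b1 i j := by
  unfold command at h
  split_ifs at h <;> simp only [Option.some.injEq] at h <;> subst h <;> simp

theorem stage_lt (l : Fin 4) (s : Fin (4 * m)) : 4 * m * l + s < 16 * m := by
  have h1 : 4 * m * (l : ℕ) ≤ 4 * m * 3 := Nat.mul_le_mul_left _ (by omega)
  omega

theorem acyclic (M : SCM m) : M.network.Acyclic := by
  refine ⟨rank, fun c d h => ?_⟩
  change M.nextClass c = some d at h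
  cases c
  case m3 k l s =>
    have hl := stage_lt l s
    simp only [nextClass] at h
    split_ifs at h with h1 h2
    · simp only [Option.some.injEq] at h
      subst h
      simp only [rank]; omega
    · simp only [Option.some.injEq] at h
      subst h
      simp only [rank, mul_add, mul_one]; omega
  case m35 j s =>
    simp only [nextClass] at h
    split_ifs at h with h1
    · simp only [Option.some.injEq] at h
      subst h
      simp only [rank]; omega
    · simp only [Option.some.injEq] at h
      subst h
      simp only [rank]; omega
  case m43 j =>
    rcases M.command_eq_some h with ⟨i, rfl⟩ | ⟨i, rfl⟩ <;> simp [rank]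
  case m03 j =>
    simp only [nextClass, Option.some.injEq] at h
    subst h
    simp only [rank]; omega
  all_goals simp only [nextClass, Option.some.injEq, reduceCtorEq] at h
  all_goals subst h; simp [rank]

theorem routed_eq_sum (M : SCM m) (y : Cls m → ℕ) {c : Cls m} (s : Finset (Cls m))
    (h : ∀ d, M.nextClass d = some c ↔ d ∈ s) : M.network.routed y c = ∑ d ∈ s, y d := by
  unfold Network.routed
  rw [← Finset.sum_filter]
  refine Finset.sum_congr ?_ fun _ _ => rfl
  ext d
  rw [Finset.mem_filter, ← h]
  exact ⟨fun h => h.2, fun h => ⟨Finset.mem_univ _, h⟩⟩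

theorem nextClass_m3_eq_some (M : SCM m) {k : Fin m} {l : Fin 4} {s : Fin (4 * m)} {d : Cls m} :
    M.nextClass (.m3 k l s) = some d ↔
      ∃ l' s', d = .m3 k l' s' ∧ 4 * m * l' + s' = 4 * m * l + s + 1 := by
  have hl := stage_lt l s
  simp only [nextClass]
  constructor
  · intro h
    split_ifs at h with h1 h2
    · simp only [Option.some.injEq] at h
      exact ⟨_, _, h.symm, by simp only; omega⟩
    · simp only [Option.some.injEq] at h
      exact ⟨_, _, h.symm, by simp only [mul_add, mul_one]; omega⟩
  · rintro ⟨l', s', rfl, h⟩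
    have hl' := stage_lt l' s'
    have hle : l' = l ∧ (s' : ℕ) = s + 1 ∨ (l' : ℕ) = l + 1 ∧ (s' : ℕ) = 0 ∧ (s : ℕ) + 1 = 4 * m := by
      rcases lt_trichotomy (l' : ℕ) l with hlt | heq | hgt
      · have := Nat.mul_le_mul_left (4 * m) (Nat.succ_le_of_lt hlt)
        rw [Nat.succ_eq_add_one, mul_add, mul_one] at this
        omega
      · left; rw [heq] at h; exact ⟨Fin.ext heq, by omega⟩
      · right
        rcases Nat.lt_or_ge (l + 1) (l' : ℕ) with h1 | h1
        · have := Nat.mul_le_mul_left (4 * m) (Nat.succ_le_of_lt h1)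
          rw [Nat.succ_eq_add_one, mul_add, mul_add, mul_one] at this
          omega
        · have h2 : (l' : ℕ) = l + 1 := by omega
          rw [h2, mul_add, mul_one] at h
          exact ⟨h2, by omega, by omega⟩
    rcases hle with ⟨rfl, h1⟩ | ⟨h1, h2, h3⟩
    · rw [dif_pos (by omega)]
      congr 2
      exact Fin.ext h1.symm
    · rw [dif_neg (by omega), dif_pos (by omega)]
      congr 2
      · exact Fin.ext h1.symm
      · exact Fin.ext h2.symm

theorem routed_c11 (M : SCM m) (y : Cls m → ℕ) (i : Fin 2) :
    M.network.routed y (.c11 i) = y (.c42 i) + y (.c51 i) + y (.b3 i) := by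
  rw [M.routed_eq_sum y {.c42 i, .c51 i, .b3 i}]
  · simp [add_assoc]
  · intro d
    cases d
    case m43 j => simp [nextClass, command]; grind
    all_goals simp [nextClass, eq_comm]
    all_goals grind

theorem routed_c12 (M : SCM m) (y : Cls m → ℕ) (i : Fin 2) :
    M.network.routed y (.c12 i) = y (.c22 i) := by
  rw [M.routed_eq_sum y {.c22 i}]
  · simp
  · intro d
    cases d
    case m43 j => simp [nextClass, command]; grind
    all_goals simp [nextClass, eq_comm]
    all_goals grind

theorem routed_c21 (M : SCM m) (y : Cls m → ℕ) (i : Fin 2) :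
    M.network.routed y (.c21 i) = y (.c11 i) := by
  rw [M.routed_eq_sum y {.c11 i}]
  · simp
  · intro d
    cases d
    case m43 j => simp [nextClass, command]; grind
    all_goals simp [nextClass, eq_comm]
    all_goals grind

theorem routed_c31 (M : SCM m) (y : Cls m → ℕ) (i : Fin 2) :
    M.network.routed y (.c31 i) = y (.c13 i) + y (.c14 i) + y (.c23 i) := by
  rw [M.routed_eq_sum y {.c13 i, .c14 i, .c23 i}]
  · simp [add_assoc]
  · intro d
    cases d
    case m43 j => simp [nextClass, command]; grind
    all_goals simp [nextClass, eq_comm]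
    all_goals grind

theorem routed_m01 (M : SCM m) (y : Cls m → ℕ) (i : Fin 2) :
    M.network.routed y (.m01 i) = y (.c33 i) := by
  rw [M.routed_eq_sum y {.c33 i}]
  · simp
  · intro d
    cases d
    case m43 j => simp [nextClass, command]; grind
    all_goals simp [nextClass, eq_comm]
    all_goals grind

theorem routed_m02 (M : SCM m) (y : Cls m → ℕ) (j : Fin m) :
    M.network.routed y (.m02 j) = y (.m42 j) := by
  rw [M.routed_eq_sum y {.m42 j}]
  · simp
  · intro d
    cases d
    case m43 j => simp [nextClass, command]; grind
    all_goals simp [nextClass, eq_comm]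
    all_goals grind

theorem routed_m03 (M : SCM m) (y : Cls m → ℕ) (j : Fin m) :
    M.network.routed y (.m03 j) = y (.m02 j) := by
  rw [M.routed_eq_sum y {.m02 j}]
  · simp
  · intro d
    cases d
    case m43 j => simp [nextClass, command]; grind
    all_goals simp [nextClass, eq_comm]
    all_goals grind

theorem routed_c41 (M : SCM m) (y : Cls m → ℕ) (i : Fin 2) :
    M.network.routed y (.c41 i) =
      ∑ j, if M.command j = some (.c41 i) then y (.m43 j) else 0 := by
  rw [← Finset.sum_filter, M.routed_eq_sum y
    ((Finset.univ.filter fun j => M.command j = some (.c41 i)).map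
      ⟨Cls.m43, fun _ _ h => by simpa using h⟩), Finset.sum_map]
  · rfl
  · intro d
    cases d
    case m43 j =>
      simp only [nextClass, Finset.mem_map, Finset.mem_filter, Finset.mem_univ, true_and]
      exact ⟨fun h => ⟨j, h, rfl⟩, fun ⟨a, h, e⟩ => by cases e; exact h⟩
    all_goals simp [nextClass]
    all_goals grind

theorem routed_b1 (M : SCM m) (y : Cls m → ℕ) (i : Fin 2) (j : Fin m) :
    M.network.routed y (.b1 i j) = if M.command j = some (.b1 i j) then y (.m43 j) else 0 := by
  have hcmd : ∀ j', M.command j' = some (.b1 i j) → j' = j := by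
    intro j' h
    rcases M.command_eq_some h with ⟨i', h'⟩ | ⟨i', h'⟩ <;> simp at h'
    exact h'.2.symm
  rw [M.routed_eq_sum y (if M.command j = some (.b1 i j) then {.m43 j} else ∅)]
  · split_ifs <;> simp
  · intro d
    cases d
    case m43 j' => 
      simp only [nextClass]
      constructor
      · intro h
        have := hcmd _ h
        subst this
        simp [h]
      · split_ifs with h <;> simp
        rintro rfl
        exact h
    all_goals simp [nextClass]
    all_goals split_ifs <;> simp

theorem routed_m3_first (M : SCM m) (y : Cls m → ℕ) (k : Fin m) (h0 : 0 < 4 * m) :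
    M.network.routed y (.m3 k 0 ⟨0, h0⟩) = y (.m03 k) := by
  rw [M.routed_eq_sum y {.m03 k}]
  · simp
  · intro d
    cases d
    case m43 j => simp [nextClass, command]; grind
    case m3 k l s =>
      simp [nextClass_m3_eq_some]
    case m35 => simp [nextClass]; grind
    all_goals simp [nextClass, eq_comm]

theorem routed_m3_next (M : SCM m) (y : Cls m → ℕ) (k : Fin m) {l l' : Fin 4} {s s' : Fin (4 * m)}
    (h : 4 * m * l' + s' = 4 * m * l + s + 1) :
    M.network.routed y (.m3 k l' s') = y (.m3 k l s) := by
  rw [M.routed_eq_sum y {.m3 k l s}]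
  · simp
  · intro d
    cases d
    case m43 j => simp [nextClass, command]; grind
    case m3 k₁ l₁ s₁ =>
      rw [nextClass_m3_eq_some]
      simp only [Cls.m3.injEq, Finset.mem_singleton]
      constructor
      · rintro ⟨l₂, s₂, ⟨rfl, rfl, rfl⟩, h₂⟩
        have h3 : 4 * m * (l : ℕ) + s = 4 * m * l₁ + s₁ := by omega
        have h4 : (4 * m * (l : ℕ) + s) / (4 * m) = (4 * m * l₁ + s₁) / (4 * m) := by rw [h3]
        rw [Nat.mul_add_div s.pos, Nat.mul_add_div s.pos, Nat.div_eq_of_lt s.2,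
          Nat.div_eq_of_lt s₁.2] at h4
        have h5 : l = l₁ := Fin.ext (by omega)
        subst h5
        exact ⟨rfl, rfl, Fin.ext (by omega)⟩
      · rintro ⟨rfl, rfl, rfl⟩
        exact ⟨_, _, ⟨rfl, rfl, rfl⟩, h⟩
    case m35 => simp [nextClass]; grind
    case m03 =>
      simp [nextClass]
      rintro - rfl
      rw [← Fin.val_eq_val]
      simp only
      intro h1
      simp at h
      omega
    all_goals simp [nextClass, eq_comm]

theorem routed_m35_next (M : SCM m) (y : Cls m → ℕ) (j : Fin m) {s s' : Fin (4 * m)}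
    (h : (s' : ℕ) = s + 1) : M.network.routed y (.m35 j s') = y (.m35 j s) := by
  rw [M.routed_eq_sum y {.m35 j s}]
  · simp
  · intro d
    cases d
    case m43 j => simp [nextClass, command]; grind
    case m3 => simp [nextClass_m3_eq_some]
    case m35 j' s₁ =>
      simp only [nextClass]
      split_ifs <;> simp [Fin.ext_iff] <;> omega
    all_goals simp [nextClass, eq_comm]

theorem routed_m41 (M : SCM m) (y : Cls m → ℕ) (j : Fin m) {s : Fin (4 * m)}
    (h : (s : ℕ) + 1 = 4 * m) : M.network.routed y (.m41 j) = y (.m35 j s) := by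
  rw [M.routed_eq_sum y {.m35 j s}]
  · simp
  · intro d
    cases d
    case m43 j => simp [nextClass, command]; grind
    case m3 => simp [nextClass_m3_eq_some]
    case m35 j' s₁ =>
      simp only [nextClass]
      split_ifs <;> simp [Fin.ext_iff] <;> omega
    all_goals simp [nextClass, eq_comm]

/-- The classes which no job enters from another class. -/
theorem routed_entry (M : SCM m) (y : Cls m → ℕ) {c : Cls m}
    (hc : match c with
      | .c13 _ | .c14 _ | .c22 _ | .c23 _ | .c32 _ | .c33 _ | .c42 _ | .c51 _ | .b2 _ | .b3 _
      | .m42 _ | .m43 _ => True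
      | .m35 _ s => (s : ℕ) = 0
      | _ => False) : M.network.routed y c = 0 := by
  rw [M.routed_eq_sum y ∅]
  · simp
  · intro d
    simp only [Finset.notMem_empty, iff_false]
    intro h
    cases d
    case m43 j => rcases M.command_eq_some h with ⟨i, rfl⟩ | ⟨i, rfl⟩ <;> exact hc
    case m3 =>
      rw [nextClass_m3_eq_some] at h
      obtain ⟨_, _, rfl, -⟩ := h
      exact hc
    case m35 =>
      simp only [nextClass] at h
      split_ifs at h <;> (simp only [Option.some.injEq] at h; subst h; simp at hc)
    all_goals simp only [nextClass, Option.some.injEq, reduceCtorEq] at h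
    all_goals subst h; exact hc

end SCM

/-- A simplified counter machine together with a policy and initial queue lengths for its modified
network. -/
structure Setting (m : ℕ) where
  M : SCM m
  θ : Cls m → ℕ
  q : Cls m → ℕ
  policy : M.network.IsPolicy θ
  levels : M.RespectsLevels θ
  pos : 0 < m
  zero : ∀ c, SCM.bufferSize c = some 0 → q c = 0

namespace Setting

open SCM

variable {m : ℕ} (T : Setting m)

/-- The time of the tick `k`. -/
noncomputable def time (m k : ℕ) : ℚ := (k : ℚ) / (400 * m : ℕ)

/-- The state right before the tick `k`. -/
noncomputable def X (k : ℕ) : State (Srv m) (Cls m) := T.M.network.gridState T.θ T.q (400 * m) k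

/-- The number of waiting jobs of a class right before the tick `k`. -/
noncomputable def w (k : ℕ) (c : Cls m) : ℕ := (T.X k).waiting c

/-- The number of jobs that join a class at the tick `k`. -/
noncomputable def inn (k : ℕ) (c : Cls m) : ℕ := T.M.network.inflow T.θ (time m k) (T.X k) c

/-- The number of jobs that leave a class at the tick `k`. -/
noncomputable def out (k : ℕ) (c : Cls m) : ℕ := T.M.network.outflow T.θ (time m k) (T.X k) c

/-- The number of external arrivals at the tick `k`. -/
noncomputable def arr (m k : ℕ) (c : Cls m) : ℕ :=
  ((arrivalTicks c).map fun p => if p.2 ≤ k ∧ (k - p.2) % p.1 = 0 then 1 else 0).getD 0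

/-- Right before the tick `k` the server `s` is idle. -/
def Idle (k : ℕ) (s : Srv m) : Prop := (T.X k).serving s = none

/-- Right before the tick `k` the server of the class `c` serves a job of this class since the
tick `j`. -/
def Serves (k : ℕ) (c : Cls m) (j : ℕ) : Prop :=
  (T.X k).serving (T.M.serverOf c) = some (c, time m j)

/-- The server `s` is free at the tick `k`, possibly because a service ends. -/
def Free (k : ℕ) (s : Srv m) : Prop :=
  T.Idle k s ∨ ∃ c j, T.M.serverOf c = s ∧ T.Serves k c j ∧ j + ticks c = k

theorem X_succ (k : ℕ) : T.X (k + 1) = T.M.network.instant T.θ (time m k) (T.X k) := rfl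

theorem regular (k : ℕ) : T.M.network.Regular (400 * m) k (T.X k) :=
  T.M.network.regular_gridState (T.M.onGrid T.pos) T.M.acyclic T.θ T.q k

theorem positive (k : ℕ) : Network.State.Positive T.M.network (T.X k) := (T.regular k).positive

theorem service_ne_iff (c : Cls m) : T.M.network.service c ≠ 0 ↔ ticks c ≠ 0 := by
  change serviceTime c ≠ 0 ↔ _
  rw [serviceTime_eq T.pos]
  simp [T.pos.ne']

theorem time_add_eq_iff (j k : ℕ) (c : Cls m) :
    time m j + T.M.network.service c = time m k ↔ j + ticks c = k := by
  change time m j + serviceTime c = _ ↔ _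
  rw [serviceTime_eq T.pos]
  unfold time
  have : ((400 * m : ℕ) : ℚ) ≠ 0 := by
    have := T.pos
    exact_mod_cast (by omega : 400 * m ≠ 0)
  rw [← add_div, div_left_inj' this]
  exact_mod_cast Iff.rfl

theorem inn_eq (k : ℕ) (c : Cls m) :
    T.inn k c = arr m k c + T.M.network.routed (T.out k) c := by
  change T.M.network.arrivals (time m k) c + _ = _
  rw [time, T.M.arrivals_eq T.pos]
  rfl

theorem Free.freeAt {T : Setting m} {k : ℕ} {s : Srv m} (h : T.Free k s) :
    T.M.network.FreeAt (time m k) (T.X k) s := by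
  intro p hp
  rcases h with h | ⟨c, j, hc, hs, hj⟩
  · unfold Idle at h
    rw [hp] at h; cases h
  · unfold Serves at hs
    rw [hc, hp] at hs
    cases hs
    exact (T.time_add_eq_iff j k c).2 hj

theorem Serves.succ {T : Setting m} {k j : ℕ} {c : Cls m} (h : T.Serves k c j)
    (hk : j + ticks c ≠ k) : T.Serves (k + 1) c j :=
  T.M.network.instant_serving_of_busy T.θ h fun h' => hk ((T.time_add_eq_iff j k c).1 h')

theorem Serves.out_eq_zero {T : Setting m} {k j : ℕ} {c d : Cls m} (h : T.Serves k c j)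
    (hk : j + ticks c ≠ k) (hd : T.M.serverOf d = T.M.serverOf c) : T.out k d = 0 :=
  T.M.network.outflow_of_busy T.θ (d := d)
    (by rw [show T.M.network.server d = _ from hd]; exact h)
    fun h' => hk ((T.time_add_eq_iff j k c).1 h')

theorem Serves.w_succ {T : Setting m} {k j : ℕ} {c d : Cls m} (h : T.Serves k c j)
    (hk : j + ticks c ≠ k) (hd : T.M.serverOf d = T.M.serverOf c) :
    T.w (k + 1) d = Network.stored (bufferSize d) (T.w k d + T.inn k d) :=
  T.M.network.instant_waiting_of_busy T.θ (d := d)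
    (by rw [show T.M.network.server d = _ from hd]; exact h)
    fun h' => hk ((T.time_add_eq_iff j k c).1 h')

theorem Serves.out_self {T : Setting m} {k j : ℕ} {c : Cls m} (h : T.Serves k c j)
    (hc : ticks c ≠ 0) : T.out k c = if j + ticks c = k then 1 else 0 := by
  split_ifs with hk
  · unfold out
    rw [T.M.network.outflow_of_service_ne _ _ _ ((T.service_ne_iff c).2 hc)]
    exact T.M.network.finishing_of_end h ((T.time_add_eq_iff j k c).2 hk)
  · exact h.out_eq_zero hk rfl

theorem Serves.out_other {T : Setting m} {k j : ℕ} {c d : Cls m} (h : T.Serves k c j)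
    (hd : T.M.serverOf d = T.M.serverOf c) (hne : c ≠ d) (ht : ticks d ≠ 0) : T.out k d = 0 := by
  unfold out
  rw [T.M.network.outflow_of_service_ne _ _ _ ((T.service_ne_iff d).2 ht)]
  exact T.M.network.finishing_of_serving (c := c)
    (by rw [show T.M.network.server d = _ from hd]; exact h) (Or.inl hne)

theorem Idle.out_eq_zero {T : Setting m} {k : ℕ} {d : Cls m} (h : T.Idle k (T.M.serverOf d))
    (ht : ticks d ≠ 0) : T.out k d = 0 := by
  unfold out
  rw [T.M.network.outflow_of_service_ne _ _ _ ((T.service_ne_iff d).2 ht)]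
  exact T.M.network.finishing_of_none h

theorem out_le (k : ℕ) {c : Cls m} (hc : ticks c = 0) : T.out k c ≤ T.w k c + T.inn k c := by
  refine T.M.network.outflow_le T.θ _ (T.positive k) ?_
  by_contra h
  exact (T.service_ne_iff c).1 h hc

/-- A free server gets idle if no jobs with a positive service time are present; the other jobs
pass. -/
theorem Free.idle_succ {T : Setting m} {k : ℕ} {s : Srv m} (h : T.Free k s)
    (h0 : ∀ d, T.M.serverOf d = s → ticks d ≠ 0 → T.w k d = 0 ∧ T.inn k d = 0) :
    T.Idle (k + 1) s :=
  T.M.network.instant_serving_of_idle T.M.acyclic T.θ h.freeAt fun d hd hd' => by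
    have := h0 d hd ((T.service_ne_iff d).1 hd')
    exact Nat.add_eq_zero_iff.2 this

theorem Free.out_eq {T : Setting m} {k : ℕ} {s : Srv m} (h : T.Free k s)
    (h0 : ∀ d, T.M.serverOf d = s → ticks d ≠ 0 → T.w k d = 0 ∧ T.inn k d = 0)
    {d : Cls m} (hd : T.M.serverOf d = s) (hd0 : ticks d = 0) :
    T.out k d = T.w k d + T.inn k d :=
  T.M.network.outflow_of_idle T.M.acyclic T.θ (T.positive k) h.freeAt (fun d hd hd' => by
    have := h0 d hd ((T.service_ne_iff d).1 hd')
    exact Nat.add_eq_zero_iff.2 this) hd (by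
      by_contra h
      exact (T.service_ne_iff d).1 h hd0)

/-- No job waits at an idle server. -/
theorem Idle.w_eq_zero {T : Setting m} {k : ℕ} {d : Cls m} (h : T.Idle (k + 1) (T.M.serverOf d)) :
    T.w (k + 1) d = 0 := T.M.network.waiting_instant_of_serving_none T.θ _ _ h

theorem w_of_capacity_zero (k : ℕ) {c : Cls m} (hc : bufferSize c = some 0) : T.w k c = 0 := by
  cases k with
  | zero => exact T.zero c hc
  | succ k =>
    have h : Network.stored (bufferSize c) (T.w (k + 1) c) = T.w (k + 1) c :=
      T.M.network.waiting_instant_le_capacity T.θ (time m k) (T.X k) c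
    rw [hc] at h
    simpa [Network.stored] using h.symm

/-- The condition that the next job served at a free server is one of class `c`. -/
def Next (k : ℕ) (c : Cls m) : Prop :=
  T.Free k (T.M.serverOf c) ∧ ticks c ≠ 0 ∧ 0 < T.w k c + T.inn k c ∧
    ∀ d, T.M.serverOf d = T.M.serverOf c → ticks d ≠ 0 → d ≠ c →
      level c < level d ∨ T.w k d = 0 ∧ T.inn k d = 0

theorem Next.le {T : Setting m} {k : ℕ} {c : Cls m} (h : T.Next k c) (d : Cls m)
    (hd : T.M.network.server d = T.M.network.server c) (hs : T.M.network.service d ≠ 0)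
    (hw : 0 < (T.X k).waiting d + T.M.network.inflow T.θ (time m k) (T.X k) d) :
    T.θ c ≤ T.θ d := by
  by_cases hdc : d = c
  · rw [hdc]
  · rcases h.2.2.2 d hd ((T.service_ne_iff d).1 hs) hdc with h1 | h1
    · exact (T.levels c d (Eq.symm hd) h1).le
    · exact absurd (Nat.add_eq_zero_iff.2 h1) hw.ne'

theorem Next.serves {T : Setting m} {k : ℕ} {c : Cls m} (h : T.Next k c) :
    T.Serves (k + 1) c k :=
  T.M.network.instant_serving_of_start T.M.acyclic T.policy h.1.freeAt
    ((T.service_ne_iff c).2 h.2.1) h.2.2.1 h.le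

theorem Next.w_aux {T : Setting m} {k : ℕ} {c : Cls m} (h : T.Next k c) {d : Cls m}
    (hd : T.M.serverOf d = T.M.serverOf c) :
    T.w (k + 1) d = Network.stored (bufferSize d)
      ((T.M.network.beforeStart T.θ (time m k) (T.X k)).waiting d - if d = c then 1 else 0) :=
  T.M.network.instant_waiting_of_start T.M.acyclic T.policy h.1.freeAt
    ((T.service_ne_iff c).2 h.2.1) h.2.2.1 h.le hd

theorem Next.w_self {T : Setting m} {k : ℕ} {c : Cls m} (h : T.Next k c) :
    T.w (k + 1) c = Network.stored (bufferSize c) (T.w k c + T.inn k c - 1) := by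
  rw [h.w_aux rfl, T.M.network.beforeStart_waiting_of_service_ne _ _ _
    ((T.service_ne_iff c).2 h.2.1), if_pos rfl]
  rfl

theorem Next.w_other {T : Setting m} {k : ℕ} {c d : Cls m} (h : T.Next k c)
    (hd : T.M.serverOf d = T.M.serverOf c) (hdc : d ≠ c) (ht : ticks d ≠ 0) :
    T.w (k + 1) d = Network.stored (bufferSize d) (T.w k d + T.inn k d) := by
  rw [h.w_aux hd, T.M.network.beforeStart_waiting_of_service_ne _ _ _
    ((T.service_ne_iff d).2 ht), if_neg hdc]
  rfl

theorem Next.w_zero {T : Setting m} {k : ℕ} {c d : Cls m} (h : T.Next k c)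
    (hd : T.M.serverOf d = T.M.serverOf c) (ht : ticks d = 0) :
    T.w (k + 1) d = Network.stored (bufferSize d) (T.w k d + T.inn k d - T.out k d) := by
  have hdc : d ≠ c := fun h' => h.2.1 (h' ▸ ht)
  have hs : T.M.network.service d = 0 := by
    by_contra h'
    exact (T.service_ne_iff d).1 h' ht
  have h1 := T.M.network.beforeStart_waiting T.θ (time m k) (T.X k) d
  rw [T.M.network.finishing_of_service_eq (T.positive k) hs, add_zero] at h1
  rw [h.w_aux hd, if_neg hdc, Nat.sub_zero]
  congr 1
  exact Nat.eq_sub_of_add_eq h1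

/-- At a server whose service is in progress or ends, a waiting job with a positive service time
keeps the jobs of lower priority from instantaneous service. -/
theorem Serves.out_eq_zero_of_blocked {T : Setting m} {k j : ℕ} {b c d : Cls m}
    (hb : T.Serves k b j) (hbc : T.M.serverOf b = T.M.serverOf c)
    (hs : T.M.serverOf d = T.M.serverOf c)
    (hd : ticks d ≠ 0) (hc : ticks c = 0) (hp : level d < level c)
    (hw : 0 < T.w k d + T.M.network.routed (T.M.network.flushed T.θ
      (T.M.network.arrive (time m k) (T.X k))) d) : T.out k c = 0 := by
  refine T.M.network.outflow_of_blocked T.θ (T.positive k) (d := d) hs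
    ((T.service_ne_iff d).2 hd) ?_ (T.levels d c hs hp) ?_ ?_
  · by_contra h'
    exact (T.service_ne_iff c).1 h' hc
  · refine T.M.network.flushed_of_serving T.θ _ ?_
    change (T.X k).serving (T.M.serverOf c) ≠ none
    rw [← hbc]
    unfold Serves at hb
    rw [hb]
    simp
  · unfold w at hw
    omega

theorem Serves.trans {T : Setting m} {a b j : ℕ} {c : Cls m} (h : T.Serves a c j) (hab : a ≤ b)
    (hb : b ≤ j + ticks c) : T.Serves b c j := by
  induction b, hab using Nat.le_induction with
  | base => exact h
  | succ b hab ih => exact (ih (by omega)).succ (by omega)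

theorem Idle.trans {T : Setting m} {a b : ℕ} {s : Srv m} (h : T.Idle a s) (ha : 0 < a) (hab : a ≤ b)
    (h0 : ∀ k, a ≤ k → k < b → ∀ d, T.M.serverOf d = s → ticks d ≠ 0 → T.inn k d = 0) :
    T.Idle b s := by
  induction b, hab using Nat.le_induction with
  | base => exact h
  | succ b hab ih =>
    have h1 := ih fun k hk hkb => h0 k hk (by omega)
    refine Free.idle_succ (Or.inl h1) fun d hd hd' => ⟨?_, h0 b hab (by omega) d hd hd'⟩
    obtain ⟨b, rfl⟩ : ∃ b', b = b' + 1 := ⟨b - 1, by omega⟩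
    exact Idle.w_eq_zero (by rw [hd]; exact h1)

/-! ### Inflows of the classes -/

section Inflow

variable (k : ℕ)

theorem inn_c11 (i : Fin 2) :
    T.inn k (.c11 i) = T.out k (.c42 i) + T.out k (.c51 i) + T.out k (.b3 i) := by
  rw [inn_eq, routed_c11]; simp [arr, arrivalTicks]

theorem inn_c12 (i : Fin 2) : T.inn k (.c12 i) = T.out k (.c22 i) := by
  rw [inn_eq, routed_c12]; simp [arr, arrivalTicks]

theorem inn_c21 (i : Fin 2) : T.inn k (.c21 i) = T.out k (.c11 i) := by
  rw [inn_eq, routed_c21]; simp [arr, arrivalTicks]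

theorem inn_c31 (i : Fin 2) :
    T.inn k (.c31 i) = T.out k (.c13 i) + T.out k (.c14 i) + T.out k (.c23 i) := by
  rw [inn_eq, routed_c31]; simp [arr, arrivalTicks]

theorem inn_c41 (i : Fin 2) : T.inn k (.c41 i) =
    ∑ j, if T.M.command j = some (.c41 i) then T.out k (.m43 j) else 0 := by
  rw [inn_eq, routed_c41]; simp [arr, arrivalTicks]

theorem inn_c51 (i : Fin 2) : T.inn k (.c51 i) = 0 := by
  rw [inn_eq, routed_entry _ _ trivial]; simp [arr, arrivalTicks]

theorem inn_b1 (i : Fin 2) (j : Fin m) : T.inn k (.b1 i j) =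
    if T.M.command j = some (.b1 i j) then T.out k (.m43 j) else 0 := by
  rw [inn_eq, routed_b1]; simp [arr, arrivalTicks]

theorem inn_m01 (i : Fin 2) : T.inn k (.m01 i) = T.out k (.c33 i) := by
  rw [inn_eq, routed_m01]; simp [arr, arrivalTicks]

theorem inn_m02 (j : Fin m) : T.inn k (.m02 j) = T.out k (.m42 j) := by
  rw [inn_eq, routed_m02]; simp [arr, arrivalTicks]

theorem inn_m03 (j : Fin m) : T.inn k (.m03 j) = T.out k (.m02 j) := by
  rw [inn_eq, routed_m03]; simp [arr, arrivalTicks]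

theorem inn_m3_first (j : Fin m) (h0 : 0 < 4 * m) :
    T.inn k (.m3 j 0 ⟨0, h0⟩) = T.out k (.m03 j) := by
  rw [inn_eq, routed_m3_first]; simp [arr, arrivalTicks]

theorem inn_m3_next (j : Fin m) {l l' : Fin 4} {s s' : Fin (4 * m)}
    (h : 4 * m * l' + s' = 4 * m * l + s + 1) :
    T.inn k (.m3 j l' s') = T.out k (.m3 j l s) := by
  rw [inn_eq, routed_m3_next _ _ _ h]; simp [arr, arrivalTicks]

theorem inn_m35_next (j : Fin m) {s s' : Fin (4 * m)} (h : (s' : ℕ) = s + 1) :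
    T.inn k (.m35 j s') = T.out k (.m35 j s) := by
  rw [inn_eq, routed_m35_next _ _ _ h]; simp [arr, arrivalTicks, h]

theorem inn_m41 (j : Fin m) {s : Fin (4 * m)} (h : (s : ℕ) + 1 = 4 * m) :
    T.inn k (.m41 j) = T.out k (.m35 j s) := by
  rw [inn_eq, routed_m41 _ _ _ h]; simp [arr, arrivalTicks]

/-- The class of the external arrivals with the given period and delay has an arrival at the tick
`B + o`, where `B` is the beginning of a cycle, only if `o` is the delay. -/
theorem arr_period {B n o a p : ℕ} (hB : B = p * n) (ho : o < p) (ha : a < p) :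
    (if a ≤ B + o ∧ (B + o - a) % p = 0 then 1 else 0 : ℕ) = if o = a then 1 else 0 := by
  subst hB
  have h1 : (a ≤ p * n + o ∧ (p * n + o - a) % p = 0) ↔ o = a := by
    constructor
    · rintro ⟨h1, h2⟩
      have h3 := (Nat.modEq_iff_dvd' h1).2 (Nat.dvd_of_mod_eq_zero h2)
      unfold Nat.ModEq at h3
      rw [Nat.mul_add_mod, Nat.mod_eq_of_lt ho, Nat.mod_eq_of_lt ha] at h3
      exact h3.symm
    · rintro rfl
      exact ⟨Nat.le_add_left _ _, by rw [Nat.add_sub_cancel, Nat.mul_mod_right]⟩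
  simp only [h1]

theorem inn_c22 {U u o : ℕ} (hU : U = 400 * m * u) (ho : o < 400 * m) (i : Fin 2) :
    T.inn (U + o) (.c22 i) = if o = 0 then 1 else 0 := by
  rw [inn_eq, routed_entry _ _ trivial, ← arr_period hU ho (by omega)]; rfl

theorem inn_c42 {U u o : ℕ} (hU : U = 400 * m * u) (ho : o < 400 * m) (i : Fin 2) :
    T.inn (U + o) (.c42 i) = if o = 0 then 1 else 0 := by
  rw [inn_eq, routed_entry _ _ trivial, ← arr_period hU ho (by omega)]; rfl

variable {B n o : ℕ} (hB : B = 1200 * m * n) (ho : o < 1200 * m)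

include hB ho

theorem inn_c13 (i : Fin 2) : T.inn (B + o) (.c13 i) = if o = 640 * m then 1 else 0 := by
  rw [inn_eq, routed_entry _ _ trivial, ← arr_period hB ho (by omega)]; rfl

theorem inn_c14 (i : Fin 2) : T.inn (B + o) (.c14 i) = if o = 1040 * m then 1 else 0 := by
  rw [inn_eq, routed_entry _ _ trivial, ← arr_period hB ho (by omega)]; rfl

theorem inn_c23 (i : Fin 2) : T.inn (B + o) (.c23 i) = if o = 840 * m then 1 else 0 := by
  rw [inn_eq, routed_entry _ _ trivial, ← arr_period hB ho (by omega)]; rfl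

theorem inn_c32 (i : Fin 2) : T.inn (B + o) (.c32 i) = if o = 600 * m then 1 else 0 := by
  rw [inn_eq, routed_entry _ _ trivial, ← arr_period hB ho (by omega)]; rfl

theorem inn_c33 (i : Fin 2) : T.inn (B + o) (.c33 i) = if o = 1080 * m then 1 else 0 := by
  rw [inn_eq, routed_entry _ _ trivial, ← arr_period hB ho (by omega)]; rfl

theorem inn_b2 (i : Fin 2) : T.inn (B + o) (.b2 i) = if o = 0 then 1 else 0 := by
  rw [inn_eq, routed_entry _ _ trivial, ← arr_period hB ho (by omega)]; rfl

theorem inn_b3 (i : Fin 2) : T.inn (B + o) (.b3 i) = if o = 4 * m then 1 else 0 := by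
  rw [inn_eq, routed_entry _ _ trivial, ← arr_period hB ho (by omega)]; rfl

theorem inn_m35_first (j : Fin m) {s : Fin (4 * m)} (hs : (s : ℕ) = 0) :
    T.inn (B + o) (.m35 j s) = if o = 1196 * m then 1 else 0 := by
  rw [inn_eq, routed_entry _ _ (show (s : ℕ) = 0 from hs),
    ← arr_period hB ho (by omega)]
  simp [arr, arrivalTicks, hs]

theorem arr_late : (if 1200 * m ≤ B + o ∧ (B + o - 1200 * m) % (1200 * m) = 0 then 1 else 0 : ℕ) =
    if o = 0 ∧ 0 < n then 1 else 0 := by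
  rcases n with _ | n
  · rw [if_neg (by rw [hB]; omega), if_neg (by omega)]
  · have h1 : B + o = 1200 * m * n + o + 1200 * m := by rw [hB]; ring
    have h2 := arr_period (B := 1200 * m * n) (a := 0) rfl ho (by omega)
    rw [h1]
    simp only [Nat.zero_le, true_and, Nat.sub_zero] at h2
    simp only [Nat.le_add_left, Nat.add_sub_cancel, true_and, Nat.succ_pos, and_true, h2]

theorem inn_m42 (j : Fin m) : T.inn (B + o) (.m42 j) = if o = 0 ∧ 0 < n then 1 else 0 := by
  rw [inn_eq, routed_entry _ _ trivial, ← arr_late hB ho]; rfl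

theorem inn_m43 (j : Fin m) : T.inn (B + o) (.m43 j) = if o = 0 ∧ 0 < n then 1 else 0 := by
  rw [inn_eq, routed_entry _ _ trivial, ← arr_late hB ho]; rfl

end Inflow

/-! ### Classes with positive service times at the servers -/

section Servers

variable {T} {P : Cls m → Prop}

theorem forall_s1 {i : Fin 2} (h : P (.c12 i)) :
    ∀ d, T.M.serverOf d = .s1 i → ticks d ≠ 0 → P d := by
  intro d hd ht
  cases d <;> simp [serverOf, ticks] at hd ht
  subst hd
  exact h

theorem forall_s2 {i : Fin 2} (h : P (.c21 i)) :
    ∀ d, T.M.serverOf d = .s2 i → ticks d ≠ 0 → P d := by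
  intro d hd ht
  cases d <;> simp [serverOf, ticks] at hd ht
  subst hd
  exact h

theorem forall_s3 {i : Fin 2} (h : P (.c31 i)) (h' : P (.c32 i)) :
    ∀ d, T.M.serverOf d = .s3 i → ticks d ≠ 0 → P d := by
  intro d hd ht
  cases d <;> simp [serverOf, ticks] at hd ht <;> (subst hd; assumption)

theorem forall_s4 {i : Fin 2} (h : P (.c41 i)) (h' : P (.c42 i)) :
    ∀ d, T.M.serverOf d = .s4 i → ticks d ≠ 0 → P d := by
  intro d hd ht
  cases d <;> simp [serverOf, ticks] at hd ht <;> (subst hd; assumption)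

theorem forall_s5 {i : Fin 2} (h : P (.c51 i)) :
    ∀ d, T.M.serverOf d = .s5 i → ticks d ≠ 0 → P d := by
  intro d hd ht
  cases d <;> simp [serverOf, ticks] at hd ht
  subst hd
  exact h

theorem forall_blk {i : Fin 2} (h : ∀ j, P (.b1 i j)) (h' : P (.b2 i)) (h'' : P (.b3 i)) :
    ∀ d, T.M.serverOf d = .blk i → ticks d ≠ 0 → P d := by
  intro d hd ht
  cases d <;> simp [serverOf, ticks] at hd ht <;> (subst hd; first | assumption | exact h _)

theorem forall_m01 (h : ∀ i, P (.m01 i)) :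
    ∀ d, T.M.serverOf d = .m01 → ticks d ≠ 0 → P d := by
  intro d hd ht
  cases d <;> simp [serverOf, ticks] at hd ht
  exact h _

theorem forall_m02 {j : Fin m} (h : P (.m02 j)) :
    ∀ d, T.M.serverOf d = .m02 j → ticks d ≠ 0 → P d := by
  intro d hd ht
  cases d <;> simp [serverOf, ticks] at hd ht
  subst hd
  exact h

theorem forall_m3 {j : Fin m} {s : Fin (4 * m)}
    (h : ∀ k l, T.M.successor k l = j → P (.m3 k l s)) :
    ∀ d, T.M.serverOf d = .m3 j s → ticks d ≠ 0 → P d := by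
  intro d hd ht
  cases d <;> simp [serverOf, ticks] at hd ht
  obtain ⟨h1, rfl⟩ := hd
  exact h _ _ h1

theorem forall_m4 {j : Fin m} (h : P (.m41 j)) :
    ∀ d, T.M.serverOf d = .m4 j → ticks d ≠ 0 → P d := by
  intro d hd ht
  cases d <;> simp [serverOf, ticks] at hd ht
  subst hd
  exact h

end Servers

/-! ### Services without successor -/

/-- If no other jobs with a positive service time come to a server than such as are dropped, then
the server gets idle after the current service. -/
theorem Serves.then_idle_of {T : Setting m} {c : Cls m} {a h E : ℕ} (hs : T.Serves a c h)
    (ha : a ≤ h + ticks c)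
    (hw : ∀ d, T.M.serverOf d = T.M.serverOf c → ticks d ≠ 0 → T.w a d = 0)
    (hin : ∀ k, a ≤ k → k < E → ∀ d, T.M.serverOf d = T.M.serverOf c → ticks d ≠ 0 →
      T.inn k d = 0 ∨ k < h + ticks c ∧ bufferSize d = some 0) :
    (∀ k, a ≤ k → k ≤ h + ticks c → T.Serves k c h) ∧
      (∀ k, h + ticks c < k → k ≤ E → T.Idle k (T.M.serverOf c)) ∧
      ∀ k, a ≤ k → k < E → ∀ d, T.M.serverOf d = T.M.serverOf c → ticks d ≠ 0 →
        T.out k d = if d = c ∧ k = h + ticks c then 1 else 0 := by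
  have h1 : ∀ k, a ≤ k → k ≤ h + ticks c → T.Serves k c h := fun k hk hk' => hs.trans hk hk'
  have h2 : ∀ k, a ≤ k → k ≤ E → k ≤ h + ticks c →
      ∀ d, T.M.serverOf d = T.M.serverOf c → ticks d ≠ 0 → T.w k d = 0 := by
    intro k hk
    induction k, hk using Nat.le_induction with
    | base => exact fun _ _ => hw
    | succ k hk ih =>
      intro hkE hk' d hd hd'
      rw [(h1 k hk (by omega)).w_succ (by omega) hd, ih (by omega) (by omega) d hd hd']
      rcases hin k hk (by omega) d hd hd' with h3 | ⟨-, h3⟩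
      · rw [h3, Network.stored_zero]
      · rw [h3]; simp [Network.stored]
  have h3 : ∀ k, h + ticks c < k → k ≤ E → T.Idle k (T.M.serverOf c) := by
    intro k hk hkE
    refine Idle.trans (a := h + ticks c + 1) ?_ (Nat.succ_pos _) hk fun k' hk' hkk' d hd hd' => ?_
    · refine Free.idle_succ (Or.inr ⟨c, h, rfl, h1 _ (by omega) le_rfl, rfl⟩) fun d hd hd' => ⟨?_, ?_⟩
      · exact h2 _ (by omega) (by omega) le_rfl d hd hd'
      · rcases hin (h + ticks c) (by omega) (by omega) d hd hd' with h4 | ⟨h4, -⟩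
        · exact h4
        · omega
    · rcases hin k' (by omega) (by omega) d hd hd' with h4 | ⟨h4, -⟩
      · exact h4
      · omega
  refine ⟨h1, h3, fun k hk hkE d hd hd' => ?_⟩
  rcases Nat.lt_or_ge (h + ticks c) k with hlt | hge
  · rw [if_neg (by omega)]
    exact (show T.Idle k (T.M.serverOf d) by rw [hd]; exact h3 k hlt (by omega)).out_eq_zero hd'
  · by_cases hdc : d = c
    · subst hdc
      rw [(h1 k hk hge).out_self hd']
      simp only [true_and, eq_comm]
    · rw [if_neg fun h => hdc h.1]
      exact (h1 k hk hge).out_other hd (Ne.symm hdc) hd'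

theorem Serves.then_idle {T : Setting m} {c : Cls m} {h E : ℕ} (hs : T.Serves (h + 1) c h)
    (ht : 0 < ticks c)
    (hw : ∀ d, T.M.serverOf d = T.M.serverOf c → ticks d ≠ 0 → T.w (h + 1) d = 0)
    (hin : ∀ k, h < k → k < E → ∀ d, T.M.serverOf d = T.M.serverOf c → ticks d ≠ 0 →
      T.inn k d = 0 ∨ k < h + ticks c ∧ bufferSize d = some 0) :
    (∀ k, h < k → k ≤ h + ticks c → T.Serves k c h) ∧
      (∀ k, h + ticks c < k → k ≤ E → T.Idle k (T.M.serverOf c)) ∧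
      ∀ k, h < k → k < E → ∀ d, T.M.serverOf d = T.M.serverOf c → ticks d ≠ 0 →
        T.out k d = if d = c ∧ k = h + ticks c then 1 else 0 :=
  hs.then_idle_of (by omega) hw hin

end Setting

namespace Setting

open SCM

variable {m : ℕ} (T : Setting m)

/-! ### The two servers which store the value of a counter -/

/-- The state of the servers `i1` and `i2` right before the tick `k`. For `σ = (true, a, b)`, a job
of the class `i12` is in service since the tick `h`, while `a` jobs of class `i11` and `b` jobs of
class `i12` wait. For `σ = (false, a, b)`, a job of class `i21` is in service since the tick `h`,
while `a` jobs of class `i21` and `b` jobs of class `i22` wait. -/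
def Core (i : Fin 2) (k h : ℕ) : Bool × ℕ × ℕ → Prop
  | (true, a, b) => T.Serves k (.c12 i) h ∧ T.Idle k (.s2 i) ∧
      T.w k (.c11 i) = a ∧ T.w k (.c12 i) = b ∧ T.w k (.c21 i) = 0 ∧ T.w k (.c22 i) = 0
  | (false, a, b) => T.Serves k (.c21 i) h ∧ T.Idle k (.s1 i) ∧
      T.w k (.c21 i) = a ∧ T.w k (.c22 i) = b ∧ T.w k (.c11 i) = 0 ∧ T.w k (.c12 i) = 0

/-- The number of waiting jobs. -/
def load : Bool × ℕ × ℕ → ℕ := fun σ => σ.2.1 + σ.2.2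

/-- The effect of `e` arrivals in class `i11`. -/
def addJobs (e : ℕ) : Bool × ℕ × ℕ → Bool × ℕ × ℕ := fun σ => (σ.1, σ.2.1 + e, σ.2.2)

/-- The effect of the end of a service, together with `v` external arrivals in class `i22`. -/
def serveNext (v : ℕ) : Bool × ℕ × ℕ → Bool × ℕ × ℕ
  | (true, a, b) => if b + v = 0 then (false, a - 1, 0) else (true, a, b + v - 1)
  | (false, a, b) => if a = 0 then (true, 0, b + v - 1) else (false, a - 1, b + v)

variable {T}

/-- Between the ends of services, arrivals in class `i11` are added to the jobs of the classes
`i11`, `i21`, according to which one of them cannot be served. -/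
theorem Core.step {i : Fin 2} {k h : ℕ} {σ : Bool × ℕ × ℕ} (hσ : T.Core i k h σ)
    (hk : h + 200 * m ≠ k) (hv : T.inn k (.c22 i) = 0) :
    T.Core i (k + 1) h (addJobs (T.inn k (.c11 i)) σ) := by
  obtain ⟨μ, a, b⟩ := σ
  cases μ
  · obtain ⟨h1, h2, h3, h4, h5, h6⟩ := hσ
    have o22 : T.out k (.c22 i) = 0 := h1.out_eq_zero hk rfl
    have i12 : T.inn k (.c12 i) = 0 := by rw [inn_c12, o22]
    have o11 : T.out k (.c11 i) = T.inn k (.c11 i) := by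
      rw [Free.out_eq (s := .s1 i) (Or.inl h2) (forall_s1 ⟨h6, i12⟩) rfl rfl, h5, zero_add]
    have h2' : T.Idle (k + 1) (.s1 i) := Free.idle_succ (Or.inl h2) (forall_s1 ⟨h6, i12⟩)
    refine ⟨h1.succ hk, h2', ?_, ?_, Idle.w_eq_zero h2', Idle.w_eq_zero h2'⟩
    · rw [h1.w_succ hk (d := .c21 i) rfl, h3, inn_c21, o11]; rfl
    · rw [h1.w_succ hk (d := .c22 i) rfl, h4, hv]; rfl
  · obtain ⟨h1, h2, h3, h4, h5, h6⟩ := hσ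
    have o11 : T.out k (.c11 i) = 0 := h1.out_eq_zero hk rfl
    have i21 : T.inn k (.c21 i) = 0 := by rw [inn_c21, o11]
    have o22 : T.out k (.c22 i) = 0 := by
      have := T.out_le k (c := .c22 i) rfl
      omega
    have h2' : T.Idle (k + 1) (.s2 i) := Free.idle_succ (Or.inl h2) (forall_s2 ⟨h5, i21⟩)
    refine ⟨h1.succ hk, h2', ?_, ?_, Idle.w_eq_zero h2', Idle.w_eq_zero h2'⟩
    · rw [h1.w_succ hk (d := .c11 i) rfl, h3]; rfl
    · rw [h1.w_succ hk (d := .c12 i) rfl, h4, inn_c12, o22]; rfl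

/-- At the end of a service, the same server goes on if it has a job with positive service time;
otherwise it releases the other jobs, and the other server begins to work. -/
theorem Core.next {i : Fin 2} {k h : ℕ} {σ : Bool × ℕ × ℕ} (hσ : T.Core i k h σ)
    (hk : h + 200 * m = k) (he : T.inn k (.c11 i) = 0)
    (hpos : 0 < load σ + T.inn k (.c22 i)) :
    T.Core i (k + 1) k (serveNext (T.inn k (.c22 i)) σ) := by
  have hm := T.pos
  have htm : (200 * m ≠ 0) := by omega
  have harr : T.M.network.arrivals (time m k) (.c22 i) = T.inn k (.c22 i) := by
    rw [inn_eq, routed_entry _ _ trivial, add_zero, time, T.M.arrivals_eq T.pos]; rfl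
  generalize hvv : T.inn k (.c22 i) = v at *
  obtain ⟨μ, a, b⟩ := σ
  simp only [load] at hpos
  cases μ
  · obtain ⟨h1, h2, h3, h4, h5, h6⟩ := hσ
    have hfree : T.Free k (.s2 i) := Or.inr ⟨_, h, rfl, h1, hk⟩
    have o11 : T.out k (.c11 i) = 0 := by
      have := T.out_le k (c := .c11 i) rfl
      omega
    have i21 : T.inn k (.c21 i) = 0 := by rw [inn_c21, o11]
    by_cases ha : a = 0
    · subst ha
      have o22 : T.out k (.c22 i) = b + v := by
        rw [hfree.out_eq (forall_s2 ⟨h3, i21⟩) rfl rfl, h4, hvv]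
      have i12 : T.inn k (.c12 i) = b + v := by rw [inn_c12, o22]
      have hnext : T.Next k (.c12 i) :=
        ⟨Or.inl h2, htm, by omega, forall_s1 fun h => absurd rfl h⟩
      have h2' : T.Idle (k + 1) (.s2 i) := hfree.idle_succ (forall_s2 ⟨h3, i21⟩)
      simp only [serveNext, if_true]
      refine ⟨hnext.serves, h2', ?_, ?_, Idle.w_eq_zero h2', Idle.w_eq_zero h2'⟩
      · rw [hnext.w_zero (d := .c11 i) rfl rfl, h5, he, o11]; rfl
      · rw [hnext.w_self, h6, i12, zero_add]; rfl
    · have hnext : T.Next k (.c21 i) :=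
        ⟨hfree, htm, by omega, forall_s2 fun h => absurd rfl h⟩
      have o22 : T.out k (.c22 i) = 0 :=
        h1.out_eq_zero_of_blocked (d := .c21 i) rfl rfl htm rfl (by simp only [level]; omega) (by omega)
      have i12 : T.inn k (.c12 i) = 0 := by rw [inn_c12, o22]
      have h2' : T.Idle (k + 1) (.s1 i) := Free.idle_succ (Or.inl h2) (forall_s1 ⟨h6, i12⟩)
      simp only [serveNext, if_neg ha]
      refine ⟨hnext.serves, h2', ?_, ?_, Idle.w_eq_zero h2', Idle.w_eq_zero h2'⟩
      · rw [hnext.w_self, h3, i21]; rfl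
      · rw [hnext.w_zero (d := .c22 i) rfl rfl, h4, hvv, o22]; rfl
  · obtain ⟨h1, h2, h3, h4, h5, h6⟩ := hσ
    have hfree : T.Free k (.s1 i) := Or.inr ⟨_, h, rfl, h1, hk⟩
    have hfl11 : T.M.network.flushed T.θ (T.M.network.arrive (time m k) (T.X k)) (.c11 i) = 0 := by
      refine T.M.network.flushed_of_serving T.θ _ ?_
      change (T.X k).serving (.s1 i) ≠ none
      rw [show (T.X k).serving (.s1 i) = _ from h1]
      simp
    have hfl22 : T.M.network.flushed T.θ (T.M.network.arrive (time m k) (T.X k)) (.c22 i) = v := by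
      rw [T.M.network.flushed_arrive_of_free T.M.acyclic T.θ (c := .c22 i) h2]
      · rw [routed_entry _ _ trivial, harr, show (T.X k).waiting (.c22 i) = 0 from h6]
        omega
      · intro d hd ht
        refine forall_s2 (P := fun d => (T.X k).waiting d + T.M.network.arrivals (time m k) d +
          T.M.network.routed (T.M.network.flushed T.θ
            (T.M.network.arrive (time m k) (T.X k))) d = 0) ?_ d hd
          ((T.service_ne_iff d).1 ht)
        rw [routed_c21, hfl11, time, T.M.arrivals_eq T.pos,
          show (T.X k).waiting (.c21 i) = 0 from h5]
        rfl
    by_cases hb : b + v = 0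
    · have o22 : T.out k (.c22 i) = 0 := by
        have := T.out_le k (c := .c22 i) rfl
        omega
      have i12 : T.inn k (.c12 i) = 0 := by rw [inn_c12, o22]
      have o11 : T.out k (.c11 i) = a := by
        rw [hfree.out_eq (forall_s1 ⟨by omega, i12⟩) rfl rfl, h3, he, add_zero]
      have i21 : T.inn k (.c21 i) = a := by rw [inn_c21, o11]
      have hnext : T.Next k (.c21 i) :=
        ⟨Or.inl h2, htm, by omega, forall_s2 fun h => absurd rfl h⟩
      have h2' : T.Idle (k + 1) (.s1 i) := hfree.idle_succ (forall_s1 ⟨by omega, i12⟩)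
      simp only [serveNext, if_pos hb]
      refine ⟨hnext.serves, h2', ?_, ?_, Idle.w_eq_zero h2', Idle.w_eq_zero h2'⟩
      · rw [hnext.w_self, h5, i21, zero_add]; rfl
      · rw [hnext.w_zero (d := .c22 i) rfl rfl, h6, o22]
        simp only [hvv]
        rw [show v = 0 by omega]; rfl
    · have o11 : T.out k (.c11 i) = 0 :=
        h1.out_eq_zero_of_blocked (d := .c12 i) rfl rfl htm rfl (by simp only [level]; omega) (by
          rw [routed_c12, hfl22]; omega)
      have i21 : T.inn k (.c21 i) = 0 := by rw [inn_c21, o11]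
      have h2' : T.Idle (k + 1) (.s2 i) := Free.idle_succ (Or.inl h2) (forall_s2 ⟨h5, i21⟩)
      have o22 : T.out k (.c22 i) = v := by
        rw [Free.out_eq (s := .s2 i) (Or.inl h2) (forall_s2 ⟨h5, i21⟩) rfl rfl, h6, hvv, zero_add]
      have i12 : T.inn k (.c12 i) = v := by rw [inn_c12, o22]
      have hnext : T.Next k (.c12 i) :=
        ⟨hfree, htm, by omega, forall_s1 fun h => absurd rfl h⟩
      simp only [serveNext, if_neg hb]
      refine ⟨hnext.serves, h2', ?_, ?_, Idle.w_eq_zero h2', Idle.w_eq_zero h2'⟩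
      · rw [hnext.w_zero (d := .c11 i) rfl rfl, h3, he, o11]; rfl
      · rw [hnext.w_self, h4, i12]; rfl

/-- One slot of half a time unit. -/
theorem Core.slot {i : Fin 2} {h e o : ℕ} {σ : Bool × ℕ × ℕ} (hσ : T.Core i (h + 1) h σ)
    (hv : ∀ k, h < k → k < h + 200 * m → T.inn k (.c22 i) = 0)
    (ho : 0 < o)
    (he : ∀ k, h < k → k < h + 200 * m → T.inn k (.c11 i) = if k = h + o then e else 0)
    {k : ℕ} (hk : h < k) (hk' : k ≤ h + 200 * m) :
    T.Core i k h (if k ≤ h + o then σ else addJobs e σ) := by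
  induction k, hk using Nat.le_induction with
  | base => rw [if_pos (by omega)]; exact hσ
  | succ k hk ih =>
    have h1 := (ih (by omega)).step (by omega) (hv k hk (by omega))
    rw [he k hk (by omega)] at h1
    convert h1 using 1
    rcases lt_trichotomy k (h + o) with hlt | rfl | hgt
    · simp only [show k + 1 ≤ h + o by omega, hlt.le, hlt.ne, if_true, if_false]; rfl
    · simp only [show ¬ h + o + 1 ≤ h + o by omega, le_refl, if_true, if_false]
    · simp only [show ¬ k + 1 ≤ h + o by omega, not_le.2 hgt, hgt.ne', if_false]; rfl

/-- In every slot exactly one of the two servers works. -/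
theorem Core.serves_or {i : Fin 2} {k h : ℕ} {σ : Bool × ℕ × ℕ} (hσ : T.Core i k h σ) :
    (σ.1 = true ∧ T.Serves k (.c12 i) h ∧ T.Idle k (.s2 i) ∧ T.w k (.c21 i) = 0) ∨
      (σ.1 = false ∧ T.Serves k (.c21 i) h ∧ T.Idle k (.s1 i) ∧ T.w k (.c12 i) = 0) := by
  obtain ⟨μ, a, b⟩ := σ
  cases μ
  · exact Or.inr ⟨rfl, hσ.1, hσ.2.1, hσ.2.2.2.2.2⟩
  · exact Or.inl ⟨rfl, hσ.1, hσ.2.1, hσ.2.2.2.2.1⟩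

/-- A job that probes the server `i1` passes if and only if the server `i2` works. -/
theorem Core.out_probe1 {i : Fin 2} {k h : ℕ} {σ : Bool × ℕ × ℕ} (hσ : T.Core i k h σ)
    (hk : h + 200 * m ≠ k) {c : Cls m} (hc : c = .c13 i ∨ c = .c14 i)
    (harr : T.inn k c = 1) : T.out k c = if σ.1 then 0 else 1 := by
  have hs : T.M.serverOf c = .s1 i := by rcases hc with rfl | rfl <;> rfl
  have ht : ticks c = 0 := by rcases hc with rfl | rfl <;> rfl
  have hcap : bufferSize c = some 0 := by rcases hc with rfl | rfl <;> rfl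
  rcases hσ.serves_or with ⟨h0, h1, h2, h3⟩ | ⟨h0, h1, h2, h3⟩
  · rw [h0, h1.out_eq_zero hk hs]; rfl
  · have o22 : T.out k (.c22 i) = 0 := h1.out_eq_zero hk rfl
    rw [Free.out_eq (s := .s1 i) (Or.inl h2) (forall_s1 ⟨h3, by rw [inn_c12, o22]⟩) hs ht,
      T.w_of_capacity_zero k hcap, harr, h0]
    rfl

/-- A job that probes the server `i2` passes if and only if the server `i1` works. -/
theorem Core.out_probe2 {i : Fin 2} {k h : ℕ} {σ : Bool × ℕ × ℕ} (hσ : T.Core i k h σ)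
    (hk : h + 200 * m ≠ k) (harr : T.inn k (.c23 i) = 1) :
    T.out k (.c23 i) = if σ.1 then 1 else 0 := by
  rcases hσ.serves_or with ⟨h0, h1, h2, h3⟩ | ⟨h0, h1, h2, h3⟩
  · have o11 : T.out k (.c11 i) = 0 := h1.out_eq_zero hk rfl
    rw [Free.out_eq (s := .s2 i) (Or.inl h2) (forall_s2 ⟨h3, by rw [inn_c21, o11]⟩) rfl rfl,
      T.w_of_capacity_zero k rfl, harr, h0]
    rfl
  · rw [h0, h1.out_eq_zero hk (d := .c23 i) rfl]; rfl

theorem load_addJobs (e : ℕ) (σ : Bool × ℕ × ℕ) : load (addJobs e σ) = load σ + e := by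
  simp only [load, addJobs]; omega

theorem load_serveNext (v : ℕ) (σ : Bool × ℕ × ℕ) (h : 0 < load σ + v) :
    load (serveNext v σ) + 1 = load σ + v := by
  obtain ⟨μ, a, b⟩ := σ
  cases μ <;> simp only [load, serveNext] at h ⊢ <;> split_ifs <;> simp only <;> omega

/-- One time unit, which begins at the tick `U` and in which `e` jobs come to the class `i11`. -/
theorem Core.unit {i : Fin 2} {U u e : ℕ} {σ : Bool × ℕ × ℕ} (hU : U = 400 * m * u)
    (hσ : T.Core i (U + 1) U σ) (hpos : 0 < load σ + e)
    (he : ∀ o, 0 < o → o ≤ 400 * m → T.inn (U + o) (.c11 i) = if o = 8 * m then e else 0) :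
    (∀ o, 0 < o → o ≤ 8 * m → T.Core i (U + o) U σ) ∧
    (∀ o, 8 * m < o → o ≤ 200 * m → T.Core i (U + o) U (addJobs e σ)) ∧
    (∀ o, 200 * m < o → o ≤ 400 * m →
      T.Core i (U + o) (U + 200 * m) (serveNext 0 (addJobs e σ))) ∧
    T.Core i (U + 400 * m + 1) (U + 400 * m) (serveNext 1 (serveNext 0 (addJobs e σ))) := by
  have hm := T.pos
  have hv : ∀ o, 0 < o → o < 400 * m → T.inn (U + o) (.c22 i) = 0 := fun o h1 h2 => by
    rw [T.inn_c22 hU h2, if_neg (by omega)]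
  have h1 : ∀ o, 0 < o → o ≤ 200 * m →
      T.Core i (U + o) U (if U + o ≤ U + 8 * m then σ else addJobs e σ) := by
    intro o ho ho'
    refine hσ.slot (fun k hk hk' => ?_) (by omega) (fun k hk hk' => ?_) (by omega) (by omega)
    · have := hv (k - U) (by omega) (by omega)
      rwa [Nat.add_sub_cancel' hk.le] at this
    · have := he (k - U) (by omega) (by omega)
      rw [Nat.add_sub_cancel' hk.le] at this
      rw [this]
      exact if_congr (by omega) rfl rfl
  have h2 : T.Core i (U + 200 * m) U (addJobs e σ) := by
    have := h1 (200 * m) (by omega) le_rfl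
    rwa [if_neg (by omega)] at this
  have h3 := h2.next rfl (by rw [he _ (by omega) (by omega), if_neg (by omega)])
    (by rw [load_addJobs]; omega)
  rw [hv _ (by omega) (by omega)] at h3
  have h4 : ∀ o, 200 * m < o → o ≤ 400 * m →
      T.Core i (U + o) (U + 200 * m) (serveNext 0 (addJobs e σ)) := by
    intro o ho ho'
    have := h3.slot (e := 0) (o := 1) (fun k hk hk' => ?_) (by omega) (fun k hk hk' => ?_)
      (k := U + o) (by omega) (by omega)
    · have h5 : addJobs 0 (serveNext 0 (addJobs e σ)) = serveNext 0 (addJobs e σ) := rfl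
      rw [h5, ite_self] at this
      exact this
    · have := hv (k - U) (by omega) (by omega)
      rwa [Nat.add_sub_cancel' (by omega)] at this
    · have := he (k - U) (by omega) (by omega)
      rw [Nat.add_sub_cancel' (by omega)] at this
      rw [this, if_neg (by omega), ite_self]
  have h5 : T.inn (U + 400 * m) (.c22 i) = 1 := by
    have : U + 400 * m = 400 * m * (u + 1) + 0 := by rw [hU]; ring
    rw [this, T.inn_c22 rfl (by omega), if_pos rfl]
  have h6 := (h4 (400 * m) (by omega) le_rfl).next (by omega)
    (by rw [he _ (by omega) le_rfl, if_neg (by omega)]) (by omega)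
  rw [h5] at h6
  refine ⟨fun o ho ho' => ?_, fun o ho ho' => ?_, h4, h6⟩
  · have := h1 o ho (by omega)
    rwa [if_pos (by omega)] at this
  · have := h1 o (by omega) ho'
    rwa [if_neg (by omega)] at this

end Setting

namespace Setting

open SCM

variable {m : ℕ} {T : Setting m}

/-! ### The servers which feed the counters -/

section Feed

variable {B n : ℕ} (hB : B = 1200 * m * n)

include hB

theorem out_m43_eq_zero {o : ℕ} (ho : 0 < o) (ho' : o < 1200 * m) (j : Fin m) :
    T.out (B + o) (.m43 j) = 0 := by
  have h1 := T.out_le (B + o) (c := .m43 j) rfl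
  rw [T.w_of_capacity_zero _ rfl, T.inn_m43 hB ho' j, if_neg (by omega)] at h1
  omega

theorem inn_c41_eq_zero {o : ℕ} (ho : 0 < o) (ho' : o < 1200 * m) (i : Fin 2) :
    T.inn (B + o) (.c41 i) = 0 := by
  rw [inn_c41]
  exact Finset.sum_eq_zero fun j _ => by rw [out_m43_eq_zero hB ho ho', ite_self]

theorem inn_b1_eq_zero {o : ℕ} (ho : 0 < o) (ho' : o < 1200 * m) (i : Fin 2) (j : Fin m) :
    T.inn (B + o) (.b1 i j) = 0 := by
  rw [inn_b1, out_m43_eq_zero hB ho ho', ite_self]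

end Feed

variable (T) in
/-- The server `i4` has just started a service, at the tick `U`: of a job of class `i42`, which is
going to increase the workload (`e = 1`), or of a job of class `i41`, which blocks it (`e = 0`). -/
def Feeds4 (i : Fin 2) (U e : ℕ) : Prop :=
  (e = 1 ∧ T.Serves (U + 1) (.c42 i) U ∨ e = 0 ∧ T.Serves (U + 1) (.c41 i) U) ∧
    T.w (U + 1) (.c41 i) = 0

theorem feeds4_one {i : Fin 2} {U u : ℕ} (hU : U = 400 * m * u) (h : T.Idle U (.s4 i))
    (hw : T.w U (.c41 i) = 0) (hin : T.inn U (.c41 i) = 0) : T.Feeds4 i U 1 := by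
  have hm := T.pos
  have h42 : T.inn U (.c42 i) = 1 := T.inn_c42 (o := 0) hU (by omega) i
  have hn : T.Next U (.c42 i) := by
    refine ⟨Or.inl h, ?_, by omega, forall_s4 (fun _ => Or.inr ⟨hw, hin⟩) fun h => absurd rfl h⟩
    simp only [ticks]; omega
  refine ⟨Or.inl ⟨rfl, hn.serves⟩, ?_⟩
  rw [hn.w_other (d := .c41 i) rfl (by simp) (by simp [ticks]), hw, hin]
  rfl

theorem feeds4_zero {i : Fin 2} {U : ℕ} (h : T.Idle U (.s4 i))
    (hw : T.w U (.c41 i) = 0) (hin : T.inn U (.c41 i) = 1) : T.Feeds4 i U 0 := by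
  have hn : T.Next U (.c41 i) := by
    refine ⟨Or.inl h, by simp [ticks], by omega, forall_s4 (fun h => absurd rfl h)
      fun _ => Or.inl ?_⟩
    simp [level]
  refine ⟨Or.inr ⟨rfl, hn.serves⟩, ?_⟩
  rw [hn.w_self, hw, hin]
  rfl

theorem Feeds4.unit {i : Fin 2} {U u e : ℕ} (hU : U = 400 * m * u) (h : T.Feeds4 i U e)
    (hin : ∀ o, 0 < o → o < 400 * m → T.inn (U + o) (.c41 i) = 0) :
    (∀ o, 0 < o → o < 400 * m → T.out (U + o) (.c42 i) = if o = 8 * m then e else 0) ∧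
      T.Idle (U + 400 * m) (.s4 i) := by
  have hm := T.pos
  have hw42 := T.w_of_capacity_zero (U + 1) (c := .c42 i) rfl
  have hin' : ∀ k, U < k → k < U + 400 * m → T.inn k (.c41 i) = 0 ∧ T.inn k (.c42 i) = 0 := by
    intro k hk hk'
    obtain ⟨o, rfl⟩ := Nat.exists_eq_add_of_lt hk
    rw [add_assoc]
    refine ⟨hin _ (by omega) (by omega), ?_⟩
    rw [T.inn_c42 hU (by omega), if_neg (by omega)]
  rcases h with ⟨⟨rfl, h⟩ | ⟨rfl, h⟩, hw⟩
  · obtain ⟨-, h2, h3⟩ := h.then_idle (E := U + 400 * m) (by simp only [ticks]; omega)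
      (forall_s4 hw hw42)
      (fun k hk hk' => forall_s4 (Or.inl (hin' k hk hk').1) (Or.inl (hin' k hk hk').2))
    refine ⟨fun o ho ho' => ?_, h2 _ (by simp only [ticks]; omega) le_rfl⟩
    rw [h3 _ (by omega) (by omega) _ rfl (by simp only [ticks]; omega)]
    simp [ticks]
  · obtain ⟨-, h2, h3⟩ := h.then_idle (E := U + 400 * m) (by simp [ticks])
      (forall_s4 hw hw42)
      (fun k hk hk' => forall_s4 (Or.inl (hin' k hk hk').1) (Or.inl (hin' k hk hk').2))
    refine ⟨fun o ho ho' => ?_, h2 _ (by simp only [ticks]; omega) le_rfl⟩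
    rw [h3 _ (by omega) (by omega) (.c42 i) rfl (by simp only [ticks]; omega)]
    simp

/-- The server `i4` during a cycle. -/
theorem Feeds4.cycle {i : Fin 2} {B n e : ℕ} (hB : B = 1200 * m * n) (h : T.Feeds4 i B e) :
    (∀ o, 0 < o → o ≤ 1200 * m → T.out (B + o) (.c42 i) =
      if o = 8 * m then e else if o = 408 * m ∨ o = 808 * m then 1 else 0) ∧
      T.Idle (B + 400 * m) (.s4 i) ∧ T.Idle (B + 1200 * m) (.s4 i) := by
  have hm := T.pos
  have hw : ∀ k, 0 < k → T.Idle k (.s4 i) → T.w k (.c41 i) = 0 := by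
    intro k hk h
    obtain ⟨k, rfl⟩ : ∃ k', k = k' + 1 := ⟨k - 1, by omega⟩
    exact Idle.w_eq_zero h
  have t42 : ticks (.c42 i : Cls m) ≠ 0 := by simp only [ticks]; omega
  have h41 : ∀ o, 0 < o → o < 1200 * m → T.inn (B + o) (.c41 i) = 0 :=
    fun o ho ho' => inn_c41_eq_zero hB ho ho' i
  have hB0 : B = 400 * m * (3 * n) := by rw [hB]; ring
  have hB1 : B + 400 * m = 400 * m * (3 * n + 1) := by rw [hB]; ring
  have hB2 : B + 400 * m + 400 * m = 400 * m * (3 * n + 2) := by rw [hB]; ring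
  obtain ⟨u1, i1⟩ := h.unit hB0 fun o ho ho' => h41 o ho (by omega)
  obtain ⟨u2, i2⟩ := (feeds4_one hB1 i1 (hw _ (by omega) i1)
    (h41 _ (by omega) (by omega))).unit hB1 fun o ho ho' => by
      rw [add_assoc]; exact h41 _ (by omega) (by omega)
  obtain ⟨u3, i3⟩ := (feeds4_one hB2 i2 (hw _ (by omega) i2)
    (by rw [add_assoc]; exact h41 _ (by omega) (by omega))).unit hB2 fun o ho ho' => by
      rw [add_assoc, add_assoc]; exact h41 _ (by omega) (by omega)
  have e2 : B + 400 * m + 400 * m = B + 800 * m := by omega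
  have e3 : B + 800 * m + 400 * m = B + 1200 * m := by omega
  rw [e2] at u3 i2 i3
  rw [e3] at i3
  refine ⟨fun o ho ho' => ?_, i1, i3⟩
  have c : o < 400 * m ∨ o = 400 * m ∨ (400 * m < o ∧ o < 800 * m) ∨ o = 800 * m ∨
    (800 * m < o ∧ o < 1200 * m) ∨ o = 1200 * m := by omega
  rcases c with c | rfl | c | rfl | c | rfl
  · rw [u1 o ho c, if_neg (show ¬ (o = 408 * m ∨ o = 808 * m) by omega)]
  · rw [i1.out_eq_zero (d := .c42 i) t42, if_neg (by omega), if_neg (by omega)]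
  · obtain ⟨p, rfl⟩ : ∃ p, o = 400 * m + p := ⟨o - 400 * m, by omega⟩
    rw [← add_assoc, u2 p (by omega) (by omega), if_neg (show ¬ 400 * m + p = 8 * m by omega)]
    exact if_congr (by omega) rfl rfl
  · rw [i2.out_eq_zero (d := .c42 i) t42, if_neg (by omega), if_neg (by omega)]
  · obtain ⟨p, rfl⟩ : ∃ p, o = 800 * m + p := ⟨o - 800 * m, by omega⟩
    rw [← add_assoc, u3 p (by omega) (by omega), if_neg (show ¬ 800 * m + p = 8 * m by omega)]
    exact if_congr (by omega) rfl rfl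
  · rw [i3.out_eq_zero (d := .c42 i) t42, if_neg (by omega), if_neg (by omega)]

variable (T) in
/-- The blocking server has just started a service at the tick `B`: of a job of class `b2`, which
prevents the service of the next job of class `b3` (`e = 0`), or of a job of a class `b1`, which
ends in time to let this job pass (`e = 1`). -/
def Feeds5 (i : Fin 2) (B e : ℕ) : Prop :=
  e = 0 ∧ T.Serves (B + 1) (.b2 i) B ∨ e = 1 ∧ ∃ j, T.Serves (B + 1) (.b1 i j) B

theorem feeds5_zero {i : Fin 2} {B n : ℕ} (hB : B = 1200 * m * n) (h : T.Idle B (.blk i))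
    (hin : ∀ j, T.inn B (.b1 i j) = 0) : T.Feeds5 i B 0 := by
  have hm := T.pos
  have h2 : T.inn B (.b2 i) = 1 := T.inn_b2 (o := 0) hB (by omega) i
  have h3 : T.inn B (.b3 i) = 0 := by
    rw [← Nat.add_zero B, T.inn_b3 (o := 0) hB (by omega) i, if_neg (by omega)]
  have hn : T.Next B (.b2 i) := by
    refine ⟨Or.inl h, ?_, by omega, forall_blk (fun j _ => Or.inr
      ⟨T.w_of_capacity_zero _ rfl, hin j⟩) (fun h => absurd rfl h)
      fun _ => Or.inr ⟨T.w_of_capacity_zero _ rfl, h3⟩⟩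
    simp only [ticks]; omega
  exact Or.inl ⟨rfl, hn.serves⟩

theorem feeds5_one {i : Fin 2} {B : ℕ} (h : T.Idle B (.blk i)) {j : Fin m}
    (hj : T.inn B (.b1 i j) = 1)
    (hin : ∀ j', j' ≠ j → T.inn B (.b1 i j') = 0) : T.Feeds5 i B 1 := by
  have hn : T.Next B (.b1 i j) := by
    refine ⟨Or.inl h, by simp [ticks], by omega, forall_blk (fun j' hj' => Or.inr
      ⟨T.w_of_capacity_zero _ rfl, hin j' fun h => hj' (by rw [h])⟩) (fun _ => Or.inl ?_)
      fun _ => Or.inl ?_⟩ <;> simp [level]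
  exact Or.inr ⟨rfl, j, hn.serves⟩

/-- The blocking server during a cycle. -/
theorem Feeds5.cycle {i : Fin 2} {B n e : ℕ} (hB : B = 1200 * m * n) (h : T.Feeds5 i B e) :
    (∀ o, 0 < o → o ≤ 1200 * m → T.out (B + o) (.b3 i) = if o = 8 * m then e else 0) ∧
      ∀ o, 400 * m ≤ o → o ≤ 1200 * m → T.Idle (B + o) (.blk i) := by
  have hm := T.pos
  have t3 : ticks (.b3 i : Cls m) ≠ 0 := by simp only [ticks]; omega
  have hw : ∀ k, ∀ d, T.M.serverOf d = .blk i → ticks d ≠ 0 → T.w k d = 0 := fun k =>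
    forall_blk (fun _ => T.w_of_capacity_zero _ rfl) (T.w_of_capacity_zero _ rfl)
      (T.w_of_capacity_zero _ rfl)
  have h1 : ∀ k, B < k → k < B + 1200 * m → ∀ j, T.inn k (.b1 i j) = 0 := by
    intro k hk hk' j
    obtain ⟨o, rfl⟩ := Nat.exists_eq_add_of_lt hk
    rw [add_assoc]
    exact inn_b1_eq_zero hB (by omega) (by omega) i j
  have h2 : ∀ k, B < k → k < B + 1200 * m → T.inn k (.b2 i) = 0 := by
    intro k hk hk'
    obtain ⟨o, rfl⟩ := Nat.exists_eq_add_of_lt hk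
    rw [add_assoc, T.inn_b2 hB (by omega), if_neg (by omega)]
  have h3 : ∀ k, B < k → k < B + 1200 * m →
      T.inn k (.b3 i) = if k = B + 4 * m then 1 else 0 := by
    intro k hk hk'
    obtain ⟨o, rfl⟩ := Nat.exists_eq_add_of_lt hk
    rw [add_assoc, T.inn_b3 hB (by omega)]
    exact if_congr (by omega) rfl rfl
  rcases h with ⟨rfl, h⟩ | ⟨rfl, j, h⟩
  · obtain ⟨-, i1, o1⟩ := h.then_idle (E := B + 1200 * m) (by simp only [ticks]; omega)
      (hw _) fun k hk hk' => forall_blk (fun j => Or.inl (h1 k hk hk' j)) (Or.inl (h2 k hk hk'))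
        (by
          by_cases hk4 : k = B + 4 * m
          · exact Or.inr ⟨by simp only [ticks]; omega, rfl⟩
          · exact Or.inl (by rw [h3 k hk hk', if_neg hk4]))
    simp only [ticks] at i1
    refine ⟨fun o ho ho' => ?_, fun o ho ho' => i1 _ (by omega) (by omega)⟩
    rw [ite_self]
    rcases Nat.lt_or_ge o (1200 * m) with hlt | hge
    · rw [o1 _ (by omega) (by omega) (.b3 i) rfl t3]
      simp
    · exact (i1 (B + o) (by omega) (by omega)).out_eq_zero (d := .b3 i) t3
  · obtain ⟨-, i1, o1⟩ := h.then_idle (E := B + 4 * m) (by simp [ticks])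
      (hw _) fun k hk hk' => forall_blk (fun j => Or.inl (h1 k hk (by omega) j))
        (Or.inl (h2 k hk (by omega))) (Or.inl (by rw [h3 k hk (by omega), if_neg (by omega)]))
    have hn : T.Next (B + 4 * m) (.b3 i) := by
      refine ⟨Or.inl (i1 _ (by simp only [ticks]; omega) le_rfl), t3, ?_, forall_blk
        (fun j _ => Or.inr ⟨hw _ (.b1 i j) rfl (by simp [ticks]), h1 _ (by omega) (by omega) j⟩)
        (fun _ => Or.inr ⟨T.w_of_capacity_zero _ rfl, h2 _ (by omega) (by omega)⟩)
        fun h => absurd rfl h⟩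
      rw [h3 _ (by omega) (by omega), if_pos rfl]; omega
    obtain ⟨-, i2, o2⟩ := hn.serves.then_idle (E := B + 1200 * m) (by simp only [ticks]; omega)
      (hw _) fun k hk hk' => forall_blk (fun j => Or.inl (h1 k (by omega) (by omega) j))
        (Or.inl (h2 k (by omega) (by omega)))
        (Or.inl (by rw [h3 k (by omega) (by omega), if_neg (by omega)]))
    simp only [ticks] at i1 i2 o2
    refine ⟨fun o ho ho' => ?_, fun o ho ho' => i2 _ (by omega) (by omega)⟩
    have c : o < 4 * m ∨ o = 4 * m ∨ (4 * m < o ∧ o < 1200 * m) ∨ o = 1200 * m := by omega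
    rcases c with c | rfl | c | rfl
    · rw [o1 _ (by omega) (by omega) (.b3 i) rfl t3, if_neg (by simp), if_neg (by omega)]
    · rw [(i1 (B + 4 * m) (by omega) le_rfl).out_eq_zero (d := .b3 i) t3, if_neg (by omega)]
    · rw [o2 _ (by omega) (by omega) (.b3 i) rfl t3]
      exact if_congr (by simp; omega) rfl rfl
    · rw [(i2 (B + 1200 * m) (by omega) le_rfl).out_eq_zero (d := .b3 i) t3, if_neg (by omega)]

theorem idle_s5 {i : Fin 2} {k k' : ℕ} (h : T.Idle k (.s5 i)) (h0 : 0 < k) (hk : k ≤ k') :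
    T.Idle k' (.s5 i) :=
  h.trans h0 hk fun k _ _ => forall_s5 (T.inn_c51 k i)

/-- The jobs that come to class `i11` during a cycle. -/
theorem inn_c11_cycle {i : Fin 2} {B n e₄ e₅ : ℕ} (hB : B = 1200 * m * n) (h4 : T.Feeds4 i B e₄)
    (h5 : T.Feeds5 i B e₅) (hs : T.Idle (B + 1) (.s5 i)) {o : ℕ} (ho : 0 < o)
    (ho' : o ≤ 1200 * m) : T.inn (B + o) (.c11 i) =
      if o = 8 * m then e₄ + e₅ else if o = 408 * m ∨ o = 808 * m then 1 else 0 := by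
  have hm := T.pos
  have h51 : T.out (B + o) (.c51 i) = 0 :=
    (idle_s5 hs (Nat.succ_pos _) (by omega)).out_eq_zero (d := .c51 i) (by
      simp only [ticks]; omega)
  rw [inn_c11, (h4.cycle hB).1 o ho ho', (h5.cycle hB).1 o ho ho', h51]
  split_ifs <;> omega

/-! ### The server which tests the counter -/

/-- A job of class `i31` is followed by the next one. -/
theorem serves_c31_next {i : Fin 2} {h r : ℕ} (hs : T.Serves (h + 1) (.c31 i) h)
    (hw : T.w (h + 1) (.c31 i) = r + 1) (hw' : T.w (h + 1) (.c32 i) = 0)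
    (hin : ∀ k, h < k → k ≤ h + 16 * m → T.inn k (.c31 i) = 0 ∧ T.inn k (.c32 i) = 0) :
    T.Serves (h + 16 * m + 1) (.c31 i) (h + 16 * m) ∧ T.w (h + 16 * m + 1) (.c31 i) = r ∧
      T.w (h + 16 * m + 1) (.c32 i) = 0 := by
  have hm := T.pos
  have h1 : ∀ k, h < k → k ≤ h + 16 * m → T.w k (.c31 i) = r + 1 ∧ T.w k (.c32 i) = 0 := by
    intro k hk
    induction k, hk using Nat.le_induction with
    | base => exact fun _ => ⟨hw, hw'⟩
    | succ k hk ih =>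
      intro hk'
      have hs' := hs.trans hk (show k ≤ h + 16 * m by omega)
      have hne : h + ticks (.c31 i : Cls m) ≠ k := by simp only [ticks]; omega
      obtain ⟨h2, h3⟩ := ih (by omega)
      obtain ⟨h4, h5⟩ := hin k hk (by omega)
      rw [hs'.w_succ hne (d := .c31 i) rfl, hs'.w_succ hne (d := .c32 i) rfl, h2, h3, h4, h5]
      exact ⟨rfl, rfl⟩
  obtain ⟨h2, h3⟩ := h1 (h + 16 * m) (by omega) le_rfl
  obtain ⟨h4, h5⟩ := hin (h + 16 * m) (by omega) le_rfl
  have hn : T.Next (h + 16 * m) (.c31 i) := by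
    refine ⟨Or.inr ⟨_, h, rfl, hs.trans (by omega) le_rfl, rfl⟩, ?_, by omega,
      forall_s3 (fun h => absurd rfl h) fun _ => Or.inr ⟨h3, h5⟩⟩
    simp only [ticks]; omega
  refine ⟨hn.serves, ?_, ?_⟩
  · rw [hn.w_self, h2, h4]; rfl
  · rw [hn.w_other (d := .c32 i) rfl (by simp) (by simp only [ticks]; omega), h3, h5]; rfl

/-- The server `i3` during a cycle, when `p₁`, `p₂`, `p₃` tell which of the three probes pass. The
job of class `i33` passes unless all of them do. -/
theorem test_cycle {i : Fin 2} {B n p₁ p₂ p₃ : ℕ} (hB : B = 1200 * m * n)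
    (h : T.Idle (B + 1) (.s3 i)) (hp₁ : p₁ ≤ 1) (hp₂ : p₂ ≤ 1) (hp₃ : p₃ ≤ 1)
    (h1 : T.out (B + 640 * m) (.c13 i) = p₁) (h2 : T.out (B + 840 * m) (.c23 i) = p₂)
    (h3 : T.out (B + 1040 * m) (.c14 i) = p₃) :
    (∀ o, 0 < o → o < 1200 * m → T.out (B + o) (.c33 i) =
      if o = 1080 * m ∧ p₁ + p₂ + p₃ ≤ 2 then 1 else 0) ∧
      T.Idle (B + 400 * m) (.s3 i) ∧ T.Idle (B + 1200 * m) (.s3 i) := by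
  have hm := T.pos
  have t31 : ticks (.c31 i : Cls m) ≠ 0 := by simp only [ticks]; omega
  have t32 : ticks (.c32 i : Cls m) ≠ 0 := by simp only [ticks]; omega
  have o0 : ∀ o, o < 1200 * m → ∀ c : Cls m, ticks c = 0 → bufferSize c = some 0 →
      T.inn (B + o) c = 0 → T.out (B + o) c = 0 := by
    intro o _ c hc hc' hi
    have := T.out_le (B + o) hc
    rw [T.w_of_capacity_zero _ hc', hi] at this
    omega
  -- the probes that pass come to class `i31` at the times `1.6`, `2.1`, `2.6` of the cycle
  have i31 : ∀ o, o < 1200 * m → T.inn (B + o) (.c31 i) =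
      (if o = 640 * m then p₁ else 0) + (if o = 840 * m then p₂ else 0) +
        if o = 1040 * m then p₃ else 0 := by
    intro o ho
    have q1 : T.out (B + o) (.c13 i) = if o = 640 * m then p₁ else 0 := by
      split_ifs with hh
      · rw [hh, h1]
      · exact o0 o ho _ rfl rfl (by rw [T.inn_c13 hB ho, if_neg hh])
    have q2 : T.out (B + o) (.c23 i) = if o = 840 * m then p₂ else 0 := by
      split_ifs with hh
      · rw [hh, h2]
      · exact o0 o ho _ rfl rfl (by rw [T.inn_c23 hB ho, if_neg hh])
    have q3 : T.out (B + o) (.c14 i) = if o = 1040 * m then p₃ else 0 := by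
      split_ifs with hh
      · rw [hh, h3]
      · exact o0 o ho _ rfl rfl (by rw [T.inn_c14 hB ho, if_neg hh])
    rw [inn_c31, q1, q2, q3]
    omega
  have i32 : ∀ o, o < 1200 * m → T.inn (B + o) (.c32 i) = if o = 600 * m then 1 else 0 :=
    fun o ho => T.inn_c32 hB ho i
  have idle : ∀ a b, 0 < a → a ≤ b → b ≤ 600 * m ∨ 1040 * m < a ∧ b ≤ 1200 * m →
      T.Idle (B + a) (.s3 i) → T.Idle (B + b) (.s3 i) := by
    intro a b ha hab hb hi
    refine hi.trans (by omega) (by omega) fun k hk hk' => ?_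
    obtain ⟨o, rfl⟩ : ∃ o, k = B + o := ⟨k - B, by omega⟩
    refine forall_s3 ?_ ?_
    · rw [i31 o (by omega), if_neg (by omega), if_neg (by omega), if_neg (by omega)]
    · rw [i32 o (by omega), if_neg (by omega)]
  have idle6 := idle 1 (600 * m) one_pos (by omega) (Or.inl le_rfl) h
  have w0 : ∀ c, T.M.serverOf c = .s3 i → T.w (B + 600 * m) c = 0 := by
    intro c hc
    obtain ⟨k, hk⟩ : ∃ k, B + 600 * m = k + 1 := ⟨B + 600 * m - 1, by omega⟩
    rw [hk] at idle6 ⊢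
    exact Idle.w_eq_zero (by rw [hc]; exact idle6)
  have hn : T.Next (B + 600 * m) (.c32 i) := by
    refine ⟨Or.inl idle6, t32, by rw [i32 _ (by omega), if_pos rfl]; omega,
      forall_s3 (fun _ => Or.inr ⟨w0 _ rfl, ?_⟩) fun h => absurd rfl h⟩
    rw [i31 _ (by omega), if_neg (by omega), if_neg (by omega), if_neg (by omega)]
  have busy : ∀ o, 600 * m < o → o ≤ 1040 * m →
      T.Serves (B + o) (.c32 i) (B + 600 * m) ∧ T.w (B + o) (.c32 i) = 0 ∧
        T.w (B + o) (.c31 i) = (if 640 * m < o then p₁ else 0) + if 840 * m < o then p₂ else 0 := by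
    intro o ho
    induction o, ho using Nat.le_induction with
    | base =>
      intro _
      refine ⟨hn.serves, ?_, ?_⟩
      · refine hn.w_self.trans ?_
        rw [w0 _ rfl, i32 _ (by omega), if_pos rfl]; rfl
      · refine (hn.w_other (d := .c31 i) rfl (by simp) t31).trans ?_
        rw [w0 _ rfl, i31 _ (by omega), if_neg (by omega), if_neg (by omega), if_neg (by omega),
          if_neg (by omega), if_neg (by omega)]
        rfl
    | succ o ho ih =>
      intro ho'
      obtain ⟨q1, q2, q3⟩ := ih (by omega)
      have hne : B + 600 * m + ticks (.c32 i : Cls m) ≠ B + o := by simp only [ticks]; omega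
      refine ⟨q1.succ hne, ?_, ?_⟩
      · refine (q1.w_succ hne (d := .c32 i) rfl).trans ?_
        rw [q2, i32 _ (by omega), if_neg (by omega)]; rfl
      · refine (q1.w_succ hne (d := .c31 i) rfl).trans ?_
        rw [q3, i31 _ (by omega)]
        change _ + _ = _
        split_ifs <;> omega
  obtain ⟨b1, b2, b3⟩ := busy (1040 * m) (by omega) le_rfl
  rw [if_pos (by omega), if_pos (by omega)] at b3
  have hfree : T.Free (B + 1040 * m) (.s3 i) :=
    Or.inr ⟨_, _, rfl, b1, by simp only [ticks]; omega⟩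
  have j31 : T.inn (B + 1040 * m) (.c31 i) = p₃ := by
    rw [i31 _ (by omega), if_neg (by omega), if_neg (by omega), if_pos rfl]; omega
  have j32 : T.inn (B + 1040 * m) (.c32 i) = 0 := by
    rw [i32 _ (by omega), if_neg (by omega)]
  -- the state at the arrival of the job of class `i33`
  have key : ((p₁ + p₂ + p₃ ≤ 2 ∧ T.Idle (B + 1080 * m) (.s3 i)) ∨
      (p₁ + p₂ + p₃ = 3 ∧ T.Serves (B + 1080 * m) (.c31 i) (B + 1072 * m))) ∧
      T.Idle (B + 1200 * m) (.s3 i) := by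
    have inn0 : ∀ k, B + 1040 * m < k → k < B + 1200 * m →
        T.inn k (.c31 i) = 0 ∧ T.inn k (.c32 i) = 0 := by
      intro k hk hk'
      obtain ⟨o, rfl⟩ : ∃ o, k = B + o := ⟨k - B, by omega⟩
      rw [i31 o (by omega), i32 o (by omega)]
      constructor
      · rw [if_neg (by omega), if_neg (by omega), if_neg (by omega)]
      · rw [if_neg (by omega)]
    have last : ∀ h, B + 1040 * m ≤ h → T.Serves (h + 1) (.c31 i) h →
        T.w (h + 1) (.c31 i) = 0 → T.w (h + 1) (.c32 i) = 0 → ∀ k, h + 16 * m < k →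
          k ≤ B + 1200 * m → T.Idle k (.s3 i) := by
      intro h hh s1 s2 s3
      exact (s1.then_idle (E := B + 1200 * m) (Nat.pos_of_ne_zero t31) (forall_s3 s2 s3)
        fun k hk hk' => forall_s3 (Or.inl (inn0 k (by omega) hk').1)
          (Or.inl (inn0 k (by omega) hk').2)).2.1
    -- from `2.6` on the probes are served for `0.04` each; only three of them keep the server busy
    -- beyond `2.7`, the arrival of the job of class `i33`
    by_cases hP : p₁ + p₂ + p₃ = 0
    · have := hfree.idle_succ (forall_s3 ⟨by omega, by omega⟩ ⟨b2, j32⟩)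
      exact ⟨Or.inl ⟨by omega, idle (1040 * m + 1) _ (by omega) (by omega) (by omega) this⟩,
        idle (1040 * m + 1) _ (by omega) (by omega) (by omega) this⟩
    · have hn' : T.Next (B + 1040 * m) (.c31 i) :=
        ⟨hfree, t31, by omega, forall_s3 (fun h => absurd rfl h) fun _ => Or.inr ⟨b2, j32⟩⟩
      have s1 := hn'.serves
      have s2 := hn'.w_self
      rw [b3, j31] at s2
      change _ = p₁ + p₂ + p₃ - 1 at s2
      have s3 := hn'.w_other (d := .c32 i) rfl (by simp) t32
      rw [b2, j32] at s3
      change _ = 0 at s3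
      have c : p₁ + p₂ + p₃ = 1 ∨ p₁ + p₂ + p₃ = 2 ∨ p₁ + p₂ + p₃ = 3 := by omega
      rcases c with c | c | c
      · rw [c] at s2
        have := last _ le_rfl s1 s2 s3
        exact ⟨Or.inl ⟨by omega, this _ (by omega) (by omega)⟩, this _ (by omega) (by omega)⟩
      · rw [c] at s2
        obtain ⟨s1, s2, s3⟩ := serves_c31_next s1 s2 s3 fun k hk hk' => inn0 k hk (by omega)
        have := last _ (by omega) s1 s2 s3
        exact ⟨Or.inl ⟨by omega, this _ (by omega) (by omega)⟩, this _ (by omega) (by omega)⟩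
      · rw [c] at s2
        obtain ⟨s1, s2, s3⟩ := serves_c31_next s1 s2 s3 fun k hk hk' => inn0 k hk (by omega)
        obtain ⟨s1, s2, s3⟩ := serves_c31_next s1 s2 s3
          fun k hk hk' => inn0 k (by omega) (by omega)
        have := last _ (by omega) s1 s2 s3
        refine ⟨Or.inr ⟨c, ?_⟩, this _ (by omega) (by omega)⟩
        have e : B + 1072 * m = B + 1040 * m + 16 * m + 16 * m := by omega
        rw [e]
        exact s1.trans (by omega) (by simp only [ticks]; omega)
  refine ⟨fun o ho ho' => ?_, idle 1 _ one_pos (by omega) (by omega) h, key.2⟩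
  by_cases h8 : o = 1080 * m
  · subst h8
    rcases key.1 with ⟨hP, hi⟩ | ⟨hP, hs⟩
    · rw [if_pos ⟨rfl, hP⟩, Free.out_eq (s := .s3 i) (Or.inl hi) ?_ rfl rfl,
        T.w_of_capacity_zero _ rfl, T.inn_c33 hB (by omega), if_pos rfl]
      refine forall_s3 ⟨?_, ?_⟩ ⟨?_, ?_⟩
      · obtain ⟨k, hk⟩ : ∃ k, B + 1080 * m = k + 1 := ⟨B + 1080 * m - 1, by omega⟩
        rw [hk] at hi ⊢
        exact Idle.w_eq_zero hi
      · rw [i31 _ (by omega), if_neg (by omega), if_neg (by omega), if_neg (by omega)]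
      · obtain ⟨k, hk⟩ : ∃ k, B + 1080 * m = k + 1 := ⟨B + 1080 * m - 1, by omega⟩
        rw [hk] at hi ⊢
        exact Idle.w_eq_zero hi
      · rw [i32 _ (by omega), if_neg (by omega)]
    · rw [if_neg (by omega)]
      exact hs.out_eq_zero (d := .c33 i) (by simp only [ticks]; omega) rfl
  · rw [if_neg fun h => h8 h.1]
    exact o0 o ho' _ rfl rfl (by rw [T.inn_c33 hB ho', if_neg h8])

/-! ### The cycle of a subnetwork -/

theorem load_serveNext_eq {v z : ℕ} {σ : Bool × ℕ × ℕ} (h : load σ + v = z + 1) :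
    load (serveNext v σ) = z := by
  have := load_serveNext v σ (by omega)
  omega

variable (T) in
/-- The state of the subnetwork `i` right after the beginning of a cycle, at the tick `B`. -/
def SubStart (i : Fin 2) (B z e₄ e₅ : ℕ) : Prop :=
  (∃ σ, T.Core i (B + 1) B σ ∧ load σ = z) ∧ T.Feeds4 i B e₄ ∧ T.Feeds5 i B e₅ ∧
    T.Idle (B + 1) (.s3 i) ∧ T.Idle (B + 1) (.s5 i)

/-- During a cycle the load changes according to the jobs which the servers `i4`, `i5` and the
blocking server send, and the job of class `i33` tells whether the new load is positive. -/
theorem SubStart.cycle {i : Fin 2} {B n z z' e₄ e₅ : ℕ} (hB : B = 1200 * m * n)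
    (h : T.SubStart i B z e₄ e₅) (hz : z + e₄ + e₅ = z' + 1) :
    (∃ σ, T.Core i (B + 400 * m) (B + 200 * m) σ ∧ load σ = z') ∧
    (∃ σ, T.Core i (B + 400 * m + 1) (B + 400 * m) σ) ∧
    (T.Idle (B + 400 * m) (.s3 i) ∧ T.Idle (B + 400 * m) (.s4 i) ∧ T.Idle (B + 400 * m) (.s5 i) ∧
      T.Idle (B + 400 * m) (.blk i)) ∧
    (∀ o, 0 < o → o < 1200 * m → T.out (B + o) (.c33 i) =
      if o = 1080 * m ∧ 0 < z' then 1 else 0) ∧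
    (∃ σ, T.Core i (B + 1200 * m + 1) (B + 1200 * m) σ ∧ load σ = z') ∧
    (T.Idle (B + 1200 * m) (.s3 i) ∧ T.Idle (B + 1200 * m) (.s4 i) ∧
      T.Idle (B + 1200 * m) (.s5 i) ∧ T.Idle (B + 1200 * m) (.blk i)) := by
  have hm := T.pos
  obtain ⟨⟨σ, hσ, hσz⟩, h4, h5, hs3, hs5⟩ := h
  have hin := fun o ho ho' => inn_c11_cycle (o := o) hB h4 h5 hs5 ho ho'
  have hB0 : B = 400 * m * (3 * n) := by rw [hB]; ring
  have hB1 : B + 400 * m = 400 * m * (3 * n + 1) := by rw [hB]; ring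
  have hB2 : B + 800 * m = 400 * m * (3 * n + 2) := by rw [hB]; ring
  -- in each of the three units two services end; one job of class `i22` and, apart from the first
  -- unit, one job of class `i42` come in
  obtain ⟨-, -, c1, d1⟩ := hσ.unit hB0 (e := e₄ + e₅) (by omega) fun o ho ho' => by
    rw [hin o ho (by omega)]
    split_ifs <;> omega
  set σ₁ := serveNext 0 (addJobs (e₄ + e₅) σ) with hσ₁
  have l1 : load σ₁ = z' :=
    load_serveNext_eq (by rw [load_addJobs]; omega)
  set σ₂ := serveNext 1 σ₁ with hσ₂
  have l2 : load σ₂ = z' :=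
    load_serveNext_eq (by omega)
  obtain ⟨-, -, c2, d2⟩ := d1.unit hB1 (e := 1) (by omega) fun o ho ho' => by
    rw [add_assoc, hin (400 * m + o) (by omega) (by omega)]
    split_ifs <;> omega
  set σ₃ := serveNext 0 (addJobs 1 σ₂) with hσ₃
  have l3 : load σ₃ = z' :=
    load_serveNext_eq (by rw [load_addJobs]; omega)
  set σ₄ := serveNext 1 σ₃ with hσ₄
  have l4 : load σ₄ = z' :=
    load_serveNext_eq (by omega)
  have e2 : B + 400 * m + 400 * m = B + 800 * m := by omega
  have e3 : B + 800 * m + 400 * m = B + 1200 * m := by omega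
  rw [e2] at d2
  obtain ⟨-, c3, c4, d3⟩ := d2.unit hB2 (e := 1) (by omega) fun o ho ho' => by
    rw [add_assoc, hin (800 * m + o) (by omega) (by omega)]
    split_ifs <;> omega
  rw [e3] at d3
  set σ₅ := serveNext 0 (addJobs 1 σ₄) with hσ₅
  have l5 : load σ₅ = z' :=
    load_serveNext_eq (by rw [load_addJobs]; omega)
  have l6 : load (serveNext 1 σ₅) = z' :=
    load_serveNext_eq (by omega)
  -- the three probes
  have q1 : T.out (B + 640 * m) (.c13 i) = if σ₃.1 then 0 else 1 := by
    have e : B + 640 * m = B + 400 * m + 240 * m := by omega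
    have := c2 (240 * m) (by omega) (by omega)
    rw [← e] at this
    exact this.out_probe1 (by omega) (Or.inl rfl) (by rw [T.inn_c13 hB (by omega), if_pos rfl])
  have q2 : T.out (B + 840 * m) (.c23 i) = if σ₄.1 then 1 else 0 := by
    have e : B + 840 * m = B + 800 * m + 40 * m := by omega
    have := c3 (40 * m) (by omega) (by omega)
    rw [← e] at this
    exact this.out_probe2 (by omega) (by rw [T.inn_c23 hB (by omega), if_pos rfl])
  have q3 : T.out (B + 1040 * m) (.c14 i) = if σ₅.1 then 0 else 1 := by
    have e : B + 1040 * m = B + 800 * m + 240 * m := by omega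
    have := c4 (240 * m) (by omega) (by omega)
    rw [← e] at this
    exact this.out_probe1 (by omega) (Or.inr rfl) (by rw [T.inn_c14 hB (by omega), if_pos rfl])
  have ite_le : ∀ b : Bool, (if b then 0 else 1 : ℕ) ≤ 1 := by decide
  have ite_le' : ∀ b : Bool, (if b then 1 else 0 : ℕ) ≤ 1 := by decide
  obtain ⟨t1, t2, t3⟩ := test_cycle hB hs3 (ite_le _) (ite_le' _) (ite_le _) q1 q2 q3
  -- with load zero the server `i1` is idle at the first and third probes and `i2` at the second one;
  -- with a positive load one of the probes finds its server busy
  have hprobe : (if σ₃.1 then 0 else 1) + (if σ₄.1 then 1 else 0) + (if σ₅.1 then 0 else 1) ≤ 2 ↔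
      0 < z' := by
    rw [hσ₅, hσ₄]
    rw [hσ₃] at l3 ⊢
    rw [hσ₂] at l3 ⊢
    clear_value σ₁
    clear * - l1 l3
    obtain ⟨μ, a, b⟩ := σ₁
    simp only [load] at l1
    subst l1
    rcases Nat.eq_zero_or_pos (a + b) with h0 | h0
    · obtain ⟨rfl, rfl⟩ := Nat.add_eq_zero_iff.1 h0
      cases μ <;> simp [serveNext, addJobs]
    · simp only [h0, iff_true]
      generalize serveNext 0 (addJobs 1 (serveNext 1 (μ, a, b))) = τ at l3 ⊢
      obtain ⟨μ, c, d⟩ := τ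
      simp only [load] at l3
      cases μ
      · by_cases hc : c = 0
        · subst hc
          simp only [serveNext, addJobs]
          simp only [if_true]
          rw [if_neg (show ¬ (d + 1 - 1 + 0 = 0) by omega)]
          simp
        · simp [serveNext, addJobs, hc]
      · simp only [if_true]
        split_ifs <;> omega
  obtain ⟨-, f1, f2⟩ := h4.cycle hB
  obtain ⟨-, g1⟩ := h5.cycle hB
  refine ⟨⟨σ₁, c1 _ (by omega) le_rfl, l1⟩, ⟨σ₂, d1⟩,
    ⟨t2, f1, idle_s5 hs5 (by omega) (by omega), g1 _ le_rfl (by omega)⟩, fun o ho ho' => ?_,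
    ⟨_, d3, l6⟩, ⟨t3, f2, idle_s5 hs5 (by omega) (by omega), g1 _ (by omega) le_rfl⟩⟩
  rw [t1 o ho ho']
  exact if_congr (and_congr Iff.rfl hprobe) rfl rfl

end Setting

namespace Setting

open SCM

variable {m : ℕ} {T : Setting m}

/-! ### The chain of stages -/

variable (T) in
/-- All servers of the classes `3kl` are idle. -/
def Idle3 (k : ℕ) : Prop := ∀ j s, T.Idle k (.m3 j s)

variable (T) in
/-- The only job at the servers of the classes `3kl` is in service in the stage `s` of the class
`3q(l+1)` since the tick `h`. -/
def Only3 (k : ℕ) (q : Fin m) (l : Fin 4) (s : Fin (4 * m)) (h : ℕ) : Prop :=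
  T.Serves k (.m3 q l s) h ∧
    (∀ j s', (Srv.m3 j s' : Srv m) ≠ .m3 (T.M.successor q l) s → T.Idle k (.m3 j s')) ∧
    ∀ k' l' s', T.w k (.m3 k' l' s') = 0

theorem stage_eq {l l' : Fin 4} {s s' : Fin (4 * m)}
    (h : 4 * m * l + (s : ℕ) = 4 * m * l' + s') : l = l' ∧ s = s' := by
  have h4 : (4 * m * (l : ℕ) + s) / (4 * m) = (4 * m * l' + s') / (4 * m) := by rw [h]
  rw [Nat.mul_add_div s.pos, Nat.mul_add_div s.pos, Nat.div_eq_of_lt s.2,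
    Nat.div_eq_of_lt s'.2] at h4
  have h5 : l = l' := Fin.ext (by omega)
  subst h5
  exact ⟨rfl, Fin.ext (by omega)⟩

/-- Every position of the chain is a stage. -/
theorem exists_stage {p : ℕ} (hp : p < 16 * m) :
    ∃ (l : Fin 4) (s : Fin (4 * m)), 4 * m * l + (s : ℕ) = p := by
  have hm : 0 < 4 * m := by omega
  refine ⟨⟨p / (4 * m), ?_⟩, ⟨p % (4 * m), Nat.mod_lt _ hm⟩, Nat.div_add_mod _ _⟩
  rw [Nat.div_lt_iff_lt_mul hm]
  omega

theorem inn_m3_eq_zero {k : ℕ} {q : Fin m} {l : Fin 4} {s : Fin (4 * m)}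
    (h0 : T.out k (.m03 q) = 0)
    (h : ∀ (l' : Fin 4) (s' : Fin (4 * m)), 4 * m * l + (s : ℕ) = 4 * m * l' + s' + 1 →
      T.out k (.m3 q l' s') = 0) :
    T.inn k (.m3 q l s) = 0 := by
  rcases Nat.eq_zero_or_pos (4 * m * l + (s : ℕ)) with hp | hp
  · obtain ⟨h1, h2⟩ := stage_eq (l := l) (s := s) (l' := 0) (s' := ⟨0, s.pos⟩) (by simpa using hp)
    rw [h1, h2, inn_m3_first, h0]
  · have hlt := stage_lt l s
    obtain ⟨l', s', hl⟩ := exists_stage (m := m) (p := 4 * m * l + (s : ℕ) - 1) (by omega)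
    rw [T.inn_m3_next k q (l := l') (s := s') (by omega)]
    exact h l' s' (by omega)

theorem Only3.out_eq {k h : ℕ} {q : Fin m} {l : Fin 4} {s : Fin (4 * m)}
    (hc : T.Only3 k q l s h) (q' : Fin m) (l' : Fin 4) (s' : Fin (4 * m)) :
    T.out k (.m3 q' l' s') = if (q' = q ∧ l' = l ∧ s' = s) ∧ k = h + 9 then 1 else 0 := by
  by_cases he : q' = q ∧ l' = l ∧ s' = s
  · obtain ⟨rfl, rfl, rfl⟩ := he
    rw [hc.1.out_self (by simp [ticks])]
    exact if_congr (by simp [ticks, eq_comm]) rfl rfl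
  · rw [if_neg fun h => he h.1]
    by_cases hs : (Srv.m3 (T.M.successor q' l') s' : Srv m) = .m3 (T.M.successor q l) s
    · refine hc.1.out_other hs ?_ (by simp [ticks])
      intro h'
      injection h' with h1 h2 h3
      exact he ⟨h1.symm, h2.symm, h3.symm⟩
    · exact (hc.2.1 _ _ hs).out_eq_zero (d := .m3 q' l' s') (by simp [ticks])

theorem Only3.stay {k h : ℕ} {q : Fin m} {l : Fin 4} {s : Fin (4 * m)}
    (hc : T.Only3 k q l s h) (hk : k ≠ h + 9) (h0 : ∀ q', T.out k (.m03 q') = 0) :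
    T.Only3 (k + 1) q l s h := by
  have hin : ∀ k' l' s', T.inn k (.m3 k' l' s') = 0 := fun k' l' s' =>
    inn_m3_eq_zero (h0 _) fun _ _ _ => by rw [hc.out_eq, if_neg fun h => hk h.2]
  have hidle : ∀ j s', (Srv.m3 j s' : Srv m) ≠ .m3 (T.M.successor q l) s →
      T.Idle (k + 1) (.m3 j s') := fun j s' hne =>
    Free.idle_succ (Or.inl (hc.2.1 j s' hne)) (forall_m3 fun k' l' _ => ⟨hc.2.2 _ _ _, hin _ _ _⟩)
  have hne : h + ticks (.m3 q l s : Cls m) ≠ k := by simp only [ticks]; omega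
  refine ⟨hc.1.succ hne, hidle, fun k' l' s' => ?_⟩
  by_cases hs : (Srv.m3 (T.M.successor k' l') s' : Srv m) = .m3 (T.M.successor q l) s
  · rw [hc.1.w_succ hne (d := .m3 k' l' s') hs, hc.2.2, hin, Network.stored_zero]
  · exact Idle.w_eq_zero (d := .m3 k' l' s') (hidle _ _ hs)

/-- At the end of its service in one stage, the job starts in the next one at once. -/
theorem Only3.next {k h : ℕ} {q : Fin m} {l l' : Fin 4} {s s' : Fin (4 * m)}
    (hc : T.Only3 k q l s h) (hk : k = h + 9) (h0 : ∀ q', T.out k (.m03 q') = 0)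
    (hl : 4 * m * l' + (s' : ℕ) = 4 * m * l + s + 1) : T.Only3 (k + 1) q l' s' k := by
  have hm := T.pos
  have hss : s' ≠ s := by
    rintro rfl
    have hlt : (l : ℕ) < l' := by
      by_contra hge
      have := Nat.mul_le_mul_left (4 * m) (not_lt.1 hge)
      omega
    have := Nat.mul_le_mul_left (4 * m) (Nat.succ_le_of_lt hlt)
    rw [Nat.succ_eq_add_one, mul_add] at this
    omega
  have hin : ∀ k₁ l₁ s₁, T.inn k (.m3 k₁ l₁ s₁) =
      if k₁ = q ∧ l₁ = l' ∧ s₁ = s' then 1 else 0 := by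
    intro k₁ l₁ s₁
    split_ifs with he
    · obtain ⟨rfl, rfl, rfl⟩ := he
      rw [T.inn_m3_next k k₁ hl, hc.out_eq, if_pos ⟨⟨rfl, rfl, rfl⟩, hk⟩]
    · refine inn_m3_eq_zero (h0 _) fun l₂ s₂ h₂ => ?_
      rw [hc.out_eq, if_neg]
      rintro ⟨⟨rfl, rfl, rfl⟩, -⟩
      exact he ⟨rfl, stage_eq (h₂.trans hl.symm)⟩
  have hfree : ∀ j s₁, T.Free k (.m3 j s₁) := by
    intro j s₁
    by_cases hs : (Srv.m3 j s₁ : Srv m) = .m3 (T.M.successor q l) s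
    · exact Or.inr ⟨.m3 q l s, h, hs.symm, hc.1, by simp [ticks, hk]⟩
    · exact Or.inl (hc.2.1 j s₁ hs)
  have hn : T.Next k (.m3 q l' s') := by
    refine ⟨hfree _ _, by simp [ticks], by rw [hin, if_pos ⟨rfl, rfl, rfl⟩]; omega,
      forall_m3 fun k₁ l₁ _ hne => Or.inr ⟨hc.2.2 _ _ _, ?_⟩⟩
    rw [hin, if_neg]
    rintro ⟨rfl, rfl, -⟩
    exact hne rfl
  have hidle : ∀ j s₁, (Srv.m3 j s₁ : Srv m) ≠ .m3 (T.M.successor q l') s' →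
      T.Idle (k + 1) (.m3 j s₁) := fun j s₁ hne =>
    (hfree j s₁).idle_succ (forall_m3 fun k₁ l₁ hj => ⟨hc.2.2 _ _ _, by
      rw [hin, if_neg]
      rintro ⟨rfl, rfl, rfl⟩
      exact hne (by rw [hj])⟩)
  refine ⟨hn.serves, hidle, fun k₁ l₁ s₁ => ?_⟩
  by_cases hs : (Srv.m3 (T.M.successor k₁ l₁) s₁ : Srv m) = .m3 (T.M.successor q l') s'
  · by_cases he : k₁ = q ∧ l₁ = l' ∧ s₁ = s'
    · obtain ⟨rfl, rfl, rfl⟩ := he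
      rw [hn.w_self, hc.2.2, hin, if_pos ⟨rfl, rfl, rfl⟩, Network.stored_zero]
    · rw [hn.w_other (d := .m3 k₁ l₁ s₁) hs (by
        intro h'
        injection h' with h1 h2 h3
        exact he ⟨h1, h2, h3⟩) (by simp [ticks]), hc.2.2, hin, if_neg he, Network.stored_zero]
  · exact Idle.w_eq_zero (d := .m3 k₁ l₁ s₁) (hidle _ _ hs)

theorem Only3.last {k h : ℕ} {q : Fin m} {l : Fin 4} {s : Fin (4 * m)}
    (hc : T.Only3 k q l s h) (hk : k = h + 9) (h0 : ∀ q', T.out k (.m03 q') = 0)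
    (hl : 4 * m * l + (s : ℕ) + 1 = 16 * m) : T.Idle3 (k + 1) := by
  have hin : ∀ k₁ l₁ s₁, T.inn k (.m3 k₁ l₁ s₁) = 0 := by
    intro k₁ l₁ s₁
    refine inn_m3_eq_zero (h0 _) fun l₂ s₂ h₂ => ?_
    rw [hc.out_eq, if_neg]
    rintro ⟨⟨rfl, rfl, rfl⟩, -⟩
    have := stage_lt l₁ s₁
    omega
  intro j s₁
  refine Free.idle_succ ?_ (forall_m3 fun k₁ l₁ _ => ⟨hc.2.2 _ _ _, hin _ _ _⟩)
  by_cases hs : (Srv.m3 j s₁ : Srv m) = .m3 (T.M.successor q l) s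
  · exact Or.inr ⟨.m3 q l s, h, hs.symm, hc.1, by simp [ticks, hk]⟩
  · exact Or.inl (hc.2.1 j s₁ hs)

theorem w_m3_of_idle3 {k : ℕ} (hk : 0 < k) (h : T.Idle3 k) (q : Fin m) (l : Fin 4)
    (s : Fin (4 * m)) : T.w k (.m3 q l s) = 0 := by
  obtain ⟨k, rfl⟩ : ∃ k', k = k' + 1 := ⟨k - 1, by omega⟩
  exact Idle.w_eq_zero (h _ _)

theorem Idle3.stay {k : ℕ} (hk : 0 < k) (h : T.Idle3 k) (h0 : ∀ q', T.out k (.m03 q') = 0) :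
    T.Idle3 (k + 1) := fun j s =>
  Free.idle_succ (Or.inl (h j s)) (forall_m3 fun _ _ _ => ⟨w_m3_of_idle3 hk h _ _ _,
    inn_m3_eq_zero (h0 _) fun _ _ _ => (h _ _).out_eq_zero (d := .m3 _ _ _) (by simp [ticks])⟩)

/-- A job of class `03q` which finds the chain empty starts in the first stage of class `3q1`. -/
theorem Idle3.enter {k : ℕ} {q : Fin m} (hk : 0 < k) (h : T.Idle3 k)
    (h0 : ∀ q', T.out k (.m03 q') = if q' = q then 1 else 0) (hm : 0 < 4 * m) :
    T.Only3 (k + 1) q 0 ⟨0, hm⟩ k := by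
  have hin : ∀ k₁ l₁ s₁, T.inn k (.m3 k₁ l₁ s₁) =
      if k₁ = q ∧ l₁ = 0 ∧ s₁ = ⟨0, hm⟩ then 1 else 0 := by
    intro k₁ l₁ s₁
    by_cases hz : l₁ = 0 ∧ s₁ = ⟨0, hm⟩
    · obtain ⟨rfl, rfl⟩ := hz
      rw [inn_m3_first, h0]
      exact if_congr (by simp) rfl rfl
    · rw [if_neg fun h => hz h.2]
      have hlt := stage_lt l₁ s₁
      have hp : 4 * m * l₁ + (s₁ : ℕ) ≠ 0 := fun hp =>
        hz (stage_eq (l' := 0) (s' := ⟨0, hm⟩) (by simpa using hp))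
      obtain ⟨l', s', hl⟩ := exists_stage (m := m) (p := 4 * m * l₁ + (s₁ : ℕ) - 1) (by omega)
      rw [T.inn_m3_next k k₁ (l := l') (s := s') (by omega)]
      exact (h _ _).out_eq_zero (d := .m3 _ _ _) (by simp [ticks])
  have hw := w_m3_of_idle3 hk h
  have hn : T.Next k (.m3 q 0 ⟨0, hm⟩) := by
    refine ⟨Or.inl (h _ _), by simp [ticks], by rw [hin, if_pos ⟨rfl, rfl, rfl⟩]; omega,
      forall_m3 fun k₁ l₁ _ hne => Or.inr ⟨hw _ _ _, ?_⟩⟩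
    rw [hin, if_neg]
    rintro ⟨rfl, rfl, -⟩
    exact hne rfl
  have hidle : ∀ j s₁, (Srv.m3 j s₁ : Srv m) ≠ .m3 (T.M.successor q 0) ⟨0, hm⟩ →
      T.Idle (k + 1) (.m3 j s₁) := fun j s₁ hne =>
    Free.idle_succ (Or.inl (h j s₁)) (forall_m3 fun k₁ l₁ hj => ⟨hw _ _ _, by
      rw [hin, if_neg]
      rintro ⟨rfl, rfl, rfl⟩
      exact hne (by rw [hj])⟩)
  refine ⟨hn.serves, hidle, fun k₁ l₁ s₁ => ?_⟩
  by_cases hs : (Srv.m3 (T.M.successor k₁ l₁) s₁ : Srv m) = .m3 (T.M.successor q 0) ⟨0, hm⟩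
  · by_cases he : k₁ = q ∧ l₁ = 0 ∧ s₁ = ⟨0, hm⟩
    · obtain ⟨rfl, rfl, rfl⟩ := he
      rw [hn.w_self, hw, hin, if_pos ⟨rfl, rfl, rfl⟩, Network.stored_zero]
    · rw [hn.w_other (d := .m3 k₁ l₁ s₁) hs (by
        intro h'
        injection h' with h1 h2 h3
        exact he ⟨h1, h2, h3⟩) (by simp [ticks]), hw, hin, if_neg he, Network.stored_zero]
  · exact Idle.w_eq_zero (d := .m3 k₁ l₁ s₁) (hidle _ _ hs)

variable (T) in
/-- A single job runs through the stages of the classes `3q1, …, 3q4`, the first of which it began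
at the tick `t`. -/
def Chain (t : ℕ) (q : Fin m) (k : ℕ) : Prop :=
  (k ≤ t + 144 * m → ∃ l s, T.Only3 k q l s (t + 9 * (4 * m * l + s)) ∧
    t + 9 * (4 * m * l + s) < k ∧ k ≤ t + 9 * (4 * m * l + s) + 9) ∧
  (t + 144 * m < k → T.Idle3 k)

theorem Chain.step {t k : ℕ} {q : Fin m} (h : T.Chain t q k) (hk : 0 < k)
    (h0 : ∀ q', T.out k (.m03 q') = 0) : T.Chain t q (k + 1) := by
  rcases Nat.lt_or_ge (t + 144 * m) k with hlt | hge
  · exact ⟨fun h' => by omega, fun _ => (h.2 hlt).stay hk h0⟩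
  · obtain ⟨l, s, h1, h2, h3⟩ := h.1 hge
    have hls := stage_lt l s
    by_cases hend : k = t + 9 * (4 * m * l + s) + 9
    · by_cases hlast : 4 * m * l + (s : ℕ) + 1 = 16 * m
      · exact ⟨fun h' => by omega, fun _ => h1.last hend h0 hlast⟩
      · obtain ⟨l', s', hl⟩ := exists_stage (m := m) (p := 4 * m * l + (s : ℕ) + 1) (by omega)
        refine ⟨fun _ => ⟨l', s', ?_, by rw [hl]; omega, by rw [hl]; omega⟩, fun h' => by omega⟩
        have := h1.next hend h0 hl
        rw [hl]
        convert this using 1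
        omega
    · exact ⟨fun _ => ⟨l, s, h1.stay hend h0, by omega, by omega⟩, fun h' => by omega⟩

theorem Chain.trans {t a b : ℕ} {q : Fin m} (h : T.Chain t q a) (ha : 0 < a) (hab : a ≤ b)
    (h0 : ∀ k, a ≤ k → k < b → ∀ q', T.out k (.m03 q') = 0) : T.Chain t q b := by
  induction b, hab using Nat.le_induction with
  | base => exact h
  | succ b hab ih =>
    exact (ih fun k hk hk' => h0 k hk (by omega)).step (by omega) (h0 b hab (by omega))

theorem Idle3.trans {a b : ℕ} (h : T.Idle3 a) (ha : 0 < a) (hab : a ≤ b)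
    (h0 : ∀ k, a ≤ k → k < b → ∀ q', T.out k (.m03 q') = 0) : T.Idle3 b := by
  induction b, hab using Nat.le_induction with
  | base => exact h
  | succ b hab ih =>
    exact (ih fun k hk hk' => h0 k hk (by omega)).stay (by omega) (h0 b hab (by omega))

theorem Idle3.chain {k : ℕ} {q : Fin m} (hk : 0 < k) (h : T.Idle3 k)
    (h0 : ∀ q', T.out k (.m03 q') = if q' = q then 1 else 0) : T.Chain k q (k + 1) := by
  have hm := T.pos
  refine ⟨fun _ => ⟨0, ⟨0, by omega⟩, ?_, by simp, by simp⟩, fun h' => by omega⟩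
  simpa using h.enter hk h0 (by omega)

/-! ### The selection of the next state -/

/-- Right before the command is selected, the job at the servers of the classes `3kl` has reached
the server of the next state; it blocks the job that is to pass through this server, while the
corresponding jobs pass at the servers of all other states. -/
theorem Only3.select {B n h : ℕ} {q : Fin m} {l : Fin 4} {s : Fin (4 * m)} (hB : B = 1200 * m * n)
    (hc : T.Only3 (B + 1196 * m) q l s h)
    (hs : (s : ℕ) + 1 < 4 * m) (h0 : ∀ q', T.out (B + 1196 * m) (.m03 q') = 0) (j : Fin m) :
    T.inn (B + 1196 * m) (.m41 j) = if j = T.M.successor q l then 0 else 1 := by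
  have hm := T.pos
  obtain ⟨e, he⟩ : ∃ e : Fin (4 * m), (e : ℕ) + 1 = 4 * m :=
    ⟨⟨4 * m - 1, by omega⟩, by simp only; omega⟩
  rw [T.inn_m41 _ j he]
  set K := B + 1196 * m with hK
  split_ifs with hj
  · subst hj
    -- the stage from which on no job passes
    have key : ∃ s₀ : Fin (4 * m), T.out K (.m35 (T.M.successor q l) s₀) = 0 := by
      -- if the service in a stage ends just now, the job takes the next server, where it has
      -- priority; otherwise it still occupies its present server
      by_cases hend : K = h + 9
      · refine ⟨⟨s + 1, hs⟩, ?_⟩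
        have hserv : T.M.network.service (.m3 q l ⟨s + 1, hs⟩) ≠ 0 :=
          (T.service_ne_iff _).2 (by simp [ticks])
        have hz : T.M.network.service (.m35 (T.M.successor q l) ⟨s + 1, hs⟩) = 0 := rfl
        have hfl : T.M.network.flushed T.θ (T.M.network.arrive (time m K) (T.X K))
            (.m35 (T.M.successor q l) s) = 0 := by
          refine T.M.network.flushed_of_serving T.θ _ ?_
          change (T.X K).serving (.m3 (T.M.successor q l) s) ≠ none
          rw [show (T.X K).serving (.m3 (T.M.successor q l) s) = _ from hc.1]
          simp
        refine T.M.network.outflow_of_blocked T.θ (T.positive K) (d := .m3 q l ⟨s + 1, hs⟩)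
          rfl hserv hz (T.levels _ _ rfl (by simp [level])) ?_ ?_
        · have h3 := T.M.network.flushed_le T.θ (T.M.network.arrive (time m K) (T.X K))
            (.m35 (T.M.successor q l) ⟨s + 1, hs⟩)
          rw [routed_m35_next _ _ _ (s := s) (s' := ⟨s + 1, hs⟩) rfl, hfl] at h3
          have h4 : (T.M.network.arrive (time m K) (T.X K)).waiting
              (.m35 (T.M.successor q l) ⟨s + 1, hs⟩) = T.w K (.m35 (T.M.successor q l) ⟨s + 1, hs⟩) +
              T.M.network.arrivals (time m K) (.m35 (T.M.successor q l) ⟨s + 1, hs⟩) := rfl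
          rw [T.w_of_capacity_zero K rfl, time, T.M.arrivals_eq T.pos] at h4
          simp only [arrivalTicks, Nat.succ_ne_zero, if_false, Option.map_none, Option.getD_none] at h4
          rw [time] at h3 ⊢
          omega
        · have h5 : T.M.network.routed (T.M.network.finishing (time m K) (T.X K))
              (.m3 q l ⟨s + 1, hs⟩) = 1 := by
            rw [routed_m3_next _ _ _ (l := l) (s := s) (by simp only; omega)]
            exact T.M.network.finishing_of_end hc.1
              ((T.time_add_eq_iff h K _).2 (by simp [ticks, hend]))
          omega
      · exact ⟨s, hc.1.out_eq_zero (d := .m35 (T.M.successor q l) s)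
          (by simp only [ticks]; omega) rfl⟩
    obtain ⟨s₀, hs₀⟩ := key
    -- a job lost at one stage does not reach the later ones
    have hall : ∀ p, (hp : p < 4 * m) → (s₀ : ℕ) ≤ p →
        T.out K (.m35 (T.M.successor q l) ⟨p, hp⟩) = 0 := by
      intro p hp hle
      induction p, hle using Nat.le_induction with
      | base => exact hs₀
      | succ p hle ih =>
        have h3 := T.out_le K (c := .m35 (T.M.successor q l) ⟨p + 1, hp⟩) rfl
        rw [T.w_of_capacity_zero K rfl,
          T.inn_m35_next K _ (s := ⟨p, by omega⟩) (s' := ⟨p + 1, hp⟩) rfl, ih (by omega)] at h3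
        omega
    exact hall e e.2 (by have := s₀.2; omega)
  · have hin : ∀ k₁ l₁ s₁, T.M.successor k₁ l₁ = j → T.inn K (.m3 k₁ l₁ s₁) = 0 := by
      intro k₁ l₁ s₁ hj₁
      refine inn_m3_eq_zero (h0 _) fun l₂ s₂ h₂ => ?_
      rw [hc.out_eq, if_neg]
      rintro ⟨⟨rfl, rfl, rfl⟩, -⟩
      obtain ⟨rfl, -⟩ := stage_eq (l' := l₂) (s' := ⟨s₂ + 1, hs⟩) (h₂.trans (by simp only; omega))
      exact hj hj₁.symm
    have hidle : ∀ s₁, T.Idle K (.m3 j s₁) := by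
      intro s₁
      refine hc.2.1 j s₁ ?_
      intro h'
      injection h' with h3
      exact hj h3
    have hout : ∀ s₁, T.out K (.m35 j s₁) = T.inn K (.m35 j s₁) := by
      intro s₁
      rw [Free.out_eq (s := .m3 j s₁) (Or.inl (hidle s₁)) (forall_m3 fun k₁ l₁ hj₁ =>
        ⟨hc.2.2 _ _ _, hin _ _ _ hj₁⟩) rfl rfl, T.w_of_capacity_zero K rfl, zero_add]
    have hall : ∀ p, (hp : p < 4 * m) → T.out K (.m35 j ⟨p, hp⟩) = 1 := by
      intro p hp
      rw [hout]
      induction p with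
      | zero => rw [hK, T.inn_m35_first hB (by omega) j rfl, if_pos rfl]
      | succ p ih =>
        rw [T.inn_m35_next K _ (s := ⟨p, by omega⟩) (s' := ⟨p + 1, hp⟩) rfl, hout]
        exact ih (by omega)
    exact hall e e.2

/-- At other times no job comes to the class `4j1`. -/
theorem inn_m41_eq_zero {B n o : ℕ} (hB : B = 1200 * m * n) (ho : o < 1200 * m)
    (ho' : o ≠ 1196 * m) (j : Fin m) : T.inn (B + o) (.m41 j) = 0 := by
  have hm := T.pos
  obtain ⟨e, he⟩ : ∃ e : Fin (4 * m), (e : ℕ) + 1 = 4 * m :=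
    ⟨⟨4 * m - 1, by omega⟩, by simp only; omega⟩
  rw [T.inn_m41 _ j he]
  have hall : ∀ p, (hp : p < 4 * m) → T.out (B + o) (.m35 j ⟨p, hp⟩) = 0 := by
    intro p hp
    have h3 := T.out_le (B + o) (c := .m35 j ⟨p, hp⟩) rfl
    rw [T.w_of_capacity_zero _ rfl] at h3
    induction p with
    | zero =>
      rw [T.inn_m35_first hB ho j rfl, if_neg ho'] at h3
      omega
    | succ p ih =>
      rw [T.inn_m35_next _ _ (s := ⟨p, by omega⟩) (s' := ⟨p + 1, hp⟩) rfl] at h3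
      have h4 := T.out_le (B + o) (c := .m35 j ⟨p, by omega⟩) rfl
      rw [T.w_of_capacity_zero _ rfl] at h4
      rw [ih (by omega) h4] at h3
      omega
  exact hall e e.2

end Setting

namespace Setting

open SCM

variable {m : ℕ} {T : Setting m}

/-! ### The cycle of the main network -/

theorem w_of_idle {k : ℕ} {d : Cls m} (hk : 0 < k) (h : T.Idle k (T.M.serverOf d)) :
    T.w k d = 0 := by
  obtain ⟨k, rfl⟩ : ∃ k', k = k' + 1 := ⟨k - 1, by omega⟩
  exact h.w_eq_zero

theorem inn_m02_eq_zero {B n o : ℕ} (hB : B = 1200 * m * n) (h0 : 0 < o) (ho : o < 1200 * m)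
    (j : Fin m) : T.inn (B + o) (.m02 j) = 0 := by
  have h1 := T.out_le (B + o) (c := .m42 j) rfl
  rw [T.w_of_capacity_zero _ rfl, T.inn_m42 hB ho, if_neg (by omega)] at h1
  rw [inn_m02]
  omega

/-- The last service in the class `01i` before the job of class `03q` passes. -/
theorem out_m03_of_serves {A h E : ℕ} {i : Fin 2} {q : Fin m} (hs : T.Serves (h + 1) (.m01 i) h)
    (hw : ∀ i', T.w (h + 1) (.m01 i') = 0)
    (hv : ∀ j, T.w (h + 1) (.m03 j) = if j = q ∧ A < h + 1 then 1 else 0)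
    (hin0 : ∀ k, h < k → k < E → ∀ i', T.inn k (.m01 i') = 0)
    (hin : ∀ k, h < k → k < E → ∀ j, T.inn k (.m03 j) = if j = q ∧ k = A then 1 else 0)
    (hD : A ≤ h + ticks (.m01 i : Cls m)) (hE : h + ticks (.m01 i : Cls m) < E) :
    (∀ k, h < k → k < E → ∀ j, T.out k (.m03 j) =
      if j = q ∧ k = h + ticks (.m01 i : Cls m) then 1 else 0) ∧ T.Idle E .m01 := by
  have hm := T.pos
  have ht : 0 < ticks (.m01 i : Cls m) := by simp only [ticks]; split_ifs <;> omega
  obtain ⟨h1, h2, -⟩ := hs.then_idle (E := E) ht (forall_m01 hw)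
    fun k hk hk' => forall_m01 fun i' => Or.inl (hin0 k hk hk' i')
  have h3 : ∀ k, h + 1 ≤ k → k ≤ h + ticks (.m01 i : Cls m) → ∀ j, T.w k (.m03 j) =
      if j = q ∧ A < k then 1 else 0 := by
    intro k hk
    induction k, hk using Nat.le_induction with
    | base => exact fun _ => hv
    | succ k hk ih =>
      intro hk' j
      rw [(h1 k (by omega) (by omega)).w_succ (d := .m03 j) (by omega) rfl, ih (by omega) j,
        hin k (by omega) (by omega) j]
      change _ + _ = _
      by_cases hj : j = q
      · simp only [hj, true_and]
        split_ifs <;> omega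
      · simp [hj]
  refine ⟨fun k hk hkE j => ?_, h2 E hE le_rfl⟩
  rcases lt_trichotomy k (h + ticks (.m01 i : Cls m)) with hlt | heq | hgt
  · rw [if_neg (by omega)]
    exact (h1 k hk hlt.le).out_eq_zero (d := .m03 j) (by omega) rfl
  · have hw' : ∀ i', T.w k (.m01 i') = 0 := by
      intro i'
      have key : ∀ k, h + 1 ≤ k → k ≤ h + ticks (.m01 i : Cls m) → T.w k (.m01 i') = 0 := by
        intro k hk
        induction k, hk using Nat.le_induction with
        | base => exact fun _ => hw i'
        | succ k hk ih =>
          intro hk'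
          rw [(h1 k (by omega) (by omega)).w_succ (d := .m01 i') (by omega) rfl, ih (by omega),
            hin0 k (by omega) (by omega), Network.stored_zero]
      exact key k hk heq.le
    rw [Free.out_eq (s := .m01) (Or.inr ⟨.m01 i, h, rfl, h1 k hk heq.le, heq.symm⟩)
      (forall_m01 fun i' => ⟨hw' i', hin0 k hk hkE i'⟩) rfl rfl, h3 k hk heq.le, hin k hk hkE]
    by_cases hj : j = q
    · simp only [hj, true_and, heq]
      split_ifs <;> omega
    · simp [hj]
  · have hi := h2 k hgt hkE.le
    rw [Free.out_eq (s := .m01) (Or.inl hi)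
      (forall_m01 fun i' => ⟨w_of_idle (by omega) hi, hin0 k hk hkE i'⟩) rfl rfl,
      w_of_idle (d := .m03 j) (by omega) hi, hin k hk hkE, if_neg (by omega), if_neg (by omega)]

/-- The jobs of the classes `011`, `012`, which display whether the counters are positive, delay the
job of class `03q`. The delay is such that this job will be in the stage of the class `3q(l+1)` at
the server of the next state at the time of the selection. -/
theorem out_m03 {B n : ℕ} {q : Fin m} {z : Fin 2 → ℕ} (hB : B = 1200 * m * n)
    (hi : T.Idle (B + 1) .m01)
    (h33 : ∀ i o, 0 < o → o < 1200 * m → T.out (B + o) (.c33 i) =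
      if o = 1080 * m ∧ 0 < z i then 1 else 0)
    (h02 : ∀ o, 0 < o → o < 1200 * m → ∀ j, T.out (B + o) (.m02 j) =
      if j = q ∧ o = 1084 * m then 1 else 0) :
    (∀ k, B < k → k ≤ B + 1080 * m → T.Idle k .m01) ∧ T.Idle (B + 1200 * m) .m01 ∧
    ∃ u, ∃ l : Fin 4, 1084 * m ≤ u ∧ u + 36 * m * l + 4 * m ≤ 1196 * m ∧
      1196 * m ≤ u + 36 * m * l + 8 * m ∧
      T.M.successor q l = T.M.α q (decide (0 < z 0)) (decide (0 < z 1)) ∧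
      ∀ o, 0 < o → o < 1200 * m → ∀ j, T.out (B + o) (.m03 j) =
        if j = q ∧ o = u then 1 else 0 := by
  have hm := T.pos
  have hin0 : ∀ k, B < k → k < B + 1200 * m → ∀ i, T.inn k (.m01 i) =
      if k = B + 1080 * m ∧ 0 < z i then 1 else 0 := by
    intro k hk hk' i
    obtain ⟨o, rfl⟩ := Nat.exists_eq_add_of_lt hk
    rw [add_assoc] at hk' ⊢
    rw [inn_m01, h33 i _ (by omega) (by omega)]
    exact if_congr (by omega) rfl rfl
  have hin : ∀ k, B < k → k < B + 1200 * m → ∀ j, T.inn k (.m03 j) =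
      if j = q ∧ k = B + 1084 * m then 1 else 0 := by
    intro k hk hk' j
    obtain ⟨o, rfl⟩ := Nat.exists_eq_add_of_lt hk
    rw [add_assoc] at hk' ⊢
    rw [inn_m03, h02 _ (by omega) (by omega)]
    exact if_congr (by omega) rfl rfl
  have idle0 : ∀ k, B < k → k ≤ B + 1080 * m → T.Idle k .m01 := fun k hk hk' =>
    hi.trans (Nat.succ_pos _) hk fun k' h1 h2 => forall_m01 fun i => by
      rw [hin0 k' (by omega) (by omega), if_neg (by omega)]
  have out_of_idle : ∀ k, B < k → k < B + 1200 * m → T.Idle k .m01 →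
      (∀ i, T.inn k (.m01 i) = 0) → ∀ j, T.out k (.m03 j) =
        if j = q ∧ k = B + 1084 * m then 1 else 0 := by
    intro k hk hk' hi' h0 j
    rw [Free.out_eq (s := .m01) (Or.inl hi')
      (forall_m01 fun i' => ⟨w_of_idle (by omega) hi', h0 i'⟩) rfl rfl,
      w_of_idle (by omega) hi', hin k hk hk', zero_add]
  have out_early : ∀ k, B < k → k < B + 1080 * m → ∀ j, T.out k (.m03 j) = 0 := by
    intro k hk hk' j
    rw [out_of_idle k hk (by omega) (idle0 k hk hk'.le)
      (fun i => by rw [hin0 k hk (by omega), if_neg (by omega)]), if_neg (by omega)]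
  have i1 := idle0 (B + 1080 * m) (by omega) le_rfl
  have out_1080 : ∀ j, T.out (B + 1080 * m) (.m03 j) = 0 := by
    intro j
    have h1 := T.out_le (B + 1080 * m) (c := .m03 j) rfl
    rw [w_of_idle (by omega) i1, hin _ (by omega) (by omega), if_neg (by omega)] at h1
    omega
  -- the service of the last job of the classes `01i`, begun at the tick `h`
  have finish : ∀ (h : ℕ) (i : Fin 2) (l : Fin 4), B + 1080 * m ≤ h →
      (∀ k, B < k → k ≤ h → ∀ j, T.out k (.m03 j) = 0) →
      T.Serves (h + 1) (.m01 i) h → (∀ i', T.w (h + 1) (.m01 i') = 0) →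
      (∀ j, T.w (h + 1) (.m03 j) = if j = q ∧ B + 1084 * m < h + 1 then 1 else 0) →
      h + ticks (.m01 i : Cls m) + 36 * m * l = B + 1188 * m →
      T.M.successor q l = T.M.α q (decide (0 < z 0)) (decide (0 < z 1)) →
      T.Idle (B + 1200 * m) .m01 ∧ ∃ u, ∃ l : Fin 4, 1084 * m ≤ u ∧
        u + 36 * m * l + 4 * m ≤ 1196 * m ∧ 1196 * m ≤ u + 36 * m * l + 8 * m ∧
        T.M.successor q l = T.M.α q (decide (0 < z 0)) (decide (0 < z 1)) ∧
        ∀ o, 0 < o → o < 1200 * m → ∀ j, T.out (B + o) (.m03 j) =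
          if j = q ∧ o = u then 1 else 0 := by
    intro h i l hh hbefore hs hw hv hl hsel
    have ht : 36 * m ≤ ticks (.m01 i : Cls m) := by simp only [ticks]; split_ifs <;> omega
    obtain ⟨h1, h2⟩ := out_m03_of_serves (A := B + 1084 * m) (E := B + 1200 * m) hs hw hv
      (fun k hk hk' i' => by rw [hin0 k (by omega) hk', if_neg (by omega)])
      (fun k hk hk' => hin k (by omega) hk') (by omega) (by omega)
    refine ⟨h2, h + ticks (.m01 i : Cls m) - B, l, by omega, by omega, by omega, hsel,
      fun o ho ho' j => ?_⟩
    rcases Nat.lt_or_ge h (B + o) with hlt | hge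
    · rw [h1 _ hlt (by omega)]
      exact if_congr (by omega) rfl rfl
    · rw [hbefore _ (by omega) hge, if_neg (by omega)]
  have before : ∀ k, B < k → k ≤ B + 1080 * m → ∀ j, T.out k (.m03 j) = 0 := by
    intro k hk hk' j
    rcases hk'.eq_or_lt with rfl | hlt
    · exact out_1080 j
    · exact out_early k hk hlt j
  have hw1 : ∀ i, T.w (B + 1080 * m) (.m01 i) = 0 := fun i => w_of_idle (by omega) i1
  have hwm3 : ∀ i, T.Next (B + 1080 * m) (.m01 i) → ∀ j, T.w (B + 1080 * m + 1) (.m03 j) =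
      if j = q ∧ B + 1084 * m < B + 1080 * m + 1 then 1 else 0 := by
    intro i hn j
    rw [hn.w_zero (d := .m03 j) rfl rfl, out_1080, w_of_idle (by omega) i1,
      hin _ (by omega) (by omega), if_neg (by omega), if_neg (by omega), Network.stored_zero]
  have ti : ∀ i : Fin 2, ticks (.m01 i : Cls m) ≠ 0 := fun i => by
    simp only [ticks]; split_ifs <;> omega
  refine ⟨idle0, ?_⟩
  have hin1 := hin0 (B + 1080 * m) (by omega) (by omega)
  simp only [true_and] at hin1
  -- the job of class `03q`, ready at the tick `1084 * m`, enters the chain at the tick `1084 * m`,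
  -- `1152 * m`, `1116 * m`, `1188 * m`, according to the signs of `z 0` and `z 1`
  rcases Nat.eq_zero_or_pos (z 0) with h0 | h0 <;> rcases Nat.eq_zero_or_pos (z 1) with h1 | h1
  · have hz : ∀ k, B < k → k < B + 1200 * m → ∀ i, T.inn k (.m01 i) = 0 := by
      intro k hk hk' i
      rw [hin0 k hk hk', if_neg]
      rintro ⟨-, hz⟩
      fin_cases i
      · exact hz.ne' h0
      · exact hz.ne' h1
    have hi' : ∀ k, B < k → k ≤ B + 1200 * m → T.Idle k .m01 := fun k hk hk' =>
      hi.trans (Nat.succ_pos _) hk fun k' h1 h2 => forall_m01 fun i =>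
        hz k' (by omega) (by omega) i
    refine ⟨hi' _ (by omega) le_rfl, 1084 * m, 3, le_rfl, ?_, ?_, by simp [successor, h0, h1],
      fun o ho ho' j => ?_⟩
    · change 1084 * m + 36 * m * 3 + _ ≤ _; omega
    · change _ ≤ 1084 * m + 36 * m * 3 + _; omega
    · rw [out_of_idle _ (by omega) (by omega) (hi' _ (by omega) (by omega))
        (hz _ (by omega) (by omega))]
      exact if_congr (by omega) rfl rfl
  · have hn : T.Next (B + 1080 * m) (.m01 1) := by
      refine ⟨Or.inl i1, ti 1, by rw [hin1, if_pos h1]; omega, forall_m01 fun i hne => Or.inr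
        ⟨hw1 i, ?_⟩⟩
      rw [hin1, if_neg]
      fin_cases i
      · simp [h0]
      · exact absurd rfl hne
    refine finish (B + 1080 * m) 1 1 le_rfl before hn.serves (fun i => ?_) (hwm3 _ hn) ?_
      (by simp [successor, h0, h1])
    · fin_cases i
      · have := hn.w_other (d := .m01 0) rfl (by simp) (ti 0)
        rw [hw1, hin1, if_neg (by omega), Network.stored_zero] at this
        exact this
      · have := hn.w_self
        rw [hw1, hin1, if_pos h1, Network.stored_zero] at this
        exact this
    · change _ + 72 * m + 36 * m * 1 = _; omega
  · have hn : T.Next (B + 1080 * m) (.m01 0) := by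
      refine ⟨Or.inl i1, ti 0, by rw [hin1, if_pos h0]; omega, forall_m01 fun i hne => Or.inr
        ⟨hw1 i, ?_⟩⟩
      rw [hin1, if_neg]
      fin_cases i
      · exact absurd rfl hne
      · simp [h1]
    refine finish (B + 1080 * m) 0 2 le_rfl before hn.serves (fun i => ?_) (hwm3 _ hn) ?_
      (by simp [successor, h0, h1])
    · fin_cases i
      · have := hn.w_self
        rw [hw1, hin1, if_pos h0, Network.stored_zero] at this
        exact this
      · have := hn.w_other (d := .m01 1) rfl (by simp) (ti 1)
        rw [hw1, hin1, if_neg (by omega), Network.stored_zero] at this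
        exact this
    · change _ + 36 * m + 36 * m * 2 = _; omega
  · have hn : T.Next (B + 1080 * m) (.m01 0) := by
      refine ⟨Or.inl i1, ti 0, by rw [hin1, if_pos h0]; omega, forall_m01 fun i hne => Or.inl ?_⟩
      fin_cases i
      · exact absurd rfl hne
      · simp [level]
    have t0 : ticks (.m01 0 : Cls m) = 36 * m := rfl
    set h := B + 1080 * m with hh
    have hs : ∀ k, h < k → k ≤ h + 36 * m → T.Serves k (.m01 0) h := fun k hk hk' =>
      hn.serves.trans hk (by omega)
    have hw : ∀ k, h + 1 ≤ k → k ≤ h + 36 * m → T.w k (.m01 0) = 0 ∧ T.w k (.m01 1) = 1 ∧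
        ∀ j, T.w k (.m03 j) = if j = q ∧ B + 1084 * m < k then 1 else 0 := by
      intro k hk
      induction k, hk using Nat.le_induction with
      | base =>
        refine fun _ => ⟨?_, ?_, hwm3 _ hn⟩
        · rw [hn.w_self, hw1, hin1, if_pos h0, Network.stored_zero]
        · have := hn.w_other (d := .m01 1) rfl (by simp) (ti 1)
          rw [hw1, hin1, if_pos h1] at this
          exact this
      | succ k hk ih =>
        intro hk'
        obtain ⟨a1, a2, a3⟩ := ih (by omega)
        have hsk := hs k (by omega) (by omega)
        have hz : ∀ i, T.inn k (.m01 i) = 0 := fun i => by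
          rw [hin0 k (by omega) (by omega), if_neg (by omega)]
        refine ⟨?_, ?_, fun j => ?_⟩
        · rw [hsk.w_succ (d := .m01 0) (by omega) rfl, a1, hz, Network.stored_zero]
        · rw [hsk.w_succ (d := .m01 1) (by omega) rfl, a2, hz]
          rfl
        · rw [hsk.w_succ (d := .m03 j) (by omega) rfl, a3, hin k (by omega) (by omega)]
          change _ + _ = _
          by_cases hj : j = q
          · simp only [hj, true_and]
            split_ifs <;> omega
          · simp [hj]
    obtain ⟨a1, a2, a3⟩ := hw (h + 36 * m) (by omega) le_rfl
    have hs' := hs (h + 36 * m) (by omega) le_rfl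
    have hz : ∀ i, T.inn (h + 36 * m) (.m01 i) = 0 := fun i => by
      rw [hin0 _ (by omega) (by omega), if_neg (by omega)]
    have hn' : T.Next (h + 36 * m) (.m01 1) := by
      refine ⟨Or.inr ⟨.m01 0, h, rfl, hs', rfl⟩, ti 1, by omega, forall_m01 fun i hne =>
        Or.inr ⟨?_, hz i⟩⟩
      fin_cases i
      · exact a1
      · exact absurd rfl hne
    have hb : ∀ j, T.out (h + 36 * m) (.m03 j) = 0 := fun j =>
      hs'.out_eq_zero_of_blocked (c := .m03 j) (d := .m01 1) rfl rfl (ti 1) rfl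
        (by simp [level]) (by omega)
    refine finish (h + 36 * m) 1 0 (by omega) (fun k hk hk' j => ?_) hn'.serves (fun i => ?_)
      (fun j => ?_) ?_ (by simp [successor, h0, h1])
    · rcases Nat.lt_or_ge h k with hlt | hge
      · rcases hk'.eq_or_lt with rfl | hlt'
        · exact hb j
        · exact (hs k hlt hk').out_eq_zero (d := .m03 j) (by omega) rfl
      · exact before k hk hge j
    · fin_cases i
      · have := hn'.w_other (d := .m01 0) rfl (by simp) (ti 0)
        rw [a1, hz, Network.stored_zero] at this
        exact this
      · have := hn'.w_self
        rw [a2, hz, Network.stored_zero] at this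
        exact this
    · rw [hn'.w_zero (d := .m03 j) rfl rfl, hb, a3, hin _ (by omega) (by omega)]
      change _ + _ - 0 = _
      by_cases hj : j = q
      · simp only [hj, true_and]
        split_ifs <;> omega
      · simp [hj]
    · change _ + 72 * m + 36 * m * 0 = _; omega

variable (T) in
/-- The state of the main network right after the beginning of a cycle in the state `q` of the
machine, at the tick `B`. The job of the previous cycle may still be in the last stages of the
chain, and the servers `4j` may still be busy. -/
structure MainStart (B : ℕ) (q : Fin m) : Prop where
  serves : T.Serves (B + 1) (.m02 q) B
  w_m02 : T.w (B + 1) (.m02 q) = 0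
  idle_m02 : ∀ j, j ≠ q → T.Idle (B + 1) (.m02 j)
  idle_m01 : T.Idle (B + 1) .m01
  chain : T.Idle3 (B + 1) ∨ ∃ t q', t + 8 * m ≤ B ∧ T.Chain t q' (B + 1)
  m4 : ∀ j, T.Idle (B + 1) (.m4 j) ∨ ∃ h, T.Serves (B + 1) (.m41 j) h ∧
    T.w (B + 1) (.m41 j) = 0 ∧ B < h + 8 * m ∧ h ≤ B

variable (T) in
/-- Right before the tick `k` the main network holds no job apart from one of class `02q`, which is
in service since the tick `B`. -/
structure MainQuiet (B : ℕ) (q : Fin m) (k : ℕ) : Prop where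
  serves : T.Serves k (.m02 q) B
  w_m02 : T.w k (.m02 q) = 0
  idle_m02 : ∀ j, j ≠ q → T.Idle k (.m02 j)
  idle_m01 : T.Idle k .m01
  idle_m3 : T.Idle3 k
  idle_m4 : ∀ j, T.Idle k (.m4 j)

/-- During a cycle, the main network finds the next state `r` of the machine from the jobs which it
receives from the subnetworks; at the end it starts the job of class `02r` and sends the command of
`r`. -/
theorem MainStart.cycle {B n : ℕ} {q : Fin m} {z : Fin 2 → ℕ} (hB : B = 1200 * m * n)
    (h : T.MainStart B q)
    (h33 : ∀ i o, 0 < o → o < 1200 * m → T.out (B + o) (.c33 i) =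
      if o = 1080 * m ∧ 0 < z i then 1 else 0) :
    T.MainQuiet B q (B + 400 * m) ∧ T.MainQuiet B q (B + 400 * m + 1) ∧
      T.MainStart (B + 1200 * m) (T.M.α q (decide (0 < z 0)) (decide (0 < z 1))) ∧
      ∀ j, T.out (B + 1200 * m) (.m43 j) =
        if j = T.M.α q (decide (0 < z 0)) (decide (0 < z 1)) then 1 else 0 := by
  have hm := T.pos
  have hB' : B + 1200 * m = 1200 * m * (n + 1) := by rw [hB]; ring
  have t02 : ticks (.m02 q : Cls m) = 1084 * m := rfl
  have hin02 : ∀ k, B < k → k < B + 1200 * m → ∀ j, T.inn k (.m02 j) = 0 := by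
    intro k hk hk' j
    obtain ⟨o, rfl⟩ := Nat.exists_eq_add_of_lt hk
    rw [add_assoc] at hk' ⊢
    exact inn_m02_eq_zero hB (by omega) (by omega) j
  obtain ⟨s1, s2, s3⟩ := h.serves.then_idle (E := B + 1200 * m) (by omega)
    (forall_m02 h.w_m02) fun k hk hk' => forall_m02 (Or.inl (hin02 k hk hk' q))
  have w02 : ∀ k, B + 1 ≤ k → k ≤ B + 1084 * m → T.w k (.m02 q) = 0 := by
    intro k hk
    induction k, hk using Nat.le_induction with
    | base => exact fun _ => h.w_m02
    | succ k hk ih =>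
      intro hk'
      rw [(s1 k (by omega) (by omega)).w_succ (d := .m02 q) (by omega) rfl, ih (by omega),
        hin02 k (by omega) (by omega), Network.stored_zero]
  have i02 : ∀ k, B < k → k ≤ B + 1200 * m → ∀ j, j ≠ q → T.Idle k (.m02 j) :=
    fun k hk hk' j hj => (h.idle_m02 j hj).trans (Nat.succ_pos _) hk fun k' h1 h2 =>
      forall_m02 (hin02 k' (by omega) (by omega) j)
  have out02 : ∀ o, 0 < o → o < 1200 * m → ∀ j, T.out (B + o) (.m02 j) =
      if j = q ∧ o = 1084 * m then 1 else 0 := by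
    intro o ho ho' j
    by_cases hj : j = q
    · subst hj
      rw [s3 _ (by omega) (by omega) (.m02 j) rfl (by omega)]
      exact if_congr (by rw [t02]; simp) rfl rfl
    · rw [if_neg fun h => hj h.1]
      exact (i02 _ (by omega) (by omega) j hj).out_eq_zero (d := .m02 j)
        (by simp only [ticks]; omega)
  obtain ⟨i01, i01', u, l, hu1, hu2, hu3, hsel, out03⟩ := out_m03 hB h.idle_m01 h33 out02
  rw [← hsel]
  set r := T.M.successor q l with hr
  have out03' : ∀ k, B < k → k < B + 1200 * m → k ≠ B + u → ∀ j, T.out k (.m03 j) = 0 := by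
    intro k hk hk' hne j
    obtain ⟨o, rfl⟩ := Nat.exists_eq_add_of_lt hk
    rw [add_assoc] at hk' hne ⊢
    rw [out03 _ (by omega) (by omega), if_neg (by omega)]
  -- the chain
  have hl : (l : ℕ) ≤ 3 := by omega
  have hu4 : u ≤ 1192 * m := by omega
  have i3a : T.Idle3 (B + 400 * m) := by
    have h0 : ∀ k, B + 1 ≤ k → k < B + 400 * m → ∀ q', T.out k (.m03 q') = 0 :=
      fun k h1 h2 => out03' k (by omega) (by omega) (by omega)
    rcases h.chain with h1 | ⟨t, q', h1, h2⟩
    · exact h1.trans (Nat.succ_pos _) (by omega) h0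
    · exact (h2.trans (Nat.succ_pos _) (by omega) h0).2 (by omega)
  have i3 : ∀ k, B + 400 * m ≤ k → k ≤ B + u → T.Idle3 k := fun k hk hk' =>
    i3a.trans (by omega) hk fun k' h1 h2 => out03' k' (by omega) (by omega) (by omega)
  have ch0 : T.Chain (B + u) q (B + u + 1) :=
    (i3 (B + u) (by omega) le_rfl).chain (by omega) fun q' => by
      rw [out03 u (by omega) (by omega)]
      exact if_congr (by simp) rfl rfl
  have ch : ∀ k, B + u < k → k ≤ B + 1200 * m → T.Chain (B + u) q k := fun k hk hk' =>
    ch0.trans (Nat.succ_pos _) hk fun k' h1 h2 => out03' k' (by omega) (by omega) (by omega)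
  have in41 : ∀ j, T.inn (B + 1196 * m) (.m41 j) = if j = r then 0 else 1 := by
    intro j
    obtain ⟨l', s, h1, h2, h3⟩ := (ch (B + 1196 * m) (by omega) (by omega)).1 (by omega)
    have hs := s.2
    have e1 : 9 * (4 * m * (l' : ℕ) + s) = 36 * m * l' + 9 * s := by ring
    rw [e1] at h2 h3
    have hll : l' = l := by
      rcases lt_trichotomy (l' : ℕ) l with hlt | heq | hgt
      · have := Nat.mul_le_mul_left (36 * m) (Nat.succ_le_of_lt hlt)
        rw [Nat.succ_eq_add_one, mul_add] at this
        omega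
      · exact Fin.ext heq
      · have := Nat.mul_le_mul_left (36 * m) (Nat.succ_le_of_lt hgt)
        rw [Nat.succ_eq_add_one, mul_add] at this
        omega
    subst hll
    exact h1.select hB (by omega) (out03' _ (by omega) (by omega) (by omega)) j
  -- the servers of the classes `4jk`
  have t41 : ∀ j, ticks (.m41 j : Cls m) = 8 * m := fun _ => rfl
  have in41' : ∀ k, B < k → k < B + 1200 * m → k ≠ B + 1196 * m → ∀ j, T.inn k (.m41 j) = 0 := by
    intro k hk hk' hne j
    obtain ⟨o, rfl⟩ := Nat.exists_eq_add_of_lt hk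
    rw [add_assoc] at hk' hne ⊢
    exact inn_m41_eq_zero hB (by omega) (by omega) j
  have i4 : ∀ k, B + 400 * m ≤ k → k ≤ B + 1196 * m → ∀ j, T.Idle k (.m4 j) := by
    intro k hk hk' j
    rcases h.m4 j with h1 | ⟨t, h1, h2, h3, h4⟩
    · exact h1.trans (Nat.succ_pos _) (by omega) fun k' h1 h2 =>
        forall_m4 (in41' k' (by omega) (by omega) (by omega) j)
    · refine (h1.then_idle_of (E := B + 1196 * m) (by rw [t41]; omega) (forall_m4 h2)
        fun k' h5 h6 => forall_m4 (Or.inl (in41' k' (by omega) (by omega) (by omega) j))).2.1 k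
        (by rw [t41]; omega) hk'
  have i4r : ∀ k, B + 1196 * m ≤ k → k ≤ B + 1200 * m → T.Idle k (.m4 r) := by
    intro k hk hk'
    refine (i4 (B + 1196 * m) (by omega) le_rfl r).trans (by omega) hk fun k' h1 h2 => forall_m4 ?_
    by_cases he : k' = B + 1196 * m
    · rw [he, in41, if_pos rfl]
    · exact in41' k' (by omega) (by omega) he r
  have s4 : ∀ j, j ≠ r → ∀ k, B + 1196 * m < k → k ≤ B + 1200 * m →
      T.Serves k (.m41 j) (B + 1196 * m) ∧ T.w k (.m41 j) = 0 := by
    intro j hj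
    have hidle := i4 (B + 1196 * m) (by omega) le_rfl j
    have hin := in41 j
    rw [if_neg hj] at hin
    have hw : T.w (B + 1196 * m) (.m41 j) = 0 := w_of_idle (d := .m41 j) (by omega) hidle
    have hn : T.Next (B + 1196 * m) (.m41 j) :=
      ⟨Or.inl hidle, by rw [t41]; omega, by omega, forall_m4 fun h => absurd rfl h⟩
    have hs : ∀ k, B + 1196 * m < k → k ≤ B + 1200 * m →
        T.Serves k (.m41 j) (B + 1196 * m) := fun k hk hk' =>
      hn.serves.trans hk (by rw [t41]; omega)
    have hwk : ∀ k, B + 1196 * m + 1 ≤ k → k ≤ B + 1200 * m → T.w k (.m41 j) = 0 := by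
      intro k hk
      induction k, hk using Nat.le_induction with
      | base => exact fun _ => by rw [hn.w_self, hw, hin, Network.stored_zero]
      | succ k hk ih =>
        intro hk'
        rw [(hs k (by omega) (by omega)).w_succ (d := .m41 j) (by rw [t41]; omega) rfl,
          ih (by omega), in41' k (by omega) (by omega) (by omega), Network.stored_zero]
    exact fun k hk hk' => ⟨hs k hk hk', hwk k hk hk'⟩
  -- the beginning of the next cycle
  set C := B + 1200 * m with hC
  have in41C : ∀ j, T.inn C (.m41 j) = 0 := fun j =>
    inn_m41_eq_zero (o := 0) hB' (by omega) (by omega) j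
  have w41r : T.w C (.m41 r) = 0 := w_of_idle (d := .m41 r) (by omega) (i4r C (by omega) le_rfl)
  have outC : ∀ j, T.out C (.m42 j) = (if j = r then 1 else 0) ∧
      T.out C (.m43 j) = if j = r then 1 else 0 := by
    intro j
    by_cases hj : j = r
    · subst hj
      have key : ∀ d : Cls m, T.M.serverOf d = .m4 r → ticks d = 0 → bufferSize d = some 0 →
          T.inn (C + 0) d = (if 0 = 0 ∧ 0 < n + 1 then 1 else 0) → T.out C d = 1 := by
        intro d hd hd0 hd1 hd2
        rw [Free.out_eq (s := .m4 r) (Or.inl (i4r C (by omega) le_rfl))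
          (forall_m4 ⟨w41r, in41C r⟩) hd hd0, T.w_of_capacity_zero _ hd1]
        rw [add_zero, if_pos ⟨rfl, Nat.succ_pos n⟩] at hd2
        rw [hd2]
      rw [if_pos rfl]
      exact ⟨key _ rfl rfl rfl (T.inn_m42 (n := n + 1) hB' (by omega) r),
        key _ rfl rfl rfl (T.inn_m43 (n := n + 1) hB' (by omega) r)⟩
    · obtain ⟨h1, -⟩ := s4 j hj C (by omega) le_rfl
      rw [if_neg hj]
      exact ⟨h1.out_eq_zero (d := .m42 j) (by rw [t41]; omega) rfl,
        h1.out_eq_zero (d := .m43 j) (by rw [t41]; omega) rfl⟩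
  have idleC : ∀ j, T.Idle C (.m02 j) := by
    intro j
    by_cases hj : j = q
    · rw [hj]
      exact s2 C (by rw [t02]; omega) le_rfl
    · exact i02 C (by omega) le_rfl j hj
  have out02C : ∀ j, T.out C (.m02 j) = 0 := fun j =>
    (idleC j).out_eq_zero (d := .m02 j) (by simp only [ticks]; omega)
  have in01C : ∀ i, T.inn C (.m01 i) = 0 := by
    intro i
    have h1 := T.out_le C (c := .c33 i) rfl
    have h2 := T.inn_c33 (o := 0) hB' (by omega) i
    rw [add_zero, if_neg (by omega)] at h2
    rw [T.w_of_capacity_zero _ rfl, h2] at h1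
    rw [inn_m01]
    omega
  have w01C : ∀ i, T.w C (.m01 i) = 0 := fun i => w_of_idle (by omega) i01'
  have out03C : ∀ j, T.out C (.m03 j) = 0 := by
    intro j
    rw [Free.out_eq (s := .m01) (Or.inl i01') (forall_m01 fun i => ⟨w01C i, in01C i⟩) rfl rfl,
      w_of_idle (d := .m03 j) (by omega) i01', inn_m03, out02C]
  have in02C : ∀ j, T.inn C (.m02 j) = if j = r then 1 else 0 := fun j => by
    rw [inn_m02, (outC j).1]
  have hn : T.Next C (.m02 r) :=
    ⟨Or.inl (idleC r), by simp only [ticks]; omega, by rw [in02C, if_pos rfl]; omega,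
      forall_m02 fun h => absurd rfl h⟩
  have w02C : ∀ j, T.w C (.m02 j) = 0 := fun j => w_of_idle (d := .m02 j) (by omega) (idleC j)
  have quiet : ∀ k, B + 400 * m ≤ k → k ≤ B + 1080 * m → T.MainQuiet B q k := fun k hk hk' =>
    ⟨s1 k (by omega) (by rw [t02]; omega), w02 k (by omega) (by omega),
      i02 k (by omega) (by omega), i01 k (by omega) hk', i3 k hk (by omega),
      i4 k hk (by omega)⟩
  refine ⟨quiet _ le_rfl (by omega), quiet _ (by omega) (by omega), ⟨hn.serves, ?_, ?_, ?_, ?_, ?_⟩,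
    fun j => (outC j).2⟩
  · rw [hn.w_self, w02C, in02C, if_pos rfl, Network.stored_zero]
  · intro j hj
    exact Free.idle_succ (Or.inl (idleC j)) (forall_m02 ⟨w02C j, by rw [in02C, if_neg hj]⟩)
  · exact Free.idle_succ (Or.inl i01') (forall_m01 fun i => ⟨w01C i, in01C i⟩)
  · exact Or.inr ⟨B + u, q, by omega, (ch C (by omega) le_rfl).step (by omega) out03C⟩
  · intro j
    by_cases hj : j = r
    · subst hj
      exact Or.inl (Free.idle_succ (Or.inl (i4r C (by omega) le_rfl)) (forall_m4 ⟨w41r, in41C _⟩))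
    · obtain ⟨h1, h2⟩ := s4 j hj C (by omega) le_rfl
      refine Or.inr ⟨B + 1196 * m, h1.succ (by rw [t41]; omega), ?_, by omega, by omega⟩
      rw [h1.w_succ (d := .m41 j) (by rw [t41]; omega) rfl, h2, in41C, Network.stored_zero]

end Setting

namespace SCM

variable {m : ℕ}

/-- The value of a counter. -/
def counter (p : Fin m × ℕ × ℕ) (i : Fin 2) : ℕ := if i = 0 then p.2.1 else p.2.2

/-- Initially there is one job in class `02j`, where `j` is the initial state of the machine, and
the initial value of the first counter is represented by jobs of class `112`. -/
def startQueue (s₀ : Fin m) (z : ℕ) (c : Cls m) : ℕ :=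
  if c = .m02 s₀ then 1 else if c = .c12 0 then z else 0

theorem startQueue_zero (s₀ : Fin m) : startQueue s₀ 0 = initialQueue s₀ := by
  funext c
  simp [startQueue, initialQueue]

theorem step_fst (M : SCM m) (p : Fin m × ℕ × ℕ) :
    (M.step p).1 = M.α p.1 (decide (0 < counter p 0)) (decide (0 < counter p 1)) := rfl

theorem counter_command (M : SCM m) (r : Fin m) {a b : ℕ} (ha : M.β r = (-1, 0) → 0 < a)
    (hb : M.β r = (0, -1) → 0 < b) (i : Fin 2) :
    (if i = 0 then a else b) + (if M.command r = some (.c41 i) then 0 else 1) +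
      (if M.command r = some (.b1 i r) then 1 else 0) =
      (if i = 0 then ((a : ℤ) + (M.β r).1).toNat else ((b : ℤ) + (M.β r).2).toNat) + 1 := by
  simp only [command]
  rcases M.β_mem r with h | h | h | h | h <;> simp only [h] at ha hb ⊢ <;>
    fin_cases i <;> simp at ha hb ⊢ <;> omega

/-- The jobs sent to the subnetworks perform the command of the new state. -/
theorem counter_step (M : SCM m) (p : Fin m × ℕ × ℕ) (i : Fin 2) :
    counter p i + (if M.command (M.step p).1 = some (.c41 i) then 0 else 1) +
      (if M.command (M.step p).1 = some (.b1 i (M.step p).1) then 1 else 0) =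
      counter (M.step p) i + 1 :=
  M.counter_command (M.step p).1
    (fun h => of_decide_eq_true (M.consistent₁ _ _ _ h))
    (fun h => of_decide_eq_true (M.consistent₂ _ _ _ h)) i

end SCM

namespace Setting

open SCM

variable {m : ℕ} {T : Setting m}

/-! ### The emulation -/

variable (T) in
/-- The state right after the beginning of a cycle, at the tick `B`, in which the configuration is
going to be `p`. -/
def CycleStart (B : ℕ) (p : Fin m × ℕ × ℕ) : Prop :=
  T.MainStart B p.1 ∧
    ∀ i, ∃ z e₄ e₅, T.SubStart i B z e₄ e₅ ∧ z + e₄ + e₅ = counter p i + 1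

theorem out_eq_zero_of_capacity {k : ℕ} {c : Cls m} (hc : bufferSize c = some 0)
    (ht : ticks c = 0) (h : T.inn k c = 0) : T.out k c = 0 := by
  have := T.out_le k ht
  rw [T.w_of_capacity_zero k hc, h] at this
  omega

theorem idle_s3_succ {B n : ℕ} (hB : B = 1200 * m * n) {i : Fin 2} (h : T.Idle B (.s3 i))
    (h1 : T.w B (.c31 i) = 0) (h2 : T.w B (.c32 i) = 0) : T.Idle (B + 1) (.s3 i) := by
  have hm := T.pos
  refine Free.idle_succ (Or.inl h) (forall_s3 ⟨h1, ?_⟩ ⟨h2, ?_⟩)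
  · have e1 := T.inn_c13 (o := 0) hB (by omega) i
    have e2 := T.inn_c14 (o := 0) hB (by omega) i
    have e3 := T.inn_c23 (o := 0) hB (by omega) i
    rw [if_neg (by omega), add_zero] at e1 e2 e3
    rw [inn_c31, out_eq_zero_of_capacity rfl rfl e1, out_eq_zero_of_capacity rfl rfl e2,
      out_eq_zero_of_capacity rfl rfl e3]
  · have e1 := T.inn_c32 (o := 0) hB (by omega) i
    rwa [if_neg (by omega), add_zero] at e1

theorem idle_s5_succ {B : ℕ} {i : Fin 2} (h : T.Idle B (.s5 i))
    (h1 : T.w B (.c51 i) = 0) : T.Idle (B + 1) (.s5 i) :=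
  Free.idle_succ (Or.inl h) (forall_s5 ⟨h1, T.inn_c51 B i⟩)

/-- The feeding servers at the beginning of a cycle, if the command of the state `r` is sent. -/
theorem feeds_of_command {B n : ℕ} (hB : B = 1200 * m * n) {i : Fin 2} {r : Fin m}
    (h43 : ∀ j, T.out B (.m43 j) = if j = r then 1 else 0) (h4 : T.Idle B (.s4 i))
    (hw : T.w B (.c41 i) = 0) (hb : T.Idle B (.blk i)) :
    T.Feeds4 i B (if T.M.command r = some (.c41 i) then 0 else 1) ∧
      T.Feeds5 i B (if T.M.command r = some (.b1 i r) then 1 else 0) := by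
  have hB' : B = 400 * m * (3 * n) := by rw [hB]; ring
  have hin4 : T.inn B (.c41 i) = if T.M.command r = some (.c41 i) then 1 else 0 := by
    rw [inn_c41, Finset.sum_eq_single r (fun j _ hj => by rw [h43, if_neg hj, ite_self])
      fun h => absurd (Finset.mem_univ r) h, h43, if_pos rfl]
  have hin5 : ∀ j, T.inn B (.b1 i j) =
      if T.M.command j = some (.b1 i j) then if j = r then 1 else 0 else 0 := by
    intro j
    rw [inn_b1, h43]
  constructor
  · split_ifs with hc
    · exact feeds4_zero h4 hw (by rw [hin4, if_pos hc])
    · exact feeds4_one hB' h4 hw (by rw [hin4, if_neg hc])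
  · split_ifs with hc
    · refine feeds5_one hb (j := r) (by rw [hin5, if_pos hc, if_pos rfl]) fun j hj => ?_
      rw [hin5, if_neg hj, ite_self]
    · refine feeds5_zero hB hb fun j => ?_
      rw [hin5]
      split_ifs with h1 h2
      · exact absurd (h2 ▸ h1) hc
      · rfl
      · rfl

variable (T) in
/-- The state in the middle of the first unit of a cycle, in which the configuration is `p`. -/
def Emulates (B : ℕ) (p : Fin m × ℕ × ℕ) : Prop :=
  T.MainQuiet B p.1 (B + 400 * m) ∧ T.MainQuiet B p.1 (B + 400 * m + 1) ∧
    ∀ i, (∃ σ, T.Core i (B + 400 * m) (B + 200 * m) σ ∧ load σ = counter p i) ∧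
      (∃ σ, T.Core i (B + 400 * m + 1) (B + 400 * m) σ) ∧
      (T.Idle (B + 400 * m) (.s3 i) ∧ T.Idle (B + 400 * m) (.s4 i) ∧
        T.Idle (B + 400 * m) (.s5 i) ∧ T.Idle (B + 400 * m) (.blk i))

theorem CycleStart.cycle {B n : ℕ} {p : Fin m × ℕ × ℕ} (hB : B = 1200 * m * n)
    (h : T.CycleStart B p) : T.Emulates B p ∧ T.CycleStart (B + 1200 * m) (T.M.step p) := by
  have hm := T.pos
  have hB' : B + 1200 * m = 1200 * m * (n + 1) := by rw [hB]; ring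
  obtain ⟨hmain, hsub⟩ := h
  choose z e₄ e₅ hsub hz using hsub
  have hc := fun i => (hsub i).cycle hB (hz i)
  obtain ⟨m1, m2, m3, m4⟩ := hmain.cycle (z := counter p) hB fun i => (hc i).2.2.2.1
  rw [← step_fst] at m3 m4
  refine ⟨⟨m1, m2, fun i => ⟨(hc i).1, (hc i).2.1, (hc i).2.2.1⟩⟩, m3, fun i => ?_⟩
  obtain ⟨-, -, -, -, hcore, i3, i4, i5, ib⟩ := hc i
  have hpos : 0 < B + 1200 * m := by omega
  obtain ⟨f4, f5⟩ := feeds_of_command hB' m4 i4 (w_of_idle (d := .c41 i) hpos i4) ib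
  exact ⟨counter p i, _, _, ⟨hcore, f4, f5,
    idle_s3_succ hB' i3 (w_of_idle (d := .c31 i) hpos i3) (w_of_idle (d := .c32 i) hpos i3),
    idle_s5_succ i5 (w_of_idle (d := .c51 i) hpos i5)⟩, counter_step T.M p i⟩

/-- At time zero a cycle begins. As there are no jobs of the classes `4j3` yet, a job of class `i42`
is served at the servers `i4`, as for commands which do not concern the counter. -/
theorem cycleStart_zero {s₀ : Fin m} {z : ℕ} (hq : T.q = startQueue s₀ z) :
    T.CycleStart 0 (s₀, z, 0) := by
  have hm := T.pos
  have hB : 0 = 1200 * m * 0 := rfl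
  have hidle : ∀ s, T.Idle 0 s := fun _ => rfl
  have hw : ∀ c, T.w 0 c = startQueue s₀ z c := fun c => by
    rw [← hq]; rfl
  have hout : ∀ d, ticks d ≠ 0 → T.out 0 d = 0 := fun d ht => (hidle _).out_eq_zero ht
  have o42 : ∀ j, T.out 0 (.m42 j) = 0 := fun j => out_eq_zero_of_capacity rfl rfl
    (T.inn_m42 (o := 0) hB (by omega) j)
  have o43 : ∀ j, T.out 0 (.m43 j) = 0 := fun j => out_eq_zero_of_capacity rfl rfl
    (T.inn_m43 (o := 0) hB (by omega) j)
  have o33 : ∀ i, T.out 0 (.c33 i) = 0 := fun i => out_eq_zero_of_capacity rfl rfl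
    (by have := T.inn_c33 (o := 0) hB (by omega) i; rwa [if_neg (by omega)] at this)
  have i01 : ∀ i, T.inn 0 (.m01 i) = 0 := fun i => by rw [inn_m01, o33]
  have i02 : ∀ j, T.inn 0 (.m02 j) = 0 := fun j => by rw [inn_m02, o42]
  have o03 : ∀ j, T.out 0 (.m03 j) = 0 := fun j => by
    rw [Free.out_eq (s := .m01) (Or.inl (hidle _)) (forall_m01 fun i => ⟨hw _, i01 i⟩) rfl rfl,
      inn_m03, hout _ (by simp only [ticks]; omega), hw]
    simp [startQueue]
  constructor
  · have hn : T.Next 0 (.m02 s₀) :=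
      ⟨Or.inl (hidle _), by simp only [ticks]; omega, by rw [hw]; simp [startQueue],
        forall_m02 fun h => absurd rfl h⟩
    refine ⟨hn.serves, ?_, fun j hj => ?_, ?_, Or.inl fun j s => ?_, fun j => Or.inl ?_⟩
    · rw [hn.w_self, hw, i02]
      simp [startQueue, Network.stored_zero]
    · exact Free.idle_succ (Or.inl (hidle _)) (forall_m02 ⟨by rw [hw]; simp [startQueue, hj], i02 j⟩)
    · exact Free.idle_succ (Or.inl (hidle _)) (forall_m01 fun i => ⟨hw _, i01 i⟩)
    · exact Free.idle_succ (Or.inl (hidle _)) (forall_m3 fun k l _ => ⟨hw _,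
        inn_m3_eq_zero (o03 _) fun _ _ _ => hout _ (by simp [ticks])⟩)
    · exact Free.idle_succ (Or.inl (hidle _)) (forall_m4 ⟨hw _,
        inn_m41_eq_zero (o := 0) hB (by omega) (by omega) j⟩)
  · intro i
    have c11 : T.inn 0 (.c11 i) = 0 := by
      rw [inn_c11, hout _ (by simp only [ticks]; omega), hout _ (by simp only [ticks]; omega),
        hout _ (by simp only [ticks]; omega)]
    have o11 : T.out 0 (.c11 i) = 0 := by
      have := T.out_le 0 (c := .c11 i) rfl
      rw [c11, hw] at this
      simpa [startQueue] using this
    have c21 : T.inn 0 (.c21 i) = 0 := by rw [inn_c21, o11]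
    have c22 : T.inn 0 (.c22 i) = 1 := T.inn_c22 (o := 0) (u := 0) rfl (by omega) i
    have o22 : T.out 0 (.c22 i) = 1 := by
      rw [Free.out_eq (s := .s2 i) (Or.inl (hidle _)) (forall_s2 ⟨hw _, c21⟩) rfl rfl, c22, hw]
      simp [startQueue]
    have c12 : T.inn 0 (.c12 i) = 1 := by rw [inn_c12, o22]
    have hn : T.Next 0 (.c12 i) :=
      ⟨Or.inl (hidle _), by simp only [ticks]; omega, by omega, forall_s1 fun h => absurd rfl h⟩
    have h2 : T.Idle 1 (.s2 i) := Free.idle_succ (Or.inl (hidle _)) (forall_s2 ⟨hw _, c21⟩)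
    refine ⟨counter (s₀, z, 0) i, 1, 0, ⟨⟨(true, 0, counter (s₀, z, 0) i), ⟨hn.serves, h2, ?_, ?_,
      Idle.w_eq_zero h2, Idle.w_eq_zero h2⟩, by simp [load]⟩, ?_, ?_, ?_, ?_⟩, rfl⟩
    · rw [hn.w_zero (d := .c11 i) rfl rfl, o11, c11, hw]
      rfl
    · rw [hn.w_self, c12, hw]
      change startQueue s₀ z (.c12 i) + 1 - 1 = _
      simp [startQueue, counter]
    · refine feeds4_one (u := 0) rfl (hidle _) (hw _) ?_
      rw [inn_c41]
      exact Finset.sum_eq_zero fun j _ => by rw [o43, ite_self]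
    · refine feeds5_zero (n := 0) rfl (hidle _) fun j => ?_
      rw [inn_b1, o43, ite_self]
    · exact idle_s3_succ hB (hidle _) (hw _) (hw _)
    · exact idle_s5_succ (hidle _) (hw _)

theorem cycleStart {s₀ : Fin m} {z : ℕ} (hq : T.q = startQueue s₀ z) (t : ℕ) :
    T.CycleStart (1200 * m * t) (T.M.step^[t] (s₀, z, 0)) := by
  induction t with
  | zero => exact cycleStart_zero hq
  | succ t ih =>
    rw [Function.iterate_succ_apply', mul_add, mul_one]
    exact (ih.cycle rfl).2

theorem emulates {s₀ : Fin m} {z : ℕ} (hq : T.q = startQueue s₀ z) (t : ℕ) :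
    T.Emulates (1200 * m * t) (T.M.step^[t] (s₀, z, 0)) := ((cycleStart hq t).cycle rfl).1

end Setting

namespace Network

variable {S C : Type} [Fintype C] [DecidableEq C]

/-! ### Routing matrices of acyclic networks -/

theorem Acyclic.isNilpotent_routing {N : Network S C} (h : N.Acyclic) (K : Type) [CommRing K] :
    IsNilpotent (N.routing K) := by
  obtain ⟨r, hr⟩ := h
  have key : ∀ (n : ℕ) c d, r c < r d + n → (N.routing K ^ n) c d = 0 := by
    intro n
    induction n with
    | zero =>
      intro c d hcd
      rw [pow_zero, Matrix.one_apply_ne]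
      rintro rfl
      omega
    | succ n ih =>
      intro c d hcd
      rw [pow_succ', Matrix.mul_apply]
      refine Finset.sum_eq_zero fun e _ => ?_
      by_cases he : N.next c = some e
      · rw [ih e d (by have := hr c e he; omega), mul_zero]
      · rw [show N.routing K c e = 0 from if_neg he, zero_mul]
  refine ⟨∑ c, r c + 1, Matrix.ext fun c d => key _ c d ?_⟩
  have := Finset.single_le_sum (f := r) (fun _ _ => Nat.zero_le _) (Finset.mem_univ c)
  omega

theorem Acyclic.spectralRadius_routing {N : Network S C} (h : N.Acyclic) :
    spectralRadius ℂ (N.routing ℂ) < 1 := by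
  rcases isEmpty_or_nonempty C with hC | hC
  · refine lt_of_le_of_lt (iSup₂_le fun k hk => ?_) one_pos
    exact absurd (isUnit_of_subsingleton _) hk
  obtain ⟨n, hn⟩ := h.isNilpotent_routing ℂ
  refine lt_of_le_of_lt (iSup₂_le fun k hk => ?_) one_pos
  have h1 := spectrum.pow_mem_pow (N.routing ℂ) n hk
  rw [hn, spectrum.zero_eq] at h1
  have h2 : k = 0 := by
    by_contra hne
    exact pow_ne_zero n hne h1
  simp [h2]

theorem Acyclic.isUnit_one_sub_routing {N : Network S C} (h : N.Acyclic) :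
    IsUnit (1 - (N.routing ℚ).transpose).det := by
  refine (Matrix.isUnit_iff_isUnit_det _).1 (IsNilpotent.isUnit_one_sub ?_)
  obtain ⟨n, hn⟩ := h.isNilpotent_routing ℚ
  exact ⟨n, by rw [← Matrix.transpose_pow, hn, Matrix.transpose_zero]⟩

theorem one_sub_routing_mulVec (N : Network S C) (v : C → ℚ) (c : C) :
    (1 - (N.routing ℚ).transpose).mulVec v c = v c - ∑ d, if N.next d = some c then v d else 0 := by
  rw [Matrix.sub_mulVec, Matrix.one_mulVec, Pi.sub_apply]
  congr 1
  refine Finset.sum_congr rfl fun d _ => ?_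
  simp [routing]

/-- The total arrival rates of an acyclic network, from a solution of the traffic equation. -/
theorem Acyclic.totalRate_eq {N : Network S C} (h : N.Acyclic) {v : C → ℚ}
    (hv : ∀ c, v c = N.externalRate c + ∑ d, if N.next d = some c then v d else 0) :
    N.totalRate = v := by
  have h1 : (1 - (N.routing ℚ).transpose).mulVec v = N.externalRate := funext fun c => by
    rw [one_sub_routing_mulVec, sub_eq_iff_eq_add, ← hv]
  rw [totalRate, ← h1, Matrix.mulVec_mulVec, Matrix.nonsing_inv_mul _ h.isUnit_one_sub_routing,
    Matrix.one_mulVec]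

theorem Acyclic.totalRate_apply {N : Network S C} (h : N.Acyclic) (c : C) :
    N.totalRate c = N.externalRate c + ∑ d, if N.next d = some c then N.totalRate d else 0 := by
  rw [← sub_eq_iff_eq_add, ← one_sub_routing_mulVec, totalRate, Matrix.mulVec_mulVec,
    Matrix.mul_nonsing_inv _ h.isUnit_one_sub_routing, Matrix.one_mulVec]

end Network

namespace SCM

variable {m : ℕ}

/-! ### The load factors -/

/-- Three times the total arrival rates. -/
def rate (M : SCM m) : Cls m → ℕ
  | .c11 _ | .c21 _ => 4
  | .c12 _ | .c22 _ | .c42 _ | .c31 _ => 3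
  | .c41 i => ∑ j, if M.command j = some (.c41 i) then 1 else 0
  | .b1 i j => if M.command j = some (.b1 i j) then 1 else 0
  | .c51 _ => 0
  | _ => 1

/-- Three times the external arrival rates. -/
def outerRate : Cls m → ℕ
  | .c22 _ | .c42 _ => 3
  | .c13 _ | .c14 _ | .c23 _ | .c32 _ | .c33 _ | .b2 _ | .b3 _ | .m42 _ | .m43 _ => 1
  | .m35 _ s => if (s : ℕ) = 0 then 1 else 0
  | _ => 0

theorem externalRate_eq (M : SCM m) (c : Cls m) :
    M.network.externalRate c = (outerRate c : ℚ) / 3 := by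
  cases c <;> simp [Network.externalRate, network, arrivalData, outerRate]
  split_ifs <;> simp

theorem rate_eq (M : SCM m) (c : Cls m) :
    M.rate c = outerRate c + M.network.routed M.rate c := by
  have first : ∀ (j : Fin m) (h0 : 0 < 4 * m),
      M.rate (.m3 j 0 ⟨0, h0⟩) = outerRate (.m3 j 0 ⟨0, h0⟩ : Cls m) +
        M.network.routed M.rate (.m3 j 0 ⟨0, h0⟩) := fun j h0 => by
    rw [routed_m3_first]; rfl
  cases c
  case c11 => rw [routed_c11]; rfl
  case c12 => rw [routed_c12]; rfl
  case c21 => rw [routed_c21]; rfl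
  case c31 => rw [routed_c31]; rfl
  case c41 => rw [routed_c41]; simp [rate, outerRate]
  case b1 => rw [routed_b1]; simp [rate, outerRate]
  case m01 => rw [routed_m01]; rfl
  case m02 => rw [routed_m02]; rfl
  case m03 => rw [routed_m03]; rfl
  case m41 j =>
    have hm : 0 < 4 * m := Nat.mul_pos (by norm_num) j.pos
    rw [routed_m41 _ _ _ (s := ⟨4 * m - 1, by omega⟩) (by simp only; omega)]
    rfl
  case m3 k l s =>
    rcases Nat.eq_zero_or_pos (4 * m * l + (s : ℕ)) with hp | hp
    · obtain ⟨h1, h2⟩ := Setting.stage_eq (l := l) (s := s) (l' := 0) (s' := ⟨0, s.pos⟩)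
        (by simpa using hp)
      rw [h1, h2]
      exact first k s.pos
    · have hlt := stage_lt l s
      obtain ⟨l', s', hl⟩ := Setting.exists_stage (m := m) (p := 4 * m * l + (s : ℕ) - 1) (by omega)
      rw [routed_m3_next _ _ _ (l := l') (s := s') (by omega)]
      rfl
  case m35 j s =>
    rcases Nat.eq_zero_or_pos (s : ℕ) with h0 | h0
    · rw [routed_entry _ _ (show (s : ℕ) = 0 from h0)]
      simp [rate, outerRate, h0]
    · rw [routed_m35_next _ _ _ (s := ⟨s - 1, by omega⟩) (by simp only; omega)]
      simp [rate, outerRate, h0.ne']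
  all_goals
    rw [routed_entry _ _ trivial]
    rfl

theorem totalRate_eq (M : SCM m) (c : Cls m) : M.network.totalRate c = (M.rate c : ℚ) / 3 := by
  refine congrFun (M.acyclic.totalRate_eq (v := fun c => (M.rate c : ℚ) / 3) fun c => ?_) c
  rw [M.externalRate_eq, M.rate_eq c, Network.routed]
  push_cast
  rw [add_div, Finset.sum_div]
  congr 1
  refine Finset.sum_congr rfl fun d _ => ?_
  split_ifs <;> simp

end SCM

namespace Setting

open SCM

variable {m : ℕ} {T : Setting m}

/-- Only classes with positive service times contribute to the load. -/
theorem load_le {s : Srv m} (t : Finset (Cls m))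
    (ht : ∀ d, T.M.serverOf d = s → ticks d ≠ 0 → d ∈ t) :
    T.M.network.load s ≤ ∑ c ∈ t, (T.M.rate c : ℚ) / 3 * serviceTime c := by
  have h0 : ∀ c : Cls m, (0 : ℚ) ≤ serviceTime c := fun c => by
    rw [serviceTime_eq T.pos]; positivity
  unfold Network.load
  rw [← Finset.sum_filter_ne_zero]
  have h1 : ∀ c, T.M.network.totalRate c * T.M.network.service c =
      (T.M.rate c : ℚ) / 3 * serviceTime c := fun c => by rw [T.M.totalRate_eq]; rfl
  simp only [h1]
  refine Finset.sum_le_sum_of_subset_of_nonneg (fun c hc => ?_)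
    fun c _ _ => mul_nonneg (by positivity) (h0 c)
  rw [Finset.mem_filter, Finset.mem_filter] at hc
  refine ht c hc.1.2 ?_
  rw [← T.service_ne_iff]
  exact (mul_ne_zero_iff.1 hc.2).2

theorem load_lt_one (s : Srv m) : T.M.network.load s < 1 := by
  have hm := T.pos
  have hmQ : (0 : ℚ) < m := by exact_mod_cast hm
  -- the service times with denominator `m` compensate for the number of classes which
  -- can feed a server
  have hcard : ∀ f : Fin m → ℕ, (∀ j, f j ≤ 1) → ((∑ j, f j : ℕ) : ℚ) ≤ m := by
    intro f hf
    have : ∑ j, f j ≤ ∑ _j : Fin m, 1 := Finset.sum_le_sum fun j _ => hf j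
    simp only [Finset.sum_const, Finset.card_univ, Fintype.card_fin, smul_eq_mul, mul_one] at this
    exact_mod_cast this
  have ite_le : ∀ (P : Prop) [Decidable P], (if P then 1 else 0 : ℕ) ≤ 1 := fun P _ => by
    split_ifs <;> omega
  cases s with
  | s1 i =>
    refine (load_le {.c12 i} (forall_s1 (by simp))).trans_lt ?_
    simp [rate, serviceTime]; norm_num
  | s2 i =>
    refine (load_le {.c21 i} (forall_s2 (by simp))).trans_lt ?_
    simp [rate, serviceTime]; norm_num
  | s3 i =>
    refine (load_le {.c31 i, .c32 i} (forall_s3 (by simp) (by simp))).trans_lt ?_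
    rw [Finset.sum_pair (by simp)]
    simp [rate, serviceTime]; norm_num
  | s4 i =>
    refine (load_le {.c41 i, .c42 i} (forall_s4 (by simp) (by simp))).trans_lt ?_
    rw [Finset.sum_pair (by simp)]
    have h1 := hcard (fun j => if T.M.command j = some (.c41 i) then 1 else 0) fun j => ite_le _
    have h2 : ((∑ j, if T.M.command j = some (.c41 i) then 1 else 0 : ℕ) : ℚ) / 3 * (0.2 / m) ≤
        0.2 / 3 := by
      rw [div_mul_div_comm, div_le_div_iff₀ (by positivity) (by positivity)]
      nlinarith
    simp only [rate, serviceTime]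
    refine (add_le_add_left h2 _).trans_lt ?_
    norm_num
  | s5 i =>
    refine (load_le {.c51 i} (forall_s5 (by simp))).trans_lt ?_
    simp [rate]
  | blk i =>
    refine (load_le ({.b2 i, .b3 i} ∪ Finset.univ.image fun j => .b1 i j)
      (forall_blk (by simp) (by simp) (by simp))).trans_lt ?_
    rw [Finset.sum_union (by
      rw [Finset.disjoint_left]
      intro a ha hb
      obtain ⟨j, -, rfl⟩ := Finset.mem_image.1 hb
      simp at ha), Finset.sum_pair (by simp), Finset.sum_image (by
      intro a _ b _ h
      simpa using h)]
    have h1 := hcard (fun j => T.M.rate (.b1 i j)) fun j => ite_le _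
    have h2 : ∑ j, (T.M.rate (.b1 i j) : ℚ) / 3 * serviceTime (.b1 i j) ≤ 0.005 / 3 := by
      simp only [serviceTime]
      rw [← Finset.sum_mul, ← Finset.sum_div, div_mul_div_comm,
        div_le_div_iff₀ (by positivity) (by positivity)]
      push_cast at h1
      nlinarith
    refine (add_le_add_right h2 _).trans_lt ?_
    simp [rate, serviceTime]; norm_num
  | m01 =>
    refine (load_le {.m01 0, .m01 1} (forall_m01 (by
      intro i; fin_cases i <;> simp))).trans_lt ?_
    rw [Finset.sum_pair (by simp)]
    simp [rate, serviceTime]; norm_num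
  | m02 j =>
    refine (load_le {.m02 j} (forall_m02 (by simp))).trans_lt ?_
    simp [rate, serviceTime]; norm_num
  | m3 j s =>
    refine (load_le (Finset.univ.image fun p : Fin m × Fin 4 => .m3 p.1 p.2 s)
      (forall_m3 fun k l _ => Finset.mem_image.2 ⟨(k, l), Finset.mem_univ _, rfl⟩)).trans_lt ?_
    rw [Finset.sum_image (by
      intro a _ b _ h
      simp only [Cls.m3.injEq, and_true] at h
      exact Prod.ext h.1 h.2)]
    simp only [rate, serviceTime, Finset.sum_const, Finset.card_univ, Fintype.card_prod,
      Fintype.card_fin, nsmul_eq_mul]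
    push_cast
    have h1 : (m : ℚ) * 4 * (1 / 3 * (0.09 / (4 * m))) = 0.03 := by
      field_simp
      norm_num
    rw [h1]
    norm_num
  | m4 j =>
    refine (load_le {.m41 j} (forall_m4 (by simp))).trans_lt ?_
    simp [rate, serviceTime]; norm_num

theorem valid : T.M.network.Valid := by
  have hG := T.M.onGrid T.pos
  refine ⟨hG.interarrival_pos, fun c => ?_, fun c => ?_, T.M.acyclic.spectralRadius_routing⟩
  · change 0 ≤ ((arrivalData c).map Prod.snd).getD 0
    cases c <;> simp [arrivalData] <;> try split_ifs
    all_goals norm_num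
  · change 0 ≤ serviceTime c
    rw [serviceTime_eq T.pos]; positivity

end Setting

namespace Setting

open SCM

variable {m : ℕ} {T : Setting m}

/-! ### The configuration of the machine in the network -/

theorem queueLength_of_idle {k : ℕ} (hk : 0 < k) {c : Cls m} (h : T.Idle k (T.M.serverOf c)) :
    T.M.network.queueLength (T.X k) c = 0 := by
  have h1 : T.w k c = 0 := w_of_idle hk h
  have h2 : (T.X k).serving (T.M.network.server c) = none := h
  unfold Network.queueLength
  rw [h2]
  change T.w k c + _ = 0
  simp [h1]

theorem queueLength_of_serves_other {k h : ℕ} {c d : Cls m} (hs : T.Serves k c h)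
    (hd : T.M.serverOf d = T.M.serverOf c) (hne : c ≠ d) :
    T.M.network.queueLength (T.X k) d = T.w k d := by
  have h2 : (T.X k).serving (T.M.network.server d) = some (c, time m h) := by
    rw [show T.M.network.server d = _ from hd]; exact hs
  unfold Network.queueLength
  rw [h2]
  change T.w k d + _ = _
  simp [hne]

theorem queueLength_of_serves {k h : ℕ} {c : Cls m} (hs : T.Serves k c h) :
    T.M.network.queueLength (T.X k) c = T.w k c + 1 := by
  have h2 : (T.X k).serving (T.M.network.server c) = some (c, time m h) := hs
  unfold Network.queueLength
  rw [h2]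
  change T.w k c + _ = _
  simp

theorem queueLength_le (k : ℕ) (c : Cls m) : T.M.network.queueLength (T.X k) c ≤ T.w k c + 1 := by
  unfold Network.queueLength
  refine Nat.add_le_add_left ?_ _
  split_ifs <;> omega

theorem MainQuiet.queueLength {B k : ℕ} {q : Fin m} (h : T.MainQuiet B q k) (hk : 0 < k)
    {c : Cls m} (hc : subnetwork c = none) :
    T.M.network.queueLength (T.X k) c = if c = .m02 q then 1 else 0 := by
  cases c <;> simp [subnetwork] at hc
  case m02 j =>
    by_cases hj : j = q
    · subst hj
      rw [queueLength_of_serves h.serves, h.w_m02, if_pos rfl]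
    · rw [queueLength_of_idle hk (h.idle_m02 j hj), if_neg (by simpa using hj)]
  all_goals rw [if_neg (by simp)]
  case m01 | m03 => exact queueLength_of_idle hk h.idle_m01
  case m3 | m35 => exact queueLength_of_idle hk (h.idle_m3 _ _)
  all_goals exact queueLength_of_idle hk (h.idle_m4 _)

theorem Core.queueLength_mul {i : Fin 2} {k h : ℕ} {σ : Bool × ℕ × ℕ} (hσ : T.Core i k h σ)
    (hk : 0 < k) : T.M.network.queueLength (T.X k) (.c12 i) *
      T.M.network.queueLength (T.X k) (.c21 i) = 0 := by
  obtain ⟨μ, a, b⟩ := σ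
  cases μ
  · rw [queueLength_of_idle (c := .c12 i) hk hσ.2.1, zero_mul]
  · rw [queueLength_of_idle (c := .c21 i) hk hσ.2.1, mul_zero]

/-- In the middle of a time unit the service in progress has just ended. -/
theorem Core.work {i : Fin 2} {k h : ℕ} {σ : Bool × ℕ × ℕ} (hσ : T.Core i k h σ) (hk : 0 < k)
    (hh : h + 200 * m = k) :
    2 * (T.M.network.work (T.X k) (time m k) (.c12 i) +
      T.M.network.work (T.X k) (time m k) (.c21 i) +
      0.5 * T.M.network.queueLength (T.X k) (.c22 i) +
      0.5 * T.M.network.queueLength (T.X k) (.c11 i)) = load σ := by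
  obtain ⟨μ, a, b⟩ := σ
  have idle : ∀ c : Cls m, T.Idle k (T.M.serverOf c) →
      T.M.network.work (T.X k) (time m k) c = 0 := by
    intro c hc
    have h1 : (T.X k).waiting c = 0 := w_of_idle hk hc
    have h2 : (T.X k).serving (T.M.network.server c) = none := hc
    simp [Network.work, h1, h2]
  have serves : ∀ c : Cls m, T.Serves k c h → ticks c = 200 * m → serviceTime c = 0.5 →
      T.M.network.work (T.X k) (time m k) c = 0.5 * T.w k c := by
    intro c hc ht hs
    have h2 : (T.X k).serving (T.M.network.server c) = some (c, time m h) := hc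
    have h3 := (T.time_add_eq_iff h k c).2 (by rw [ht]; exact hh)
    simp only [Network.work, h2, if_true, h3, sub_self, add_zero]
    change serviceTime c * (T.w k c : ℚ) = _
    rw [hs]
  cases μ
  · obtain ⟨h1, h2, h3, h4, h5, h6⟩ := hσ
    rw [idle (.c12 i) h2, serves (.c21 i) h1 rfl rfl, queueLength_of_idle (c := .c11 i) hk h2,
      queueLength_of_serves_other (d := .c22 i) h1 rfl (by simp), h3, h4]
    simp only [load]
    push_cast
    ring
  · obtain ⟨h1, h2, h3, h4, h5, h6⟩ := hσ
    rw [idle (.c21 i) h2, serves (.c12 i) h1 rfl rfl, queueLength_of_idle (c := .c22 i) hk h2,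
      queueLength_of_serves_other (d := .c11 i) h1 rfl (by simp), h3, h4]
    simp only [load]
    push_cast
    ring

theorem Emulates.queueLength_eq_zero {B : ℕ} {p : Fin m × ℕ × ℕ} (h : T.Emulates B p) {i : Fin 2}
    {c : Cls m} (hc : subnetwork c = some i) (h1 : c ≠ .c11 i) (h2 : c ≠ .c12 i) (h3 : c ≠ .c21 i)
    (h4 : c ≠ .c22 i) : T.M.network.queueLength (T.X (B + 400 * m)) c = 0 := by
  have hm := T.pos
  have hk : 0 < B + 400 * m := by omega
  obtain ⟨-, -, hi⟩ := h
  obtain ⟨⟨⟨μ, a, b⟩, hσ, -⟩, -, i3, i4, i5, ib⟩ := hi i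
  have cap : ∀ c : Cls m, bufferSize c = some 0 →
      (T.M.serverOf c = .s1 i ∧ c ≠ .c12 i ∨ T.M.serverOf c = .s2 i ∧ c ≠ .c21 i) →
      T.M.network.queueLength (T.X (B + 400 * m)) c = 0 := by
    intro c hc hs
    have hw := T.w_of_capacity_zero (B + 400 * m) hc
    rcases hs with ⟨hs, hne⟩ | ⟨hs, hne⟩ <;> cases μ
    · exact queueLength_of_idle hk (by rw [hs]; exact hσ.2.1)
    · rw [queueLength_of_serves_other hσ.1 hs (Ne.symm hne), hw]
    · rw [queueLength_of_serves_other hσ.1 hs (Ne.symm hne), hw]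
    · exact queueLength_of_idle hk (by rw [hs]; exact hσ.2.1)
  cases c <;> simp [subnetwork] at hc <;> subst hc
  case c11 => exact absurd rfl h1
  case c12 => exact absurd rfl h2
  case c21 => exact absurd rfl h3
  case c22 => exact absurd rfl h4
  case c13 | c14 => exact cap _ rfl (Or.inl ⟨rfl, by simp⟩)
  case c23 => exact cap _ rfl (Or.inr ⟨rfl, by simp⟩)
  case c31 | c32 | c33 => exact queueLength_of_idle hk i3
  case c41 | c42 => exact queueLength_of_idle hk i4
  case c51 => exact queueLength_of_idle hk i5
  all_goals exact queueLength_of_idle hk ib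

theorem Core.w_le {i : Fin 2} {k h : ℕ} {σ : Bool × ℕ × ℕ} (hσ : T.Core i k h σ) :
    T.w k (.c11 i) ≤ load σ ∧ T.w k (.c12 i) ≤ load σ ∧ T.w k (.c21 i) ≤ load σ ∧
      T.w k (.c22 i) ≤ load σ := by
  obtain ⟨μ, a, b⟩ := σ
  cases μ <;> obtain ⟨-, -, h3, h4, h5, h6⟩ := hσ <;> simp only [load] <;> omega

theorem Core.load_le {i : Fin 2} {k h : ℕ} {σ : Bool × ℕ × ℕ} (hσ : T.Core i k h σ) :
    load σ ≤ T.w k (.c11 i) + T.w k (.c12 i) + T.w k (.c21 i) + T.w k (.c22 i) := by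
  obtain ⟨μ, a, b⟩ := σ
  cases μ <;> obtain ⟨-, -, h3, h4, h5, h6⟩ := hσ <;> simp only [load] <;> omega

theorem w_le_queueLength (k : ℕ) (c : Cls m) : T.w k c ≤ T.M.network.queueLength (T.X k) c :=
  Nat.le_add_right _ _

theorem Emulates.queueLength_le {B Z : ℕ} {p : Fin m × ℕ × ℕ} (h : T.Emulates B p)
    (hZ : ∀ i, counter p i ≤ Z) (c : Cls m) :
    T.M.network.queueLength (T.X (B + 400 * m)) c ≤ Z + 1 := by
  have hm := T.pos
  cases hc : subnetwork c with
  | none =>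
    rw [h.1.queueLength (by omega) hc]
    split_ifs <;> omega
  | some i =>
    obtain ⟨σ, hσ, hl⟩ := (h.2.2 i).1
    obtain ⟨a1, a2, a3, a4⟩ := hσ.w_le
    have hz := hZ i
    by_cases h1 : c = .c11 i
    · rw [h1]; have := T.queueLength_le (B + 400 * m) (.c11 i); omega
    by_cases h2 : c = .c12 i
    · rw [h2]; have := T.queueLength_le (B + 400 * m) (.c12 i); omega
    by_cases h3 : c = .c21 i
    · rw [h3]; have := T.queueLength_le (B + 400 * m) (.c21 i); omega
    by_cases h4 : c = .c22 i
    · rw [h4]; have := T.queueLength_le (B + 400 * m) (.c22 i); omega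
    rw [h.queueLength_eq_zero hc h1 h2 h3 h4]
    omega

/-! ### Stability -/

theorem sum_queueLength_add_le (a b : ℕ) :
    ∑ c, T.M.network.queueLength (T.X (a + b)) c ≤
      ∑ c, T.M.network.queueLength (T.X a) c + b * Fintype.card (Cls m) := by
  induction b with
  | zero => simp
  | succ b ih =>
    have h1 := T.M.network.sum_queueLength_instant_le T.θ (time m (a + b)) (T.X (a + b))
    rw [← T.X_succ] at h1
    rw [← add_assoc, add_one_mul]
    omega

/-- The network is stable if and only if the counters of the machine stay bounded. -/
theorem stable_iff {s₀ : Fin m} {z : ℕ} (hq : T.q = startQueue s₀ z) :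
    T.M.network.Stable T.θ T.q ↔ ∃ Z, ∀ t i, counter (T.M.step^[t] (s₀, z, 0)) i ≤ Z := by
  have hm := T.pos
  rw [T.M.network.stable_iff_gridState (T.M.onGrid T.pos) T.M.acyclic]
  change (∃ B, ∀ k, ∑ c, T.M.network.queueLength (T.X (k + 1)) c ≤ B) ↔ _
  constructor
  · rintro ⟨Z, hZ⟩
    refine ⟨4 * Z, fun t i => ?_⟩
    obtain ⟨σ, hσ, hl⟩ := ((emulates hq t).2.2 i).1
    have h1 := hσ.load_le
    obtain ⟨k, hk⟩ : ∃ k, 1200 * m * t + 400 * m = k + 1 := ⟨1200 * m * t + 400 * m - 1, by omega⟩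
    rw [hk] at h1
    have h2 : ∀ c, T.w (k + 1) c ≤ Z := fun c =>
      (w_le_queueLength _ c).trans ((Finset.single_le_sum
        (f := fun c => T.M.network.queueLength (T.X (k + 1)) c)
        (fun _ _ => Nat.zero_le _) (Finset.mem_univ c)).trans (hZ k))
    have a1 := h2 (.c11 i)
    have a2 := h2 (.c12 i)
    have a3 := h2 (.c21 i)
    have a4 := h2 (.c22 i)
    omega
  · rintro ⟨Z, hZ⟩
    set N := Fintype.card (Cls m) with hN
    set F := fun k => ∑ c, T.M.network.queueLength (T.X k) c with hF
    have h1 : ∀ t, F (1200 * m * t + 400 * m) ≤ N * (Z + 1) := by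
      intro t
      refine (Finset.sum_le_sum fun c _ => (emulates hq t).queueLength_le (hZ t) c).trans ?_
      rw [Finset.sum_const, smul_eq_mul]
      rfl
    refine ⟨F 0 + N * (Z + 1) + 1200 * m * N, fun k => ?_⟩
    rcases Nat.lt_or_ge (k + 1) (400 * m) with hlt | hge
    · have h2 := sum_queueLength_add_le (T := T) 0 (k + 1)
      have h3 : (k + 1) * N ≤ 1200 * m * N := Nat.mul_le_mul_right _ (by omega)
      rw [zero_add] at h2
      change F (k + 1) ≤ F 0 + (k + 1) * N at h2
      change F (k + 1) ≤ _
      omega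
    · set o := (k + 1 - 400 * m) % (1200 * m) with ho
      have h4 : k + 1 = 1200 * m * ((k + 1 - 400 * m) / (1200 * m)) + 400 * m + o := by
        have := Nat.div_add_mod (k + 1 - 400 * m) (1200 * m)
        omega
      have h5 : o < 1200 * m := Nat.mod_lt _ (by omega)
      have h2 := sum_queueLength_add_le (T := T)
        (1200 * m * ((k + 1 - 400 * m) / (1200 * m)) + 400 * m) o
      rw [← h4] at h2
      have h3 : o * N ≤ 1200 * m * N := Nat.mul_le_mul_right _ (by omega)
      have h6 := h1 ((k + 1 - 400 * m) / (1200 * m))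
      change F (k + 1) ≤ F _ + o * N at h2
      change F (k + 1) ≤ _
      omega

end Setting

namespace SCM

variable {m : ℕ}

/-! ### The network started with empty counters -/

/-- The network of the machine with the given policy, started with one job in class `02j`, where
`j` is the initial state, and with `z` jobs in class `112`. -/
def setting (M : SCM m) (s₀ : Fin m) (z : ℕ) (θ : Cls m → ℕ) (h1 : M.network.IsPolicy θ)
    (h2 : M.RespectsLevels θ) : Setting m where
  M := M
  θ := θ
  q := startQueue s₀ z
  policy := h1
  levels := h2
  pos := s₀.pos
  zero c hc := by cases c <;> simp [startQueue, bufferSize] at hc ⊢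

variable (M : SCM m) (s₀ : Fin m) {θ : Cls m → ℕ} (h1 : M.network.IsPolicy θ)
  (h2 : M.RespectsLevels θ)

include h1 h2

theorem stateAt_succ (t : ℕ) : M.network.stateAt θ (initialQueue s₀) ((3 * t + 1 : ℕ) : ℝ) =
    (M.setting s₀ 0 θ h1 h2).X (1200 * m * t + 400 * m + 1) := by
  rw [M.network.stateAt_natCast (M.onGrid s₀.pos) M.acyclic, ← startQueue_zero]
  change M.network.gridState _ _ _ _ = M.network.gridState _ _ _ _
  congr 1
  ring

theorem stateBefore_succ (t : ℕ) :
    M.network.stateBefore θ (initialQueue s₀) ((3 * t + 1 : ℕ) : ℝ) =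
      (M.setting s₀ 0 θ h1 h2).X (1200 * m * t + 400 * m) := by
  rw [M.network.stateBefore_natCast (M.onGrid s₀.pos) M.acyclic _ _ (Nat.succ_pos _),
    ← startQueue_zero]
  change M.network.gridState _ _ _ _ = M.network.gridState _ _ _ _
  congr 1
  change (3 * t + 1) * (400 * m) = _
  ring

theorem mainStatus (t : ℕ) : M.MainStatus θ s₀ (3 * t) (M.config s₀ t).1 := by
  have hm := s₀.pos
  have hq := (Setting.emulates (T := M.setting s₀ 0 θ h1 h2) rfl t).2.1
  unfold MainStatus
  rw [show (((3 * t : ℕ) : ℝ) + 1) = ((3 * t + 1 : ℕ) : ℝ) by push_cast; ring,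
    M.stateAt_succ s₀ h1 h2]
  refine ⟨?_, fun c hc => hq.queueLength (Nat.succ_pos _) hc⟩
  have h3 : Setting.time m (1200 * m * t) = ((3 * t : ℕ) : ℚ) := by
    have : (m : ℚ) ≠ 0 := by exact_mod_cast hm.ne'
    unfold Setting.time
    push_cast
    field_simp
    ring
  rw [← h3]
  exact hq.serves

theorem counterStatus (t : ℕ) (i : Fin 2) :
    M.CounterStatus θ s₀ i (3 * t + 1) (counter (M.config s₀ t) i) := by
  have hm := s₀.pos
  have hE := Setting.emulates (T := M.setting s₀ 0 θ h1 h2) rfl t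
  obtain ⟨⟨σ, hσ, hl⟩, ⟨τ, hτ⟩, -⟩ := hE.2.2 i
  have hk : 0 < 1200 * m * t + 400 * m := by omega
  unfold CounterStatus workloadBefore
  rw [M.stateAt_succ s₀ h1 h2, M.stateBefore_succ s₀ h1 h2]
  refine ⟨hτ.queueLength_mul (Nat.succ_pos _), fun c hc a1 a2 a3 a4 =>
    hE.queueLength_eq_zero hc a1 a2 a3 a4, ?_⟩
  have h3 : Setting.time m (1200 * m * t + 400 * m) = ((3 * t + 1 : ℕ) : ℚ) := by
    have : (m : ℚ) ≠ 0 := by exact_mod_cast hm.ne'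
    unfold Setting.time
    push_cast
    field_simp
    ring
  have h4 := hσ.work hk (by omega)
  rw [h3, hl] at h4
  exact h4

theorem stable_network_iff : M.network.Stable θ (initialQueue s₀) ↔ M.Stable s₀ := by
  have h3 := Setting.stable_iff (T := M.setting s₀ 0 θ h1 h2) (s₀ := s₀) (z := 0) rfl
  change M.network.Stable θ (startQueue s₀ 0) ↔ _ at h3
  rw [← startQueue_zero, h3]
  constructor
  · rintro ⟨Z, hZ⟩
    refine ⟨⟨Z, ?_⟩, ⟨Z, ?_⟩⟩
    · rintro _ ⟨t, rfl⟩
      exact hZ t 0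
    · rintro _ ⟨t, rfl⟩
      exact hZ t 1
  · rintro ⟨⟨Z₁, hZ₁⟩, ⟨Z₂, hZ₂⟩⟩
    refine ⟨Z₁ + Z₂, fun t i => ?_⟩
    have a1 : (M.config s₀ t).2.1 ≤ Z₁ := hZ₁ ⟨t, rfl⟩
    have a2 : (M.config s₀ t).2.2 ≤ Z₂ := hZ₂ ⟨t, rfl⟩
    change counter (M.config s₀ t) i ≤ _
    unfold counter
    split_ifs <;> omega

end SCM

/-! ### Programs for registers -/

/-- Programs acting on registers with values in `ℕ`. The program `rep r p` is the loop "while the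
register `r` is positive, decrease it and execute `p`". -/
inductive Program : Type
  | skip
  | inc (r : ℕ)
  | seq (p q : Program)
  | rep (r : ℕ) (p : Program)
  deriving DecidableEq

namespace Program

open Function

/-- The effect of a program, in which no loop `rep r p` modifies the register `r` in its body. -/
def run : Program → (ℕ → ℕ) → ℕ → ℕ
  | skip, ρ => ρ
  | inc r, ρ => update ρ r (ρ r + 1)
  | seq p q, ρ => q.run (p.run ρ)
  | rep r p, ρ => (fun σ => p.run (update σ r (σ r - 1)))^[ρ r] ρ

/-- The register `r` does not occur in the program. -/
def Avoids (r : ℕ) : Program → Prop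
  | skip => True
  | inc r' => r' ≠ r
  | seq p q => p.Avoids r ∧ q.Avoids r
  | rep r' p => r' ≠ r ∧ p.Avoids r

/-- In no loop `rep r p` does the register `r` occur in the body. -/
def Proper : Program → Prop
  | skip => True
  | inc _ => True
  | seq p q => p.Proper ∧ q.Proper
  | rep r p => p.Avoids r ∧ p.Proper

theorem Avoids.run_eq {r : ℕ} : ∀ {p : Program} (_ : p.Avoids r) (ρ : ℕ → ℕ), p.run ρ r = ρ r
  | skip, _, _ => rfl
  | inc _, h, _ => update_of_ne (Ne.symm h) _ _
  | seq _ _, h, ρ => by rw [run, h.2.run_eq, h.1.run_eq]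
  | rep r' p, h, ρ => by
    have key : ∀ n (ρ : ℕ → ℕ), (fun σ => p.run (update σ r' (σ r' - 1)))^[n] ρ r = ρ r := by
      intro n
      induction n with
      | zero => exact fun _ => rfl
      | succ n ih =>
        intro ρ
        rw [iterate_succ_apply, ih, h.2.run_eq, update_of_ne (Ne.symm h.1)]
    exact key _ ρ

theorem run_rep_zero {r : ℕ} {ρ : ℕ → ℕ} (p : Program) (h : ρ r = 0) : (rep r p).run ρ = ρ := by
  rw [run, h]; rfl

theorem run_rep_succ {r n : ℕ} {p : Program} {ρ : ℕ → ℕ} (hp : p.Avoids r) (h : ρ r = n + 1) :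
    (rep r p).run ρ = (rep r p).run (p.run (update ρ r n)) := by
  rw [run, run, hp.run_eq, h, update_self, iterate_succ_apply, h, Nat.add_sub_cancel]

theorem run_clear (r : ℕ) (ρ : ℕ → ℕ) : (rep r skip).run ρ = update ρ r 0 := by
  induction h : ρ r generalizing ρ with
  | zero => rw [run_rep_zero _ h, ← h, update_eq_self]
  | succ n ih =>
    rw [run_rep_succ (p := skip) trivial h]
    change (rep r skip).run (update ρ r n) = _
    rw [ih _ (update_self _ _ _), update_idem]

theorem run_move {a b : ℕ} (hab : a ≠ b) (ρ : ℕ → ℕ) :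
    (rep a (inc b)).run ρ = update (update ρ b (ρ b + ρ a)) a 0 := by
  induction h : ρ a generalizing ρ with
  | zero =>
    rw [run_rep_zero _ h, add_zero, update_eq_self, ← h, update_eq_self]
  | succ n ih =>
    rw [run_rep_succ (p := inc b) (Ne.symm hab) h, ih _ (by simp [run, hab])]
    funext r
    by_cases h1 : r = a
    · simp [h1]
    · by_cases h2 : r = b
      · subst h2
        simp [run, h1]; omega
      · simp [run, h1, h2]

/-- The program adding the register `a` to the register `b`, by means of the register `t`. -/
def copy (a b t : ℕ) : Program := seq (rep a (seq (inc b) (inc t))) (rep t (inc a))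

theorem run_copy {a b t : ℕ} (hab : a ≠ b) (hat : a ≠ t) (hbt : b ≠ t) {ρ : ℕ → ℕ} (ht : ρ t = 0) :
    (copy a b t).run ρ = update ρ b (ρ b + ρ a) := by
  have key : ∀ n (ρ : ℕ → ℕ), ρ a = n → (rep a (seq (inc b) (inc t))).run ρ =
      update (update (update ρ b (ρ b + n)) t (ρ t + n)) a 0 := by
    intro n
    induction n with
    | zero =>
      intro ρ h
      rw [run_rep_zero _ h, add_zero, add_zero, update_eq_self, update_eq_self, ← h, update_eq_self]
    | succ n ih =>
      intro ρ h
      rw [run_rep_succ (p := seq (inc b) (inc t)) ⟨Ne.symm hab, Ne.symm hat⟩ h,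
        ih _ (by simp [run, hab, hat])]
      funext r
      by_cases h1 : r = a
      · simp [h1]
      · by_cases h2 : r = b
        · subst h2
          simp [run, h1, hbt, hbt.symm]; omega
        · by_cases h3 : r = t
          · subst h3
            simp [run, h1, h2]; omega
          · simp [run, h1, h2, h3]
  rw [copy, run, key _ ρ rfl, run_move (Ne.symm hat)]
  funext r
  by_cases h1 : r = a
  · subst h1
    rw [update_of_ne hat, update_self, update_of_ne hab]
    simp [hat.symm, ht]
  · by_cases h2 : r = b
    · subst h2
      simp [h1, hbt]
    · by_cases h3 : r = t
      · subst h3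
        simp [h2, ht]
      · simp [h1, h2, h3]

theorem copy_avoids {a b t r : ℕ} (ha : a ≠ r) (hb : b ≠ r) (ht : t ≠ r) : (copy a b t).Avoids r :=
  ⟨⟨ha, hb, ht⟩, ht, ha⟩

theorem copy_proper {a b t : ℕ} (hab : a ≠ b) (hat : a ≠ t) : (copy a b t).Proper :=
  ⟨⟨⟨hab.symm, hat.symm⟩, trivial, trivial⟩, hat, trivial⟩

/-- The program `p` writes the value of the function `f` at the contents of the registers `a i` to
the register `o`, using registers from `s` on as auxiliary registers. -/
structure Implements {n : ℕ} (p : Program) (f : List.Vector ℕ n → ℕ) (a : Fin n → ℕ)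
    (o s : ℕ) : Prop where
  proper : p.Proper
  avoids : ∀ r < s, r ≠ o → (∀ i, a i ≠ r) → p.Avoids r
  run_eq : ∀ ρ : ℕ → ℕ, ρ o = 0 → (∀ r, s ≤ r → ρ r = 0) →
    p.run ρ = update ρ o (f (List.Vector.ofFn fun i => ρ (a i)))

variable {n : ℕ}

/-- Programs for several functions can be executed one after another. -/
theorem exists_run_all {m : ℕ} {g : Fin m → List.Vector ℕ n → ℕ} {a : Fin n → ℕ} {s : ℕ}
    (ha : ∀ i, a i < s)
    (hg : ∀ i, ∃ p : Program, p.Implements (g i) a (s + i) (s + m)) (k : ℕ) (hk : k ≤ m) :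
    ∃ p : Program, p.Proper ∧ (∀ r < s, (∀ i, a i ≠ r) → p.Avoids r) ∧
      ∀ ρ : ℕ → ℕ, (∀ r, s ≤ r → ρ r = 0) → ∀ r, p.run ρ r =
        if h : s ≤ r ∧ r < s + k then g ⟨r - s, by omega⟩ (List.Vector.ofFn fun i => ρ (a i))
        else ρ r := by
  induction k with
  | zero =>
    refine ⟨skip, trivial, fun _ _ _ => trivial, fun ρ hρ r => ?_⟩
    rw [dif_neg (by omega)]
    rfl
  | succ k ih =>
    obtain ⟨p, hp1, hp2, hp3⟩ := ih (by omega)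
    obtain ⟨q, hq1, hq2, hq3⟩ := hg ⟨k, hk⟩
    refine ⟨seq p q, ⟨hp1, hq1⟩, fun r hr hr' => ⟨hp2 r hr hr', hq2 r (by omega)
      (by simp only [ne_eq]; omega) hr'⟩, fun ρ hρ r => ?_⟩
    have hin : (fun i => p.run ρ (a i)) = fun i => ρ (a i) := funext fun i => by
      rw [hp3 ρ hρ]
      exact dif_neg (by have := ha i; omega)
    rw [run, hq3, hin]
    · by_cases h1 : r = s + k
      · subst h1
        rw [update_self, dif_pos (by omega)]
        exact congrFun (congrArg g (Fin.ext (by simp))) _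
      · rw [update_of_ne h1, hp3 ρ hρ]
        by_cases h2 : s ≤ r ∧ r < s + k
        · rw [dif_pos h2, dif_pos (by omega)]
        · rw [dif_neg h2, dif_neg (by omega)]
    · rw [hp3 ρ hρ, dif_neg (by simp only; omega)]
      exact hρ _ (Nat.le_add_right _ _)
    · intro r hr
      rw [hp3 ρ hρ, dif_neg (by omega)]
      exact hρ r (by omega)

theorem exists_clear (s m : ℕ) : ∃ p : Program, p.Proper ∧ (∀ r < s, p.Avoids r) ∧
    ∀ (ρ : ℕ → ℕ) r, p.run ρ r = if s ≤ r ∧ r < s + m then 0 else ρ r := by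
  induction m with
  | zero =>
    refine ⟨skip, trivial, fun _ _ => trivial, fun ρ r => ?_⟩
    rw [if_neg (by omega)]
    rfl
  | succ m ih =>
    obtain ⟨p, hp1, hp2, hp3⟩ := ih
    refine ⟨seq p (rep (s + m) skip), ⟨hp1, trivial, trivial⟩,
      fun r hr => ⟨hp2 r hr, by omega, trivial⟩, fun ρ r => ?_⟩
    rw [run, run_clear]
    by_cases h1 : r = s + m
    · subst h1
      rw [update_self, if_pos (by omega)]
    · rw [update_of_ne h1, hp3]
      by_cases h2 : s ≤ r ∧ r < s + m
      · rw [if_pos h2, if_pos (by omega)]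
      · rw [if_neg h2, if_neg (by omega)]

/-- For a composition, the inner values are written to the registers `s, …, s + m - 1`, which are
cleared at the end. -/
theorem exists_implements_comp {m : ℕ} {f : List.Vector ℕ m → ℕ} {g : Fin m → List.Vector ℕ n → ℕ}
    {a : Fin n → ℕ} {o s : ℕ} (ha : ∀ i, a i < s) (hao : ∀ i, a i ≠ o) (ho : o < s)
    (hf : ∀ (a : Fin m → ℕ) (o s : ℕ), (∀ i, a i < s) → (∀ i, a i ≠ o) → o < s →
      ∃ p : Program, p.Implements f a o s)
    (hg : ∀ i (a : Fin n → ℕ) (o s : ℕ), (∀ i, a i < s) → (∀ i, a i ≠ o) → o < s →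
      ∃ p : Program, p.Implements (g i) a o s) :
    ∃ p : Program, p.Implements (fun v => f (List.Vector.ofFn fun i => g i v)) a o s := by
  obtain ⟨p, hp1, hp2, hp3⟩ := exists_run_all (g := g) ha (fun i => hg i a (s + i) (s + m)
    (fun j => by have := ha j; omega) (fun j => by have := ha j; omega) (by omega)) m le_rfl
  obtain ⟨q, hq1, hq2, hq3⟩ := hf (fun i => s + i) o (s + m) (fun i => by omega)
    (fun i => by omega) (by omega)
  obtain ⟨c, hc1, hc2, hc3⟩ := exists_clear s m
  refine ⟨seq (seq p q) c, ⟨⟨hp1, hq1⟩, hc1⟩, fun r hr hro hra => ⟨⟨hp2 r hr hra,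
    hq2 r (by omega) hro fun i => by omega⟩, hc2 r hr⟩, fun ρ hρ0 hρ => ?_⟩
  funext r
  rw [run, run, hc3, hq3]
  · by_cases h1 : r = o
    · subst h1
      rw [if_neg (by omega), update_self, update_self]
      congr 2
      funext i
      rw [hp3 ρ hρ, dif_pos (by omega)]
      congr 1
      exact Fin.ext (by simp)
    · rw [update_of_ne h1, update_of_ne h1, hp3 ρ hρ]
      by_cases h2 : s ≤ r ∧ r < s + m
      · rw [if_pos h2, hρ r h2.1]
      · rw [if_neg h2, dif_neg h2]
  · rw [hp3 ρ hρ, dif_neg (by omega), hρ0]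
  · intro r hr
    rw [hp3 ρ hρ, dif_neg (by omega), hρ r (by omega)]

/-- Primitive recursion is a loop. The register of the recursion argument is copied first, because a
proper loop consumes its register. -/
theorem exists_implements_prec {f : List.Vector ℕ n → ℕ} {g : List.Vector ℕ (n + 2) → ℕ}
    {a : Fin (n + 1) → ℕ} {o s : ℕ} (ha : ∀ i, a i < s) (hao : ∀ i, a i ≠ o) (ho : o < s)
    (hf : ∀ (a : Fin n → ℕ) (o s : ℕ), (∀ i, a i < s) → (∀ i, a i ≠ o) → o < s →
      ∃ p : Program, p.Implements f a o s)
    (hg : ∀ (a : Fin (n + 2) → ℕ) (o s : ℕ), (∀ i, a i < s) → (∀ i, a i ≠ o) → o < s →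
      ∃ p : Program, p.Implements g a o s) :
    ∃ p : Program, p.Implements (fun v : List.Vector ℕ (n + 1) =>
      v.head.rec (f v.tail) fun y IH => g (y ::ᵥ IH ::ᵥ v.tail)) a o s := by
  -- `s` counts the remaining rounds, `s + 1` the rounds made, and `s + 2` receives the new value
  obtain ⟨p, hp1, hp2, hp3⟩ := hf (fun i => a i.succ) o (s + 3) (fun i => by have := ha i.succ; omega)
    (fun i => hao _) (by omega)
  obtain ⟨q, hq1, hq2, hq3⟩ := hg (Fin.cons (s + 1) (Fin.cons o fun i => a i.succ)) (s + 2) (s + 3)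
    (Fin.cases (by simp) (Fin.cases (by simp; omega) fun i => by
      have := ha i.succ
      simp only [Fin.cons_succ]; omega))
    (Fin.cases (by simp) (Fin.cases (by simp; omega) fun i => by
      have := ha i.succ
      simp only [Fin.cons_succ]; omega)) (by omega)
  have a0 := ha 0
  have a0' := hao 0
  set body : Program := seq (seq q (rep o skip)) (seq (rep (s + 2) (inc o)) (inc (s + 1))) with hbody
  have hbs : body.Avoids s := by
    refine ⟨⟨hq2 s (by omega) (by omega) (Fin.cases (by simp) (Fin.cases (by simp; omega) fun i => ?_)),
      by omega, trivial⟩, ⟨by omega, show o ≠ s by omega⟩, show s + 1 ≠ s by omega⟩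
    have := ha i.succ
    simp only [Fin.cons_succ]; omega
  refine ⟨seq (seq (copy (a 0) s (s + 1)) p) (seq (rep s body) (rep (s + 1) skip)),
    ⟨⟨copy_proper (by omega) (by omega), hp1⟩, ⟨hbs, ⟨hq1, trivial, trivial⟩,
      ⟨show o ≠ s + 2 by omega, trivial⟩, trivial⟩, trivial, trivial⟩, fun r hr hro hra => ?_,
    fun ρ hρ0 hρ => ?_⟩
  · refine ⟨⟨copy_avoids (hra 0) (by omega) (by omega), hp2 r (by omega) hro fun i => hra _⟩,
      ⟨by omega, ⟨hq2 r (by omega) (by omega) (Fin.cases (by simp; omega)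
        (Fin.cases (by simpa using hro.symm) fun i => ?_)), hro.symm, trivial⟩,
        ⟨by omega, hro.symm⟩, show s + 1 ≠ r by omega⟩, by omega, trivial⟩
    simpa using hra i.succ
  set v : List.Vector ℕ n := List.Vector.ofFn fun i => ρ (a i.succ) with hv
  set F : ℕ → ℕ := fun k => k.rec (f v) fun y IH => g (y ::ᵥ IH ::ᵥ v) with hF
  have loop : ∀ k j, (rep s body).run (update (update (update ρ o (F j)) s k) (s + 1) j) =
      update (update ρ o (F (j + k))) (s + 1) (j + k) := by
    intro k
    induction k with
    | zero =>
      intro j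
      rw [run_rep_zero _ (by simp), add_zero]
      congr 1
      refine (update_eq_self_iff).2 ?_
      rw [update_of_ne (by omega), hρ s le_rfl]
    | succ k ih =>
      intro j
      rw [run_rep_succ (n := k) hbs (by simp)]
      have e1 : j + (k + 1) = j + 1 + k := by omega
      rw [e1, ← ih (j + 1), hbody]
      congr 1
      set σ := update (update (update (update ρ o (F j)) s (k + 1)) (s + 1) j) s k with hσ
      have hσo : σ o = F j := by
        rw [hσ, update_of_ne (by omega), update_of_ne (by omega), update_of_ne (by omega),
          update_self]
      have hσi : σ (s + 1) = j := by rw [hσ, update_of_ne (by omega), update_self]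
      have hσr : ∀ r, r ≠ o → r ≠ s → r ≠ s + 1 → σ r = ρ r := fun r h1 h2 h3 => by
        rw [hσ, update_of_ne h2, update_of_ne h3, update_of_ne h2, update_of_ne h1]
      have hval : g (List.Vector.ofFn fun i => σ
          ((Fin.cons (s + 1) (Fin.cons o fun i => a i.succ) : Fin (n + 2) → ℕ) i)) = F (j + 1) := by
        have e2 : (List.Vector.ofFn fun i => σ
            ((Fin.cons (s + 1) (Fin.cons o fun i => a i.succ) : Fin (n + 2) → ℕ) i)) =
            σ (s + 1) ::ᵥ σ o ::ᵥ List.Vector.ofFn fun i => σ (a i.succ) := rfl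
        rw [e2, hσi, hσo]
        have e3 : (fun i : Fin n => σ (a i.succ)) = fun i => ρ (a i.succ) := funext fun i => by
          have := ha i.succ
          exact hσr _ (hao _) (by omega) (by omega)
        rw [e3]
      change (inc (s + 1)).run ((rep (s + 2) (inc o)).run ((rep o skip).run (q.run σ))) = _
      rw [hq3 σ (by rw [hσr _ (by omega) (by omega) (by omega), hρ _ (by omega)])
        (fun r hr => by rw [hσr _ (by omega) (by omega) (by omega), hρ _ (by omega)]), hval,
        run_clear, run_move (by omega), run]
      funext r
      by_cases h1 : r = s + 1
      · subst h1
        simp [hσi, show s + 1 ≠ o by omega]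
      · by_cases h2 : r = s + 2
        · subst h2
          simp [show s + 2 ≠ o by omega, hρ]
        · by_cases h3 : r = o
          · subst h3
            simp [h1, h2, show r ≠ s by omega, show s + 2 ≠ r by omega]
          · by_cases h4 : r = s
            · subst h4
              simp [h3, hσ]
            · simp [h1, h2, h3, h4, hσr r h3 h4 h1]
  have e0 : (copy (a 0) s (s + 1)).run ρ = update ρ s (ρ (a 0)) := by
    rw [run_copy (by omega) (by omega) (by omega) (hρ _ (by omega)), hρ s le_rfl, zero_add]
  have e1 : p.run (update ρ s (ρ (a 0))) = update (update (update ρ o (F 0)) s (ρ (a 0))) (s + 1) 0 := by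
    rw [hp3 _ (by rw [update_of_ne (by omega), hρ0])
      fun r hr => by rw [update_of_ne (by omega), hρ r (by omega)]]
    have e2 : (fun i : Fin n => update ρ s (ρ (a 0)) (a i.succ)) = fun i => ρ (a i.succ) :=
      funext fun i => update_of_ne (by have := ha i.succ; omega) _ _
    rw [e2]
    funext r
    by_cases h1 : r = s + 1
    · subst h1
      simp [show s + 1 ≠ o by omega, hρ]
    · by_cases h2 : r = s
      · subst h2
        simp [show r ≠ o by omega]
      · by_cases h3 : r = o
        · subst h3
          simp [h1, h2, hF, hv]
        · simp [h1, h2, h3]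
  change (rep (s + 1) skip).run ((rep s body).run (p.run ((copy (a 0) s (s + 1)).run ρ))) = _
  rw [e0, e1, loop, run_clear, zero_add]
  have e3 : (fun v : List.Vector ℕ (n + 1) => v.head.rec (f v.tail)
      fun y IH => g (y ::ᵥ IH ::ᵥ v.tail)) (List.Vector.ofFn fun i => ρ (a i)) = F (ρ (a 0)) := by
    have e4 : (List.Vector.ofFn fun i => ρ (a i)) = ρ (a 0) ::ᵥ v := rfl
    rw [e4]
    simp only [List.Vector.head_cons, List.Vector.tail_cons, hF]
  rw [update_idem, show update (update ρ o (F (ρ (a 0)))) (s + 1) 0 = update ρ o (F (ρ (a 0))) from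
    update_eq_self_iff.2 (by rw [update_of_ne (by omega), hρ _ (by omega)])]
  exact congrArg (update ρ o) e3.symm

/-- Primitive recursive functions are computed by programs. -/
theorem exists_implements {f : List.Vector ℕ n → ℕ} (hf : Nat.Primrec' f) :
    ∀ (a : Fin n → ℕ) (o s : ℕ), (∀ i, a i < s) → (∀ i, a i ≠ o) → o < s →
      ∃ p : Program, p.Implements f a o s := by
  induction hf with
  | zero =>
    intro a o s _ _ _
    exact ⟨skip, trivial, fun _ _ _ _ => trivial, fun ρ h _ => (update_eq_self_iff.2 h.symm).symm⟩
  | succ =>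
    intro a o s ha hao ho
    have a0 := ha 0
    refine ⟨seq (copy (a 0) o s) (inc o), ⟨copy_proper (hao 0) (by omega), trivial⟩,
      fun r hr hro hra => ⟨copy_avoids (hra 0) hro.symm (by omega), hro.symm⟩, fun ρ h0 hρ => ?_⟩
    rw [run, run_copy (hao 0) (by omega) (by omega) (hρ s le_rfl), run, update_self, update_idem,
      h0, zero_add]
    rfl
  | get i =>
    intro a o s ha hao ho
    have a0 := ha i
    refine ⟨copy (a i) o s, copy_proper (hao i) (by omega),
      fun r hr hro hra => copy_avoids (hra i) hro.symm (by omega), fun ρ h0 hρ => ?_⟩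
    rw [run_copy (hao i) (by omega) (by omega) (hρ s le_rfl), h0, zero_add]
    simp
  | comp g _ _ hf hg =>
    exact fun a o s ha hao ho => exists_implements_comp ha hao ho hf hg
  | prec _ _ hf hg =>
    exact fun a o s ha hao ho => exists_implements_prec ha hao ho hf hg

end Program

namespace Program

open Function

/-! ### Registers as exponents -/

/-- The contents of the registers which the number `N` represents: the exponents of the primes. -/
noncomputable def contents (N r : ℕ) : ℕ := N.factorization (Nat.nth Nat.Prime r)

theorem nth_prime_injective : Injective (Nat.nth Nat.Prime) :=
  Nat.nth_injective Nat.infinite_setOfPred_prime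

theorem contents_mul {N : ℕ} (hN : N ≠ 0) (r : ℕ) :
    contents (Nat.nth Nat.Prime r * N) = update (contents N) r (contents N r + 1) := by
  have hp := Nat.prime_nth_prime r
  funext i
  rw [contents, Nat.factorization_mul hp.ne_zero hN, Finsupp.add_apply, hp.factorization]
  by_cases h : i = r
  · subst h
    rw [update_self, Finsupp.single_eq_same, add_comm]
    rfl
  · rw [update_of_ne h, Finsupp.single_eq_of_ne (fun h' => h (nth_prime_injective h')), zero_add]
    rfl

theorem dvd_iff {N : ℕ} (hN : N ≠ 0) (r : ℕ) : Nat.nth Nat.Prime r ∣ N ↔ contents N r ≠ 0 := by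
  rw [(Nat.prime_nth_prime r).dvd_iff_one_le_factorization hN]
  exact Nat.one_le_iff_ne_zero

theorem contents_div {N : ℕ} {r : ℕ} (h : Nat.nth Nat.Prime r ∣ N) :
    contents (N / Nat.nth Nat.Prime r) = update (contents N) r (contents N r - 1) := by
  have hp := Nat.prime_nth_prime r
  funext i
  rw [contents, Nat.factorization_div h, Finsupp.tsub_apply, hp.factorization]
  by_cases h : i = r
  · subst h
    rw [update_self, Finsupp.single_eq_same]
    rfl
  · rw [update_of_ne h, Finsupp.single_eq_of_ne (fun h' => h (nth_prime_injective h')), Nat.sub_zero]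
    rfl

theorem contents_two_pow (n : ℕ) : contents (2 ^ n) = fun r => if r = 0 then n else 0 := by
  funext r
  rw [contents, Nat.Prime.factorization_pow Nat.prime_two]
  split_ifs with h
  · rw [h, Nat.nth_prime_zero_eq_two, Finsupp.single_eq_same]
  · refine Finsupp.single_eq_of_ne fun h' => h (nth_prime_injective ?_)
    rw [h', Nat.nth_prime_zero_eq_two]

/-! ### Execution of programs on a single number -/

/-- One step of the execution of a list of programs, on registers represented by a number. -/
noncomputable def exec : List Program × ℕ → List Program × ℕ
  | ([], N) => ([], N)
  | (skip :: k, N) => (k, N)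
  | (inc r :: k, N) => (k, Nat.nth Nat.Prime r * N)
  | (seq p q :: k, N) => (p :: q :: k, N)
  | (rep r p :: k, N) => if Nat.nth Nat.Prime r ∣ N then
      (p :: rep r p :: k, N / Nat.nth Nat.Prime r) else (k, N)

/-- The execution leads from one configuration to another one. -/
abbrev Leads : List Program × ℕ → List Program × ℕ → Prop :=
  Relation.ReflTransGen fun c d => exec c = d

theorem Leads.head {c d e : List Program × ℕ} (h : exec c = d) (h' : Leads d e) : Leads c e :=
  Relation.ReflTransGen.head h h'

theorem exec_rep_of_dvd {r N : ℕ} (h : Nat.nth Nat.Prime r ∣ N) (p : Program) (k : List Program) :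
    exec (rep r p :: k, N) = (p :: rep r p :: k, N / Nat.nth Nat.Prime r) := if_pos h

theorem exec_rep_of_not_dvd {r N : ℕ} (h : ¬ Nat.nth Nat.Prime r ∣ N) (p : Program)
    (k : List Program) : exec (rep r p :: k, N) = (k, N) := if_neg h

theorem div_ne_zero_of_dvd {N r : ℕ} (hN : N ≠ 0) (h : Nat.nth Nat.Prime r ∣ N) :
    N / Nat.nth Nat.Prime r ≠ 0 :=
  (Nat.div_pos (Nat.le_of_dvd (Nat.pos_of_ne_zero hN) h) (Nat.prime_nth_prime r).pos).ne'

/-- Proper programs have the intended effect. -/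
theorem Proper.leads : ∀ {p : Program} (_ : p.Proper) (k : List Program) {N : ℕ} (_ : N ≠ 0),
    ∃ N', Leads (p :: k, N) (k, N') ∧ N' ≠ 0 ∧ contents N' = p.run (contents N)
  | skip, _, _, N, hN => ⟨N, .single rfl, hN, rfl⟩
  | inc r, _, _, N, hN => ⟨_, .single rfl, mul_ne_zero (Nat.prime_nth_prime r).ne_zero hN,
      contents_mul hN r⟩
  | seq p q, h, k, N, hN => by
    obtain ⟨N₁, h1, h2, h3⟩ := h.1.leads (q :: k) hN
    obtain ⟨N₂, h4, h5, h6⟩ := h.2.leads k h2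
    exact ⟨N₂, (Leads.head (d := (p :: q :: k, N)) rfl h1).trans h4, h5, by rw [h6, h3, run]⟩
  | rep r p, h, k, N, hN => by
    have key : ∀ n N, N ≠ 0 → contents N r = n → ∃ N', Leads (rep r p :: k, N) (k, N') ∧ N' ≠ 0 ∧
        contents N' = (rep r p).run (contents N) := by
      intro n
      induction n with
      | zero =>
        intro N hN hn
        have hd : ¬ Nat.nth Nat.Prime r ∣ N := by rw [dvd_iff hN, hn]; simp
        exact ⟨N, .single (exec_rep_of_not_dvd hd p k), hN, (run_rep_zero p hn).symm⟩
      | succ n ih =>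
        intro N hN hn
        have hd : Nat.nth Nat.Prime r ∣ N := by rw [dvd_iff hN, hn]; simp
        obtain ⟨N₁, h1, h2, h3⟩ := h.2.leads (rep r p :: k) (div_ne_zero_of_dvd hN hd)
        rw [contents_div hd, hn, Nat.add_sub_cancel] at h3
        obtain ⟨N₂, h4, h5, h6⟩ := ih N₁ h2 (by rw [h3, h.1.run_eq, update_self])
        exact ⟨N₂, (Leads.head (exec_rep_of_dvd hd p k) h1).trans h4, h5, by
          rw [h6, h3, run_rep_succ h.1 hn]⟩
    exact key _ N hN rfl

/-! ### Unbounded search -/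

/-- Registers with given values of the first three. -/
def triple (n k y r : ℕ) : ℕ := if r = 0 then n else if r = 1 then k else if r = 2 then y else 0

/-- One round of the search for a zero: the next argument is tested. -/
def searchBody (p : Program) : Program := seq (rep 2 skip) (seq (inc 1) p)

/-- The search for the first zero of `k ↦ g (n, k)`, where `n` and `k` are the contents of the
registers `0` and `1`, and `p` writes the value of `g` to the register `2`. -/
def search (p : Program) : Program := seq p (rep 2 (searchBody p))

section Search

variable {p : Program} {g : List.Vector ℕ 2 → ℕ} (hp : p.Implements g Fin.val 2 3)

include hp

theorem Implements.run_triple (n k : ℕ) :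
    p.run (triple n k 0) = triple n k (g (n ::ᵥ k ::ᵥ .nil)) := by
  rw [hp.run_eq _ rfl fun r hr => by
    rw [triple, if_neg (by omega), if_neg (by omega), if_neg (by omega)]]
  have e : (List.Vector.ofFn fun i : Fin 2 => triple n k 0 (i : ℕ)) = n ::ᵥ k ::ᵥ .nil := rfl
  rw [e]
  funext r
  by_cases h : r = 2
  · subst h; rw [update_self]; rfl
  · rw [update_of_ne h]
    simp [triple, h]

theorem Implements.run_searchBody (n k y : ℕ) :
    (searchBody p).run (triple n k y) = triple n (k + 1) (g (n ::ᵥ (k + 1) ::ᵥ .nil)) := by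
  rw [← hp.run_triple]
  change p.run ((inc 1).run ((rep 2 skip).run _)) = _
  rw [run_clear, run]
  congr 1
  funext r
  by_cases h1 : r = 1
  · subst h1; simp [triple]
  · by_cases h2 : r = 2
    · subst h2; simp [triple]
    · simp [triple, h1, h2]

/-- As long as no zero has been found, the search comes to every argument. -/
theorem Implements.leads_search (n k : ℕ) (h : ∀ j < k, g (n ::ᵥ j ::ᵥ .nil) ≠ 0) :
    ∃ N, Leads ([search p], 2 ^ n) ([rep 2 (searchBody p)], N) ∧ N ≠ 0 ∧
      contents N = triple n k (g (n ::ᵥ k ::ᵥ .nil)) := by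
  induction k with
  | zero =>
    obtain ⟨N, h1, h2, h3⟩ := hp.proper.leads [rep 2 (searchBody p)] (N := 2 ^ n) (by positivity)
    refine ⟨N, Leads.head rfl h1, h2, ?_⟩
    rw [h3, ← hp.run_triple, contents_two_pow]
    congr 1
    funext r
    simp [triple]
  | succ k ih =>
    obtain ⟨N, h1, h2, h3⟩ := ih fun j hj => h j (by omega)
    have hg := h k (Nat.lt_succ_self k)
    have hd : Nat.nth Nat.Prime 2 ∣ N := by rw [dvd_iff h2, h3]; exact hg
    have hproper : (searchBody p).Proper := ⟨⟨trivial, trivial⟩, trivial, hp.proper⟩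
    obtain ⟨N', h4, h5, h6⟩ := hproper.leads [rep 2 (searchBody p)] (div_ne_zero_of_dvd h2 hd)
    refine ⟨N', h1.trans (Leads.head (exec_rep_of_dvd hd _ _) h4), h5, ?_⟩
    rw [h6, contents_div hd, h3, ← hp.run_searchBody n k (g (n ::ᵥ k ::ᵥ .nil) - 1)]
    congr 1
    funext r
    by_cases h2 : r = 2
    · subst h2; rw [update_self]; rfl
    · rw [update_of_ne h2]
      simp [triple, h2]

theorem Implements.leads_nil {n k : ℕ} (h : g (n ::ᵥ k ::ᵥ .nil) = 0) :
    ∃ N, Leads ([search p], 2 ^ n) ([], N) := by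
  classical
  have hex : ∃ k, g (n ::ᵥ k ::ᵥ .nil) = 0 := ⟨k, h⟩
  obtain ⟨N, h1, h2, h3⟩ := hp.leads_search n (Nat.find hex) fun j hj => Nat.find_min hex hj
  rw [Nat.find_spec hex] at h3
  refine ⟨N, h1.trans (.single (exec_rep_of_not_dvd ?_ _ _))⟩
  rw [dvd_iff h2, h3]
  exact fun h => h rfl

/-- If there is no zero, then the arguments tested, and so the numbers representing them, grow
unboundedly. -/
theorem Implements.leads_large {n : ℕ} (h : ∀ k, g (n ::ᵥ k ::ᵥ .nil) ≠ 0) (k : ℕ) :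
    ∃ l N, Leads ([search p], 2 ^ n) (l, N) ∧ k < N := by
  obtain ⟨N, h1, h2, h3⟩ := hp.leads_search n k fun j _ => h j
  refine ⟨_, N, h1, ?_⟩
  have h4 : contents N 1 = k := by rw [h3]; rfl
  rw [← h4]
  exact Nat.factorization_lt _ h2

end Search

/-! ### The lists of programs which occur in an execution -/

/-- The lists of programs which occur in the execution of `p`, if the list `k` remains to be
executed afterwards. -/
def support : Program → List Program → Finset (List Program)
  | skip, k => {skip :: k}
  | inc r, k => {inc r :: k}
  | seq p q, k => insert (seq p q :: k) (p.support (q :: k) ∪ q.support k)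
  | rep r p, k => insert (rep r p :: k) (p.support (rep r p :: k))

theorem cons_mem_support (p : Program) (k : List Program) : p :: k ∈ p.support k := by
  cases p <;> simp [support]

theorem exec_mem_support (p : Program) (k : List Program) {l : List Program} (N : ℕ)
    (h : l ∈ p.support k) : (exec (l, N)).1 ∈ insert k (p.support k) := by
  induction p generalizing k with
  | skip =>
    rw [support, Finset.mem_singleton] at h
    subst h
    exact Finset.mem_insert_self _ _
  | inc r =>
    rw [support, Finset.mem_singleton] at h
    subst h
    exact Finset.mem_insert_self _ _
  | seq p q ihp ihq =>
    simp only [support, Finset.mem_insert, Finset.mem_union] at h ⊢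
    rcases h with rfl | h | h
    · exact Or.inr (Or.inr (Or.inl (cons_mem_support _ _)))
    · rcases Finset.mem_insert.1 (ihp _ h) with h' | h'
      · rw [h']; exact Or.inr (Or.inr (Or.inr (cons_mem_support _ _)))
      · exact Or.inr (Or.inr (Or.inl h'))
    · rcases Finset.mem_insert.1 (ihq _ h) with h' | h'
      · exact Or.inl h'
      · exact Or.inr (Or.inr (Or.inr h'))
  | rep r p ih =>
    simp only [support, Finset.mem_insert] at h ⊢
    rcases h with rfl | h
    · by_cases hd : Nat.nth Nat.Prime r ∣ N
      · rw [exec_rep_of_dvd hd]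
        exact Or.inr (Or.inr (cons_mem_support _ _))
      · rw [exec_rep_of_not_dvd hd]
        exact Or.inl rfl
    · exact Or.inr (Finset.mem_insert.1 (ih _ h))

/-- The number by which the next step divides with remainder; `0` at the end. -/
noncomputable def modulus : List Program → ℕ
  | [] => 0
  | rep r _ :: _ => Nat.nth Nat.Prime r
  | _ => 1

/-- The number by which the next step multiplies the quotient, if the remainder is `s`. -/
noncomputable def factor (s : ℕ) : List Program → ℕ
  | inc r :: _ => Nat.nth Nat.Prime r
  | rep r _ :: _ => if s = 0 then 1 else Nat.nth Nat.Prime r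
  | _ => 1

theorem modulus_pos {l : List Program} (hl : l ≠ []) : 0 < modulus l := by
  match l, hl with
  | skip :: _, _ => exact one_pos
  | inc _ :: _, _ => exact one_pos
  | seq _ _ :: _, _ => exact one_pos
  | rep r _ :: _, _ => exact (Nat.prime_nth_prime r).pos

/-- Every step is an affine function on each residue class. -/
theorem exec_eq {l : List Program} (hl : l ≠ []) (N : ℕ) :
    exec (l, N) = ((exec (l, N % modulus l)).1,
      factor (N % modulus l) l * (N / modulus l) + N % modulus l) := by
  match l, hl with
  | skip :: k, _ => simp [exec, modulus, factor, Nat.mod_one]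
  | inc r :: k, _ => simp [exec, modulus, factor, Nat.mod_one]
  | seq p q :: k, _ => simp [exec, modulus, factor, Nat.mod_one]
  | rep r p :: k, _ =>
    by_cases hd : Nat.nth Nat.Prime r ∣ N
    · have h0 : N % Nat.nth Nat.Prime r = 0 := Nat.mod_eq_zero_of_dvd hd
      rw [exec_rep_of_dvd hd]
      simp only [modulus, factor, h0, if_true]
      rw [exec_rep_of_dvd (dvd_zero _)]
      simp
    · have h0 : N % Nat.nth Nat.Prime r ≠ 0 := fun h => hd (Nat.dvd_of_mod_eq_zero h)
      rw [exec_rep_of_not_dvd hd]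
      simp only [modulus, factor, h0, if_false]
      rw [exec_rep_of_not_dvd (fun h => hd ((Nat.dvd_mod_iff dvd_rfl).1 h)), Nat.div_add_mod]

theorem factor_le (s : ℕ) (l : List Program) : factor s l ≤ modulus l + factor 0 l := by
  match l with
  | [] => exact Nat.le_add_left _ _
  | skip :: _ => exact Nat.le_add_left _ _
  | inc _ :: _ => exact Nat.le_add_left _ _
  | seq _ _ :: _ => exact Nat.le_add_left _ _
  | rep r _ :: _ =>
    simp only [modulus, factor, if_true]
    split_ifs <;> omega

theorem exists_bound (F : Finset (List Program)) :
    ∃ K, ∀ l ∈ F, modulus l ≤ K ∧ ∀ s, factor s l ≤ K := by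
  refine ⟨F.sup fun l => modulus l + factor 0 l, fun l hl => ?_⟩
  have h1 : modulus l + factor 0 l ≤ _ := Finset.le_sup (f := fun l => modulus l + factor 0 l) hl
  exact ⟨(Nat.le_add_right _ _).trans h1, fun s => (factor_le s l).trans h1⟩

end Program

namespace Program

/-! ### Execution of programs by a simplified counter machine -/

/-- The phases in which a machine with two counters executes a step which maps `N` to
`factor s l * (N / modulus l) + s`, where `s = N % modulus l`. The number `N` is in the first
counter and the second one is zero. In the phases `divide` and `count` the quotient is moved to the
second counter; then `restore`, `spend` and `grow` move its multiple back, and `finish` adds the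
remainder. -/
inductive Phase : Type
  | divide | count | restore | spend | grow | finish

instance : Finite Phase :=
  Finite.of_surjective ![.divide, .count, .restore, .spend, .grow, .finish] fun r => by
    cases r
    exacts [⟨0, rfl⟩, ⟨1, rfl⟩, ⟨2, rfl⟩, ⟨3, rfl⟩, ⟨4, rfl⟩, ⟨5, rfl⟩]

/-- The states of the machine: the phase, the list of programs to be executed, the remainder found
so far, and the number of increments that remain to be made. -/
abbrev Control := Phase × List Program × ℕ × ℕ

/-- The first state on the way to `restore` in which the first counter is increased `j` times. -/
def growBy (l : List Program) (s : ℕ) : ℕ → Control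
  | 0 => (.restore, l, s, 0)
  | j + 1 => (.grow, l, s, j)

/-- The first state on the way to the next step in which the first counter is increased `j`
times. -/
noncomputable def finishBy (l : List Program) (s : ℕ) : ℕ → Control
  | 0 => (.divide, (exec (l, s)).1, 0, 0)
  | j + 1 => (.finish, l, s, j)

/-- The transitions, depending on which of the counters are positive. -/
noncomputable def transition : Control → Bool → Bool → Control
  | (.divide, l, s, _), b, _ =>
    if modulus l = 0 then (.divide, l, 0, 0) else if modulus l ≤ s then (.count, l, 0, 0)
    else if b then (.divide, l, s + 1, 0) else (.restore, l, s, 0)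
  | (.count, l, _, _), _, _ => (.divide, l, 0, 0)
  | (.restore, l, s, _), _, b => if b then (.spend, l, s, 0) else finishBy l s s
  | (.spend, l, s, _), _, _ => growBy l s (factor s l)
  | (.grow, l, s, j), _, _ => growBy l s j
  | (.finish, l, s, j), _, _ => finishBy l s j

/-- The change of the counters on entering a state. -/
def change : Control → ℤ × ℤ
  | (.divide, _, s, _) => if s = 0 then (0, 0) else (-1, 0)
  | (.count, _, _, _) => (0, 1)
  | (.restore, _, _, _) => (0, 0)
  | (.spend, _, _, _) => (0, -1)
  | (.grow, _, _, _) => (1, 0)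
  | (.finish, _, _, _) => (1, 0)

/-- The configuration after entering the state `r`. -/
def enter (r : Control) (x u : ℕ) : Control × ℕ × ℕ :=
  (r, ((x : ℤ) + (change r).1).toNat, ((u : ℤ) + (change r).2).toNat)

/-- One step of the machine. -/
noncomputable def move (c : Control × ℕ × ℕ) : Control × ℕ × ℕ :=
  enter (transition c.1 (decide (0 < c.2.1)) (decide (0 < c.2.2))) c.2.1 c.2.2

theorem change_growBy (l : List Program) (s j : ℕ) :
    change (growBy l s j) = (0, 0) ∨ change (growBy l s j) = (1, 0) := by
  cases j
  · exact Or.inl rfl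
  · exact Or.inr rfl

theorem change_finishBy (l : List Program) (s j : ℕ) :
    change (finishBy l s j) = (0, 0) ∨ change (finishBy l s j) = (1, 0) := by
  cases j
  · exact Or.inl rfl
  · exact Or.inr rfl

theorem change_mem (r : Control) : change r = (-1, 0) ∨ change r = (0, -1) ∨ change r = (0, 0) ∨
    change r = (1, 0) ∨ change r = (0, 1) := by
  obtain ⟨_ | _ | _ | _ | _ | _, l, s, j⟩ := r <;> simp only [change] <;> try split_ifs
  all_goals simp

theorem change_transition (r : Control) (b₁ b₂ : Bool) :
    (change (transition r b₁ b₂) = (-1, 0) → b₁ = true) ∧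
      (change (transition r b₁ b₂) = (0, -1) → b₂ = true) := by
  obtain ⟨_ | _ | _ | _ | _ | _, l, s, j⟩ := r
  · simp only [transition]
    split_ifs with h1 h2 h3 <;> simp [change, *]
  · simp [transition, change]
  · simp only [transition]
    split_ifs with h1
    · simp [change, h1]
    · rcases change_finishBy l s s with h | h <;> simp [h]
  · simp only [transition]
    rcases change_growBy l s (factor s l) with h | h <;> simp [h]
  · simp only [transition]
    rcases change_growBy l s j with h | h <;> simp [h]
  · simp only [transition]
    rcases change_finishBy l s j with h | h <;> simp [h]

/-- The machine leads from one configuration to another one. -/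
abbrev Moves : Control × ℕ × ℕ → Control × ℕ × ℕ → Prop :=
  Relation.ReflTransGen fun c d => move c = d

theorem Moves.head {c d e : Control × ℕ × ℕ} (h : move c = d) (h' : Moves d e) : Moves c e :=
  Relation.ReflTransGen.head h h'

theorem enter_eq {r : Control} {x u x' u' : ℕ} (h1 : (x : ℤ) + (change r).1 = x')
    (h2 : (u : ℤ) + (change r).2 = u') : enter r x u = (r, x', u') := by
  rw [enter, h1, h2, Int.toNat_natCast, Int.toNat_natCast]

theorem moves_growBy (l : List Program) (s j x u : ℕ) :
    Moves (enter (growBy l s j) x u) ((.restore, l, s, 0), x + j, u) := by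
  induction j generalizing x with
  | zero => rw [growBy, enter_eq (x' := x) (u' := u) (by simp [change]) (by simp [change])]; rfl
  | succ j ih =>
    rw [growBy, enter_eq (x' := x + 1) (u' := u) (by simp [change]) (by simp [change])]
    have h := ih (x + 1)
    rw [add_right_comm, add_assoc] at h
    exact .head rfl h

theorem moves_finishBy (l : List Program) (s j x u : ℕ) :
    Moves (enter (finishBy l s j) x u) ((.divide, (exec (l, s)).1, 0, 0), x + j, u) := by
  induction j generalizing x with
  | zero => rw [finishBy, enter_eq (x' := x) (u' := u) (by simp [change]) (by simp [change])]; rfl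
  | succ j ih =>
    rw [finishBy, enter_eq (x' := x + 1) (u' := u) (by simp [change]) (by simp [change])]
    have h := ih (x + 1)
    rw [add_right_comm, add_assoc] at h
    exact .head rfl h

theorem moves_restore (l : List Program) (s x u : ℕ) :
    Moves ((.restore, l, s, 0), x, u)
      ((.divide, (exec (l, s)).1, 0, 0), x + factor s l * u + s, 0) := by
  induction u generalizing x with
  | zero =>
    exact .head (by simp [move, transition]) (moves_finishBy l s s x 0)
  | succ u ih =>
    have h1 : move ((.restore, l, s, 0), x, u + 1) = ((.spend, l, s, 0), x, u) := by
      simp [move, transition, enter, change]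
    have h2 := ih (x + factor s l)
    rw [show x + factor s l + factor s l * u = x + factor s l * (u + 1) by ring] at h2
    exact .head h1 ((Moves.head (d := enter (growBy l s (factor s l)) x u) rfl
      (moves_growBy l s (factor s l) x u)).trans h2)

theorem move_divide_succ {l : List Program} {s : ℕ} (h : s < modulus l) (x u : ℕ) :
    move ((.divide, l, s, 0), x + 1, u) = ((.divide, l, s + 1, 0), x, u) := by
  simp [move, transition, enter, change, h.not_ge, (Nat.zero_le s |>.trans_lt h).ne']

theorem moves_divide_of_lt {l : List Program} {s x : ℕ} (h : s + x < modulus l) (u : ℕ) :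
    Moves ((.divide, l, s, 0), x, u) ((.restore, l, s + x, 0), 0, u) := by
  induction x generalizing s with
  | zero =>
    refine .single ?_
    have h0 : s < modulus l := h
    simp [move, transition, enter, change, h0.not_ge, (Nat.zero_le s |>.trans_lt h0).ne']
  | succ x ih =>
    have h1 := ih (s := s + 1) (by omega)
    rw [add_right_comm, add_assoc] at h1
    exact .head (move_divide_succ (by omega) x u) h1

theorem moves_divide_add {l : List Program} {s d : ℕ} (h : s + d = modulus l) (hl : 0 < modulus l)
    (x u : ℕ) : Moves ((.divide, l, s, 0), d + x, u) ((.divide, l, 0, 0), x, u + 1) := by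
  induction d generalizing s with
  | zero =>
    have h1 : move ((.divide, l, s, 0), 0 + x, u) = ((.count, l, 0, 0), x, u + 1) := by
      simp [move, transition, enter, change, hl.ne', show modulus l ≤ s from h.ge]
    exact .head h1 (.single (by simp [move, transition, enter, change]))
  | succ d ih =>
    rw [add_right_comm]
    exact .head (move_divide_succ (by omega) _ u) (ih (by omega))

theorem moves_divide {l : List Program} (hl : 0 < modulus l) {s : ℕ} (hs : s < modulus l)
    (n u : ℕ) : Moves ((.divide, l, 0, 0), modulus l * n + s, u) ((.restore, l, s, 0), 0, u + n) := by
  induction n generalizing u with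
  | zero =>
    have h := moves_divide_of_lt (l := l) (s := 0) (x := s) (by omega) u
    rw [zero_add] at h
    rwa [mul_zero, zero_add, add_zero]
  | succ n ih =>
    have h := moves_divide_add (l := l) (s := 0) (zero_add _) hl (modulus l * n + s) u
    rw [show modulus l * (n + 1) + s = modulus l + (modulus l * n + s) by ring,
      show u + (n + 1) = u + 1 + n by ring]
    exact h.trans (ih (u + 1))

/-- The machine executes a step of the programs. -/
theorem moves_exec (l : List Program) (N : ℕ) :
    Moves ((.divide, l, 0, 0), N, 0) ((.divide, (exec (l, N)).1, 0, 0), (exec (l, N)).2, 0) := by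
  rcases eq_or_ne l [] with rfl | hl
  · rfl
  · have hp := modulus_pos hl
    have h1 := moves_divide hp (Nat.mod_lt N hp) (N / modulus l) 0
    rw [Nat.div_add_mod, zero_add] at h1
    have h2 := moves_restore l (N % modulus l) 0 (N / modulus l)
    rw [zero_add] at h2
    rw [exec_eq hl]
    exact h1.trans h2

theorem Leads.moves {c d : List Program × ℕ} (h : Leads c d) :
    Moves ((.divide, c.1, 0, 0), c.2, 0) ((.divide, d.1, 0, 0), d.2, 0) := by
  induction h with
  | refl => rfl
  | tail _ h ih =>
    subst h
    exact ih.trans (moves_exec _ _)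

theorem move_nil (N : ℕ) : move ((.divide, [], 0, 0), N, 0) = ((.divide, [], 0, 0), N, 0) := by
  simp [move, transition, modulus, enter, change]

theorem Moves.exists_iterate {c d : Control × ℕ × ℕ} (h : Moves c d) : ∃ t, move^[t] c = d := by
  induction h with
  | refl => exact ⟨0, rfl⟩
  | tail _ h ih =>
    obtain ⟨t, ht⟩ := ih
    exact ⟨t + 1, by rw [Function.iterate_succ_apply', ht, h]⟩

/-- The states over the lists in `G` with remainders and increments of at most `K`. -/
def states (G : Finset (List Program)) (K : ℕ) : Set Control :=
  {r | r.2.1 ∈ G ∧ r.2.2.1 ≤ K ∧ r.2.2.2 ≤ K}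

theorem finite_states (G : Finset (List Program)) (K : ℕ) : (states G K).Finite := by
  have h : (Set.univ ×ˢ ((G : Set (List Program)) ×ˢ (Set.Iic K ×ˢ Set.Iic K)) :
      Set Control).Finite :=
    Set.finite_univ.prod (G.finite_toSet.prod ((Set.finite_Iic K).prod (Set.finite_Iic K)))
  exact h.subset fun r hr => ⟨trivial, hr.1, hr.2.1, hr.2.2⟩

theorem transition_mem_states {G : Finset (List Program)} {K : ℕ}
    (hG : ∀ l ∈ G, ∀ N, (exec (l, N)).1 ∈ G) (hK : ∀ l ∈ G, modulus l ≤ K ∧ ∀ s, factor s l ≤ K)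
    {r : Control} (hr : r ∈ states G K) (b₁ b₂ : Bool) : transition r b₁ b₂ ∈ states G K := by
  have hgrow : ∀ l ∈ G, ∀ s ≤ K, ∀ j ≤ K, growBy l s j ∈ states G K := by
    intro l hl s hs j hj
    cases j
    · exact ⟨hl, hs, Nat.zero_le _⟩
    · exact ⟨hl, hs, (Nat.le_succ _).trans hj⟩
  have hfinish : ∀ l ∈ G, ∀ s ≤ K, ∀ j ≤ K, finishBy l s j ∈ states G K := by
    intro l hl s hs j hj
    cases j
    · exact ⟨hG l hl s, Nat.zero_le _, Nat.zero_le _⟩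
    · exact ⟨hl, hs, (Nat.le_succ _).trans hj⟩
  obtain ⟨_ | _ | _ | _ | _ | _, l, s, j⟩ := r <;> obtain ⟨h1, h2, h3⟩ := hr <;>
    simp only at h1 h2 h3 <;> simp only [transition]
  · split_ifs with h4 h5 h6
    · exact ⟨h1, Nat.zero_le _, Nat.zero_le _⟩
    · exact ⟨h1, Nat.zero_le _, Nat.zero_le _⟩
    · exact ⟨h1, (not_le.1 h5).trans_le (hK l h1).1, Nat.zero_le _⟩
    · exact ⟨h1, h2, Nat.zero_le _⟩
  · exact ⟨h1, Nat.zero_le _, Nat.zero_le _⟩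
  · split_ifs
    · exact ⟨h1, h2, Nat.zero_le _⟩
    · exact hfinish l h1 s h2 s h2
  · exact hgrow l h1 s h2 _ ((hK l h1).2 s)
  · exact hgrow l h1 s h2 j h3
  · exact hfinish l h1 s h2 j h3

/-- A finite set of states which is closed under transitions is a simplified counter machine. -/
theorem exists_scm_semiconj {F : Set Control} (hF : F.Finite)
    (h : ∀ r ∈ F, ∀ b₁ b₂, transition r b₁ b₂ ∈ F) {r₀ : Control} (hr₀ : r₀ ∈ F) :
    ∃ (m : ℕ) (M : SCM m) (s₀ : Fin m), ∀ t x,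
      (M.step^[t] (s₀, x)).2 = (move^[t] (r₀, x)).2 := by
  have := hF.fintype
  let e := Fintype.equivFin F
  let M : SCM (Fintype.card F) :=
    { α := fun s b₁ b₂ => e ⟨transition (e.symm s).1 b₁ b₂, h _ (e.symm s).2 _ _⟩
      β := fun s => change (e.symm s).1
      β_mem := fun s => change_mem _
      consistent₁ := fun s b₁ b₂ hb => (change_transition (e.symm s).1 b₁ b₂).1 (by simpa using hb)
      consistent₂ := fun s b₁ b₂ hb => (change_transition (e.symm s).1 b₁ b₂).2 (by simpa using hb) }
  have hsemi : Function.Semiconj (Prod.map (fun s => (e.symm s).1) id) M.step move := by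
    intro p
    simp [SCM.step, move, enter, M]
  refine ⟨_, M, e ⟨r₀, hr₀⟩, fun t x => ?_⟩
  have h1 := hsemi.iterate_right t (e ⟨r₀, hr₀⟩, x)
  have h2 := congrArg Prod.snd h1
  simpa using h2

theorem bounded_of_fixed {c : Control × ℕ × ℕ} {t : ℕ} (h : move (move^[t] c) = move^[t] c) :
    ∃ Z, ∀ n, (move^[n] c).2.1 ≤ Z ∧ (move^[n] c).2.2 ≤ Z := by
  refine ⟨∑ n ∈ Finset.range (t + 1), ((move^[n] c).2.1 + (move^[n] c).2.2), fun n => ?_⟩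
  have hn : move^[n] c = move^[min n t] c := by
    rcases le_total n t with h' | h'
    · rw [min_eq_left h']
    · obtain ⟨k, rfl⟩ := Nat.exists_eq_add_of_le h'
      rw [min_eq_right h', add_comm, Function.iterate_add_apply, Function.iterate_fixed h]
  have h1 := Finset.single_le_sum (s := Finset.range (t + 1))
    (f := fun n => (move^[n] c).2.1 + (move^[n] c).2.2)
    (fun _ _ => Nat.zero_le _) (Finset.mem_range.2 (Nat.lt_succ_of_le (min_le_right n t)))
  rw [hn]
  omega

/-- For every primitive recursive function `g` there is a simplified counter machine which, started
with the counters `2 ^ n` and `0`, stays bounded if and only if `g (n, ·)` has a zero. -/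
theorem exists_scm {g : List.Vector ℕ 2 → ℕ} (hg : Nat.Primrec' g) :
    ∃ (m : ℕ) (M : SCM m) (s₀ : Fin m), ∀ n,
      (∃ Z, ∀ t i, SCM.counter (M.step^[t] (s₀, 2 ^ n, 0)) i ≤ Z) ↔ ∃ k, g (n ::ᵥ k ::ᵥ .nil) = 0 := by
  obtain ⟨p, hp⟩ := exists_implements hg Fin.val 2 3 (fun i => by omega) (fun i => by omega)
    (by omega)
  obtain ⟨K, hK⟩ := exists_bound (insert [] ((search p).support []))
  have hG : ∀ l ∈ insert [] ((search p).support []), ∀ N,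
      (exec (l, N)).1 ∈ insert [] ((search p).support []) := by
    intro l hl N
    rcases Finset.mem_insert.1 hl with rfl | hl
    · exact Finset.mem_insert_self _ _
    · exact exec_mem_support _ _ N hl
  have h0 : ((.divide, [search p], 0, 0) : Control) ∈
      states (insert [] ((search p).support [])) K :=
    ⟨Finset.mem_insert_of_mem (cons_mem_support _ _), Nat.zero_le _, Nat.zero_le _⟩
  obtain ⟨m, M, s₀, hM⟩ := exists_scm_semiconj (finite_states _ K)
    (fun r hr b₁ b₂ => transition_mem_states hG hK hr b₁ b₂) h0
  refine ⟨m, M, s₀, fun n => ?_⟩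
  constructor
  · rintro ⟨Z, hZ⟩
    by_contra hne
    obtain ⟨l, N, h1, h2⟩ := hp.leads_large (fun k hk => hne ⟨k, hk⟩) Z
    obtain ⟨t, ht⟩ := h1.moves.exists_iterate
    have h3 := hZ t 0
    rw [SCM.counter, if_pos rfl, hM, ht] at h3
    exact absurd h3 (not_le.2 h2)
  · rintro ⟨k, hk⟩
    obtain ⟨N, h1⟩ := hp.leads_nil hk
    obtain ⟨t, ht⟩ := h1.moves.exists_iterate
    obtain ⟨Z, hZ⟩ := bounded_of_fixed (t := t) (by rw [ht]; exact move_nil N)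
    refine ⟨Z, fun t i => ?_⟩
    rw [SCM.counter, hM]
    split_ifs
    · exact (hZ t).1
    · exact (hZ t).2

end Program

namespace Network

/-! ### Isomorphisms of networks -/

variable {S C S' C' : Type}

/-- The equivalences `eS` and `eC` of servers and classes identify two networks. -/
structure Iso (N : Network S C) (N' : Network S' C') (eS : S ≃ S') (eC : C ≃ C') : Prop where
  server : ∀ c, N'.server (eC c) = eS (N.server c)
  interarrival : ∀ c, N'.interarrival (eC c) = N.interarrival c
  delay : ∀ c, N'.delay (eC c) = N.delay c
  service : ∀ c, N'.service (eC c) = N.service c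
  capacity : ∀ c, N'.capacity (eC c) = N.capacity c
  next : ∀ c, N'.next (eC c) = (N.next c).map eC

/-- The equivalences identify two states. -/
structure StateIso (eS : S ≃ S') (eC : C ≃ C') (x : State S C) (x' : State S' C') : Prop where
  waiting : ∀ c, x'.waiting (eC c) = x.waiting c
  serving : ∀ s, x'.serving (eS s) = (x.serving s).map (Prod.map eC id)

namespace Iso

variable {N : Network S C} {N' : Network S' C'} {eS : S ≃ S'} {eC : C ≃ C'}
  {x : State S C} {x' : State S' C'} {θ : C → ℕ} {θ' : C' → ℕ} {D : ℕ}

section Dynamics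

variable (h : N.Iso N' eS eC) (hx : StateIso eS eC x x') (hθ : ∀ c, θ' (eC c) = θ c)

include h

theorem next_eq_iff (d c : C) : N'.next (eC d) = some (eC c) ↔ N.next d = some c := by
  rw [h.next, Option.map_eq_some_iff]
  simp

theorem server_eq_iff (d c : C) : N'.server (eC d) = N'.server (eC c) ↔ N.server d = N.server c := by
  rw [h.server, h.server, eS.apply_eq_iff_eq]

theorem acyclic (hN : N.Acyclic) : N'.Acyclic := by
  obtain ⟨r, hr⟩ := hN
  refine ⟨fun c => r (eC.symm c), eC.forall_congr_right.1 fun c => eC.forall_congr_right.1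
    fun d hcd => ?_⟩
  simp only [eC.symm_apply_apply]
  exact hr c d ((h.next_eq_iff c d).1 hcd)

theorem onGrid (hN : N.OnGrid D) : N'.OnGrid D where
  pos := hN.pos
  interarrival_pos := eC.forall_congr_right.1 fun c => by
    rw [h.interarrival]; exact hN.interarrival_pos c
  interarrival := eC.forall_congr_right.1 fun c => by
    rw [h.interarrival]; exact hN.interarrival c
  delay := eC.forall_congr_right.1 fun c => by rw [h.delay]; exact hN.delay c
  service := eC.forall_congr_right.1 fun c => by rw [h.service]; exact hN.service c

theorem routed [Fintype C] [DecidableEq C] [Fintype C'] [DecidableEq C'] {y : C → ℕ} {y' : C' → ℕ}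
    (hy : ∀ c, y' (eC c) = y c) (c : C) : N'.routed y' (eC c) = N.routed y c := by
  rw [Network.routed, ← eC.sum_comp]
  exact Finset.sum_congr rfl fun d _ => if_congr (h.next_eq_iff d c) (hy d) rfl

theorem isTop {w : C → ℕ} {w' : C' → ℕ} (hθ : ∀ c, θ' (eC c) = θ c) (hw : ∀ c, w' (eC c) = w c)
    (c : C) : N'.IsTop θ' w' (eC c) ↔ N.IsTop θ w c := by
  rw [IsTop, IsTop, hw, ← eC.forall_congr_right]
  simp only [h.server_eq_iff, hw, hθ]

include hx

theorem arrive (t : ℚ) : StateIso eS eC (N.arrive t x) (N'.arrive t x') where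
  waiting c := by
    simp only [Network.arrive, Network.arrivals, hx.waiting]
    classical exact congrArg _ (if_congr (by rw [h.interarrival, h.delay]) rfl rfl)
  serving := hx.serving

theorem serving_eq_some_iff (c : C) (u : ℚ) :
    x'.serving (N'.server (eC c)) = some (eC c, u) ↔ x.serving (N.server c) = some (c, u) := by
  rw [h.server, hx.serving, Option.map_eq_some_iff]
  simp [Prod.ext_iff]

theorem serving_eq_none_iff (c : C) :
    x'.serving (N'.server (eC c)) = none ↔ x.serving (N.server c) = none := by
  rw [h.server, hx.serving, Option.map_eq_none_iff]

theorem queueLength (c : C) : N'.queueLength x' (eC c) = N.queueLength x c := by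
  simp only [Network.queueLength, hx.waiting]
  classical exact congrArg _ (if_congr (exists_congr fun u => h.serving_eq_some_iff hx c u) rfl rfl)

theorem finishing (t : ℚ) (c : C) : N'.finishing t x' (eC c) = N.finishing t x c := by
  classical exact if_congr (exists_congr fun u => by rw [h.serving_eq_some_iff hx, h.service]) rfl rfl

include hθ

theorem immediate (c : C) : N'.immediate θ' x' (eC c) = N.immediate θ x c := by
  classical exact if_congr (by rw [h.serving_eq_none_iff hx, h.isTop hθ hx.waiting, h.service]) rfl rfl

theorem start (hP : N.IsPolicy θ) (t : ℚ) :
    StateIso eS eC (N.start θ t x) (N'.start θ' t x') where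
  waiting c := by
    simp only [Network.start, h.capacity, hx.waiting]
    classical
    refine congrArg (fun n => stored (N.capacity c) (x.waiting c - n)) (if_congr ?_ rfl rfl)
    rw [h.serving_eq_none_iff hx, h.isTop hθ hx.waiting]
  serving s := by
    simp only [Network.start, hx.serving, Option.map_eq_none_iff]
    by_cases h1 : x.serving s = none
    · rw [if_pos h1, if_pos h1]
      have key : ∀ c, N'.server (eC c) = eS s ∧ N'.IsTop θ' x'.waiting (eC c) ↔
          N.server c = s ∧ N.IsTop θ x.waiting c := fun c => by
        rw [h.server, eS.apply_eq_iff_eq, h.isTop hθ hx.waiting]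
      by_cases h2 : ∃ c, N.server c = s ∧ N.IsTop θ x.waiting c
      · have h3 : ∃ c, N'.server c = eS s ∧ N'.IsTop θ' x'.waiting c :=
          h2.elim fun c hc => ⟨eC c, (key c).2 hc⟩
        rw [dif_pos h2, dif_pos h3]
        obtain ⟨c, hc⟩ := eC.surjective h3.choose
        have h4 := h3.choose_spec
        rw [← hc] at h4
        obtain ⟨h5, h6⟩ := (key c).1 h4
        obtain ⟨h7, h8⟩ := h2.choose_spec
        -- both choices are forced, since a policy orders the classes of a server strictly
        have h9 : c = h2.choose := hP _ _ (h5.trans h7.symm) (le_antisymm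
          (h6.2 _ (h7.trans h5.symm) h8.1) (h8.2 _ (h5.trans h7.symm) h6.1))
        rw [← hc, Option.map_some, ← h9]
        rfl
      · have h3 : ¬ ∃ c, N'.server c = eS s ∧ N'.IsTop θ' x'.waiting c := by
          rintro ⟨c, hc⟩
          obtain ⟨c, rfl⟩ := eC.surjective c
          exact h2 ⟨c, (key c).1 hc⟩
        rw [dif_neg h2, dif_neg h3]
        rfl
    · rw [if_neg h1, if_neg h1]

variable [Fintype C] [DecidableEq C] [Fintype C'] [DecidableEq C']

theorem flushStep : StateIso eS eC (N.flushStep θ x) (N'.flushStep θ' x') where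
  waiting c := by
    simp only [Network.flushStep, hx.waiting, h.immediate hx hθ, h.routed (h.immediate hx hθ)]
  serving := hx.serving

theorem flush : StateIso eS eC (N.flush θ x) (N'.flush θ' x') := by
  have h1 : ∑ c, x'.waiting c = ∑ c, x.waiting c := by
    rw [← eC.sum_comp]
    exact Finset.sum_congr rfl fun c _ => hx.waiting c
  rw [Network.flush, Network.flush, h1, ← Fintype.card_congr eC]
  generalize (∑ c, x.waiting c) * Fintype.card C = n
  induction n with
  | zero => exact hx
  | succ n ih =>
    rw [Function.iterate_succ_apply', Function.iterate_succ_apply']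
    exact h.flushStep ih hθ

omit hθ in
theorem complete (t : ℚ) : StateIso eS eC (N.complete t x) (N'.complete t x') where
  waiting c := by
    simp only [Network.complete, hx.waiting, h.routed (h.finishing hx t)]
  serving s := by
    simp only [Network.complete, hx.serving]
    rcases x.serving s with _ | ⟨c, u⟩
    · rfl
    · by_cases hu : u + N.service c = t <;> simp [Option.filter, h.service, hu]

theorem instant (hP : N.IsPolicy θ) (t : ℚ) :
    StateIso eS eC (N.instant θ t x) (N'.instant θ' t x') :=
  h.start (h.flush (h.complete (h.flush (h.arrive hx t) hθ) t) hθ) hθ hP t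

end Dynamics

variable [Fintype C] [DecidableEq C] [Fintype C'] [DecidableEq C'] {q : C → ℕ} {q' : C' → ℕ}

theorem gridState (h : N.Iso N' eS eC) (hθ : ∀ c, θ' (eC c) = θ c) (hP : N.IsPolicy θ)
    (hq : ∀ c, q' (eC c) = q c) (k : ℕ) :
    StateIso eS eC (N.gridState θ q D k) (N'.gridState θ' q' D k) := by
  induction k with
  | zero => exact ⟨hq, fun _ => rfl⟩
  | succ k ih => exact h.instant ih hθ hP _

/-- Isomorphic triplets are stable at the same time. -/
theorem stable_iff [Fintype S] [Fintype S'] (h : N.Iso N' eS eC) (hθ : ∀ c, θ' (eC c) = θ c)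
    (hP : N.IsPolicy θ) (hq : ∀ c, q' (eC c) = q c) (hG : N.OnGrid D) (hN : N.Acyclic) :
    N'.Stable θ' q' ↔ N.Stable θ q := by
  rw [N.stable_iff_gridState hG hN, N'.stable_iff_gridState (h.onGrid hG) (h.acyclic hN)]
  have key : ∀ k, ∑ c, N'.queueLength (N'.gridState θ' q' D (k + 1)) c =
      ∑ c, N.queueLength (N.gridState θ q D (k + 1)) c := fun k => by
    rw [← eC.sum_comp]
    exact Finset.sum_congr rfl fun c _ => h.queueLength (h.gridState hθ hP hq _) c
  simp only [key]

theorem valid (h : N.Iso N' eS eC) (hV : N.Valid) (hN : N.Acyclic) : N'.Valid := by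
  refine ⟨eC.forall_congr_right.1 fun c => ?_, eC.forall_congr_right.1 fun c => ?_,
    eC.forall_congr_right.1 fun c => ?_, (h.acyclic hN).spectralRadius_routing⟩
  · rw [h.interarrival]; exact hV.1 c
  · rw [h.delay]; exact hV.2.1 c
  · rw [h.service]; exact hV.2.2.1 c

omit [Fintype C] [DecidableEq C] [Fintype C'] [DecidableEq C'] in
theorem isPolicy (h : N.Iso N' eS eC) (hθ : ∀ c, θ' (eC c) = θ c) (hP : N.IsPolicy θ) :
    N'.IsPolicy θ' := by
  refine eC.forall_congr_right.1 fun c => eC.forall_congr_right.1 fun d h1 h2 => ?_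
  rw [hθ, hθ] at h2
  rw [hP c d ((h.server_eq_iff c d).1 h1) h2]

theorem totalRate (h : N.Iso N' eS eC) (hN : N.Acyclic) (c : C) :
    N'.totalRate (eC c) = N.totalRate c := by
  have h1 := (h.acyclic hN).totalRate_eq (v := fun c => N.totalRate (eC.symm c))
    (eC.forall_congr_right.1 fun c => ?_)
  · simp only [h1, eC.symm_apply_apply]
  · rw [← eC.sum_comp]
    simp only [eC.symm_apply_apply, h.next_eq_iff]
    have h2 : N'.externalRate (eC c) = N.externalRate c := by
      rw [externalRate, externalRate, h.interarrival]
    rw [h2]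
    exact hN.totalRate_apply c

/-- Isomorphic networks have the same load factors. -/
theorem load [DecidableEq S] [DecidableEq S'] (h : N.Iso N' eS eC) (hN : N.Acyclic) (s : S) :
    N'.load (eS s) = N.load s := by
  rw [Network.load, Network.load, Finset.sum_filter, Finset.sum_filter, ← eC.sum_comp]
  refine Finset.sum_congr rfl fun c _ => ?_
  exact if_congr (by rw [h.server, eS.apply_eq_iff_eq]) (by rw [h.totalRate hN, h.service]) rfl

end Iso

end Network

open Primrec

/-! ### Descriptions of networks -/

/-- The description of a nonnegative rational number. -/
def pairOf (r : ℚ) : ℕ × ℕ := (r.num.toNat, r.den - 1)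

theorem ratOf_pairOf {r : ℚ} (hr : 0 ≤ r) : ratOf (pairOf r) = r := by
  have h1 : ((r.num.toNat : ℕ) : ℚ) = (r.num : ℚ) := by
    exact_mod_cast Int.toNat_of_nonneg (Rat.num_nonneg.2 hr)
  have h2 : ((r.den - 1 : ℕ) : ℚ) + 1 = r.den := by
    exact_mod_cast Nat.sub_add_cancel r.den_pos
  rw [ratOf, pairOf]
  simp only [h1, h2]
  exact Rat.num_div_den r

namespace Network

section Describe

variable {S C : Type} [Fintype S] [Fintype C] (N : Network S C) (θ q : C → ℕ)

/-- The description of a class, in terms of numberings of the servers and classes. -/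
noncomputable def classSpec (c : C) : ClassSpec where
  server := Fintype.equivFin S (N.server c)
  arrival := (N.interarrival c).map fun a => (pairOf a, pairOf (N.delay c))
  service := pairOf (N.service c)
  capacity := N.capacity c
  next := (N.next c).map fun d => (Fintype.equivFin C d : ℕ)
  priority := θ c
  initial := q c

/-- The description of a triplet of a network, a policy and initial queue lengths. -/
noncomputable def describe : NetworkInput where
  numServers := Fintype.card S
  classes := List.ofFn fun i => N.classSpec θ q ((Fintype.equivFin C).symm i)

theorem length_describe : (N.describe θ q).classes.length = Fintype.card C := List.length_ofFn

/-- The number of a class in the description. -/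
noncomputable def classEquiv : C ≃ Fin (N.describe θ q).classes.length :=
  (Fintype.equivFin C).trans (finCongr (N.length_describe θ q).symm)

theorem get_classEquiv (c : C) :
    (N.describe θ q).classes.get (N.classEquiv θ q c) = N.classSpec θ q c := by
  simp only [describe, classEquiv, List.get_eq_getElem, List.getElem_ofFn]
  exact congrArg _ ((Fintype.equivFin C).symm_apply_apply c)

theorem inRange_describe : (N.describe θ q).InRange := by
  refine (N.classEquiv θ q).forall_congr_right.1 fun c => ?_
  rw [get_classEquiv, length_describe]
  refine ⟨Fin.is_lt _, fun d hd => ?_⟩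
  obtain ⟨e, -, rfl⟩ := Option.map_eq_some_iff.1 hd
  exact Fin.is_lt _

theorem policy_describe (c : C) : (N.describe θ q).policy (N.classEquiv θ q c) = θ c := by
  rw [NetworkInput.policy, get_classEquiv]
  rfl

theorem initialQueue_describe (c : C) :
    (N.describe θ q).initialQueue (N.classEquiv θ q c) = q c := by
  rw [NetworkInput.initialQueue, get_classEquiv]
  rfl

variable {N} in
/-- A network with nonnegative data is isomorphic to the one which its description determines. -/
theorem iso_describe [DecidableEq C] (hV : N.Valid)
    (h0 : ∀ c, N.interarrival c = none → N.delay c = 0) :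
    N.Iso ((N.describe θ q).network (N.inRange_describe θ q)) (Fintype.equivFin S)
      (N.classEquiv θ q) where
  server c := by
    refine Fin.ext ?_
    change ((N.describe θ q).classes.get _).server = _
    rw [get_classEquiv]
    rfl
  interarrival c := by
    change ((N.describe θ q).classes.get _).arrival.map _ = _
    rw [get_classEquiv]
    have h1 := hV.1 c
    simp only [classSpec]
    rcases e : N.interarrival c with _ | a
    · rfl
    · exact congrArg some (ratOf_pairOf (h1 a e).le)
  delay c := by
    change (((N.describe θ q).classes.get _).arrival.map _).getD 0 = _
    rw [get_classEquiv]
    have h1 := h0 c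
    simp only [classSpec]
    rcases e : N.interarrival c with _ | a
    · exact (h1 e).symm
    · exact ratOf_pairOf (hV.2.1 c)
  service c := by
    change ratOf ((N.describe θ q).classes.get _).service = _
    rw [get_classEquiv]
    exact ratOf_pairOf (hV.2.2.1 c)
  capacity c := by
    change ((N.describe θ q).classes.get _).capacity = _
    rw [get_classEquiv]
    rfl
  next c := by
    have h1 : ((N.describe θ q).classes.get (N.classEquiv θ q c)).next =
        (N.next c).map fun d => (Fintype.equivFin C d : ℕ) := by rw [get_classEquiv]; rfl
    refine Option.map_injective Fin.val_injective ?_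
    change (Option.pmap Fin.mk _ _).map Fin.val = _
    rw [Option.map_pmap, Option.map_map]
    simp only [Option.pmap_eq_map, Option.map_id_fun', id_eq, h1]
    rfl

variable {θ q} in
theorem computable_describe {q : ℕ → C → ℕ} (hq : ∀ c, Primrec fun n => q n c) :
    Computable fun n => N.describe θ (q n) := by
  have h1 : ∀ c, Primrec fun n => N.classSpec θ (q n) c := fun c =>
    (Primrec.of_equiv_symm (e := ClassSpec.equivTuple)).comp
      ((Primrec.const (N.classSpec θ (q 0) c).server).pair
        ((Primrec.const (N.classSpec θ (q 0) c).arrival).pair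
          ((Primrec.const (N.classSpec θ (q 0) c).service).pair
            ((Primrec.const (N.classSpec θ (q 0) c).capacity).pair
              ((Primrec.const (N.classSpec θ (q 0) c).next).pair
                ((Primrec.const (N.classSpec θ (q 0) c).priority).pair (hq c)))))))
  have h2 : Primrec fun n => N.describe θ (q n) :=
    (Primrec.of_equiv_symm (e := NetworkInput.equivTuple)).comp
      ((Primrec.const (Fintype.card S)).pair (Primrec.list_ofFn fun i => h1 _))
  exact h2.to_comp

end Describe

end Network

namespace SCM

variable {m : ℕ}

/-- A policy which respects the levels: the classes of each level are ordered by their numbers. -/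
noncomputable def somePolicy (c : Cls m) : ℕ :=
  level c * Fintype.card (Cls m) + Fintype.equivFin (Cls m) c

theorem somePolicy_respectsLevels (M : SCM m) : M.RespectsLevels somePolicy := by
  intro c d _ h
  have h1 := (Fintype.equivFin (Cls m) c).is_lt
  have h2 := Nat.mul_le_mul_right (Fintype.card (Cls m)) (Nat.succ_le_of_lt h)
  rw [Nat.succ_mul] at h2
  rw [somePolicy, somePolicy]
  omega

theorem somePolicy_isPolicy (M : SCM m) : M.network.IsPolicy somePolicy := by
  intro c d _ h
  have h1 := congrArg (· % Fintype.card (Cls m)) h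
  simp only [somePolicy, Nat.mul_add_mod_of_lt (Fin.is_lt _)] at h1
  exact (Fintype.equivFin (Cls m)).injective (Fin.ext h1)

end SCM

/-! ### Undecidability -/

/-- The halting problem is the search for a zero of a primitive recursive function. -/
theorem exists_primrec_halting : ∃ g : List.Vector ℕ 2 → ℕ, Nat.Primrec' g ∧
    ∀ c : Nat.Partrec.Code, (∃ k, g (Encodable.encode c ::ᵥ k ::ᵥ .nil) = 0) ↔ (c.eval 0).Dom := by
  have h1 : Primrec₂ fun x k : ℕ =>
      if (Nat.Partrec.Code.evaln k (Denumerable.ofNat Nat.Partrec.Code x) 0).isSome then 0 else 1 := by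
    have h2 : Primrec fun p : ℕ × ℕ =>
        Nat.Partrec.Code.evaln p.2 (Denumerable.ofNat Nat.Partrec.Code p.1) 0 :=
      Nat.Partrec.Code.primrec_evaln.comp
        ((Primrec.snd.pair ((Primrec.ofNat Nat.Partrec.Code).comp Primrec.fst)).pair
          (Primrec.const 0))
    exact Primrec.ite (Primrec.eq.comp (Primrec.option_isSome.comp h2) (Primrec.const true)) (Primrec.const 0)
      (Primrec.const 1)
  refine ⟨_, Nat.Primrec'.prim_iff₂.2 h1, fun c => ?_⟩
  simp only [List.Vector.head_cons, List.Vector.tail_cons, Denumerable.ofNat_encode]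
  constructor
  · rintro ⟨k, hk⟩
    by_cases hs : (Nat.Partrec.Code.evaln k c 0).isSome
    · obtain ⟨y, hy⟩ := Option.isSome_iff_exists.1 hs
      exact Part.dom_iff_mem.2 ⟨y, Nat.Partrec.Code.evaln_complete.2 ⟨k, hy⟩⟩
    · rw [if_neg hs] at hk
      exact absurd hk one_ne_zero
  · intro h
    obtain ⟨y, hy⟩ := Part.dom_iff_mem.1 h
    obtain ⟨k, hk⟩ := Nat.Partrec.Code.evaln_complete.1 hy
    exact ⟨k, if_pos (Option.isSome_iff_exists.2 ⟨y, hk⟩)⟩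

/-- No algorithm decides the stability of networks whose load factors are less than one. -/
theorem not_decidable_stable : ¬ ∃ f : NetworkInput → Bool, Computable f ∧
    ∀ (I : NetworkInput) (h : I.InRange),
      (I.network h).Valid → (I.network h).IsPolicy I.policy →
        (∀ s, (I.network h).load s < 1) →
          (f I = true ↔ (I.network h).Stable I.policy I.initialQueue) := by
  rintro ⟨f, hf, hI⟩
  obtain ⟨g, hg, hhalt⟩ := exists_primrec_halting
  obtain ⟨m, M, s₀, hM⟩ := Program.exists_scm hg
  let I : ℕ → NetworkInput := fun n =>
    M.network.describe SCM.somePolicy (SCM.startQueue s₀ (2 ^ n))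
  have hcomp : Computable I := by
    refine M.network.computable_describe fun c => ?_
    simp only [SCM.startQueue]
    split_ifs
    · exact Primrec.const 1
    · exact (Primrec₂.unpaired'.1 Nat.Primrec.pow).comp (Primrec.const 2) Primrec.id
    · exact Primrec.const 0
  have key : ∀ n, f (I n) = true ↔ ∃ k, g (n ::ᵥ k ::ᵥ .nil) = 0 := by
    intro n
    let T := M.setting s₀ (2 ^ n) SCM.somePolicy M.somePolicy_isPolicy M.somePolicy_respectsLevels
    have hiso := Network.iso_describe (N := M.network) SCM.somePolicy
      (SCM.startQueue s₀ (2 ^ n)) T.valid fun c hc => by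
        change ((SCM.arrivalData c).map Prod.snd).getD 0 = 0
        rw [Option.map_eq_none_iff.1 hc]
        rfl
    have hθ := M.network.policy_describe SCM.somePolicy (SCM.startQueue s₀ (2 ^ n))
    have h1 := hI (I n) (M.network.inRange_describe _ _) (hiso.valid T.valid M.acyclic)
      (hiso.isPolicy hθ M.somePolicy_isPolicy) fun s => by
        obtain ⟨s, rfl⟩ := (Fintype.equivFin (Srv m)).surjective s
        exact (hiso.load M.acyclic s).trans_lt (T.load_lt_one s)
    have h2 := hiso.stable_iff hθ M.somePolicy_isPolicy
      (M.network.initialQueue_describe _ _) (M.onGrid s₀.pos) M.acyclic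
    exact (h1.trans h2).trans ((T.stable_iff rfl).trans (hM n))
  refine ComputablePred.halting_problem 0 (ComputablePred.computable_iff.2
    ⟨fun c => f (I (Encodable.encode c)), hf.comp (hcomp.comp Computable.encode), ?_⟩)
  funext c
  exact propext ((hhalt c).symm.trans (key _).symm)

end MQN

theorem mainTheorem6 :
    (∀ (m : ℕ) (M : MQN.SCM m) (s₀ : Fin m) (θ : MQN.Cls m → ℕ),
      M.network.IsPolicy θ → M.RespectsLevels θ →
        M.network.Valid ∧
        (∀ s, M.network.load s < 1) ∧
        (∀ t : ℕ, M.MainStatus θ s₀ (3 * t) (M.config s₀ t).1 ∧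
          M.CounterStatus θ s₀ 0 (3 * t + 1) (M.config s₀ t).2.1 ∧
          M.CounterStatus θ s₀ 1 (3 * t + 1) (M.config s₀ t).2.2) ∧
        (M.network.Stable θ (MQN.SCM.initialQueue s₀) ↔ M.Stable s₀)) ∧
    ¬ ∃ f : MQN.NetworkInput → Bool, Computable f ∧
      ∀ (I : MQN.NetworkInput) (h : I.InRange),
        (I.network h).Valid → (I.network h).IsPolicy I.policy →
          (∀ s, (I.network h).load s < 1) →
            (f I = true ↔ (I.network h).Stable I.policy I.initialQueue) := by
  refine ⟨fun m M s₀ θ h1 h2 => ?_, MQN.not_decidable_stable⟩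
  let T := M.setting s₀ 0 θ h1 h2
  exact ⟨T.valid, T.load_lt_one, fun t => ⟨M.mainStatus s₀ h1 h2 t, M.counterStatus s₀ h1 h2 t 0,
    M.counterStatus s₀ h1 h2 t 1⟩, M.stable_network_iff s₀ h1 h2⟩
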